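/- **Definitions.** An ordered graph is a finite simple graph $G$ on the vertices $1<2<\dots<n$, with $m$ edges. A pattern $P$ is a finite totally ordered vertex set $V(P)$ with two disjoint sets of unordered pairs of vertices, the mandatory edges $M(P)$ and the forbidden edges $F(P)$ (all other pairs are undecided); $E(P)=M(P)\cup F(P)$. $G$ contains $P$ if there is a strictly increasing map from $V(P)$ to $V(G)$ that sends mandatory edges to edges and forbidden edges to non-edges. Detecting the fixed pattern $P$ means deciding, given the adjacency lists of $G$, whether $G$ contains $P$. An anchored pattern is a pattern with a set of vertices marked as anchors. A merge tree for $P$ is a finite rooted tree whose nodes are labelled with anchored patterns, whose root is labelled with $P$ (with some choice of anchors), and in which each node is of one of the following kinds. 1. A leaf, labelled with a pattern that consists of one (mandatory or forbidden) edge and its two endpoints. 2. A node labelled $Q$ with one child labelled $Q'$, where $Q'$ is obtained from $Q$ by deleting a vertex $v$ that lies in no edge of $E(Q)$; the vertices just before and just after $v$ in $Q$, if they exist, are anchors of $Q'$, and every anchor of $Q$ other than $v$ is an anchor of $Q'$. 3. A node labelled $Q$ with two children labelled $Q_1,Q_2$ such that $V(Q)=V(Q_1)\cup V(Q_2)$;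 the edges of $Q$, with their kinds (mandatory or forbidden), are partitioned into those of $Q_1$ and those of $Q_2$; every vertex of $V(Q_1)\cap V(Q_2)$ is an anchor of both $Q_1$ and $Q_2$; every anchor of $Q$ is an anchor of each of $Q_1,Q_2$ that contains it; and no two consecutive vertices of $V(Q)$ are such that one lies only in $V(Q_1)$ and the other only in $V(Q_2)$. The width of a merge tree is the maximum number of anchors of a label. The merge-width of $P$ is the minimum width of a merge tree for $P$ (it is defined exactly if $P$ has a merge tree). Algorithms are programs for a word RAM whose words have $O(\log n)$ bits, with unit cost per operation on words. **Theorem.** Let $\omega$ be a real number such that two $n\times n$ matrices with entries in $\{0,1\}$ can be multiplied in time $O(n^{\omega})$ (over the integers, or only as Boolean matrices). Let $P$ be a fixed pattern of merge-width $p$. If $p\ge 2$, then $P$ can be detected in ordered graphs with $n$ vertices in time $O(n^{\omega p/2})$. For every $p$, it can be detected in time $O(n^{\omega p/2}+n+m)$. The implied constants may depend on $P$ and on the matrix multiplication algorithm. -/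

import Mathlib

/-! ### Patterns and ordered graphs -/

/-- A pattern: a finite totally ordered vertex set, with disjoint sets of mandatory and of
forbidden edges; every other pair of vertices is undecided. -/
structure OrdPattern (α : Type*) [LinearOrder α] where
  verts : Finset α
  mand : SimpleGraph α
  forb : SimpleGraph α
  mand_mem : ∀ u v, mand.Adj u v → u ∈ verts ∧ v ∈ verts
  forb_mem : ∀ u v, forb.Adj u v → u ∈ verts ∧ v ∈ verts
  disj : Disjoint mand forb

/-- The ordered graph `G` on `0 < 1 < ⋯ < n - 1` contains the pattern `P`: some set of vertices
of `G`, matched with the vertices of `P` in increasing order, spans all mandatory edges and no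
forbidden edge. -/
def OrdPattern.ContainedIn {α : Type*} [LinearOrder α] (P : OrdPattern α) {n : ℕ}
    (G : SimpleGraph (Fin n)) : Prop :=
  ∃ f : {x // x ∈ P.verts} ↪o Fin n, ∀ u v : {x // x ∈ P.verts},
    (P.mand.Adj u v → G.Adj (f u) (f v)) ∧ (P.forb.Adj u v → ¬ G.Adj (f u) (f v))

/-! ### Anchored patterns, merge trees, merge-width -/

/-- A pattern some of whose vertices are marked as anchors. -/
structure AnchoredPattern (α : Type*) [LinearOrder α] extends OrdPattern α where
  anchors : Finset α
  anchors_subset : anchors ⊆ verts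

/-- `u` and `v` are consecutive in `S`, with `u` before `v`. -/
def ConsecutiveIn {α : Type*} [LinearOrder α] (S : Finset α) (u v : α) : Prop :=
  u ∈ S ∧ v ∈ S ∧ u < v ∧ ∀ w ∈ S, ¬ (u < w ∧ w < v)

namespace AnchoredPattern

variable {α : Type*} [LinearOrder α]

/-- The pattern consists of a single (mandatory or forbidden) edge and its two endpoints. -/
def IsSingleEdge (Q : AnchoredPattern α) : Prop :=
  ∃ u v : α, u < v ∧ Q.verts = {u, v} ∧
    ((Q.mand = SimpleGraph.edge u v ∧ Q.forb = ⊥) ∨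
      (Q.mand = ⊥ ∧ Q.forb = SimpleGraph.edge u v))

/-- `Q'` is obtained from `Q` by a vertex deletion, that is, `Q` is obtained from `Q'` by a
vertex creation. The created vertex may or may not be an anchor of `Q`, and anchors of `Q'` may
lose their status in `Q`, but no other vertex becomes an anchor. -/
def IsVertexDeletion (Q Q' : AnchoredPattern α) : Prop :=
  ∃ v ∈ Q.verts,
    (∀ u, ¬ Q.mand.Adj v u ∧ ¬ Q.forb.Adj v u) ∧
    Q'.verts = Q.verts.erase v ∧ Q'.mand = Q.mand ∧ Q'.forb = Q.forb ∧
    Q.anchors.erase v ⊆ Q'.anchors ∧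
    ∀ u, ConsecutiveIn Q.verts u v ∨ ConsecutiveIn Q.verts v u → u ∈ Q'.anchors

/-- `Q` is divided into `Q₁` and `Q₂`, that is, `Q` is a merge of `Q₁` and `Q₂`. -/
structure IsDivision (Q Q₁ Q₂ : AnchoredPattern α) : Prop where
  mand_union : Q₁.mand ⊔ Q₂.mand = Q.mand
  forb_union : Q₁.forb ⊔ Q₂.forb = Q.forb
  mand_disj : Disjoint Q₁.mand Q₂.mand
  forb_disj : Disjoint Q₁.forb Q₂.forb
  verts_union : Q₁.verts ∪ Q₂.verts = Q.verts
  common : ∀ v, v ∈ Q₁.verts → v ∈ Q₂.verts → v ∈ Q₁.anchors ∧ v ∈ Q₂.anchors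
  anchors_left : ∀ v ∈ Q.anchors, v ∈ Q₁.verts → v ∈ Q₁.anchors
  anchors_right : ∀ v ∈ Q.anchors, v ∈ Q₂.verts → v ∈ Q₂.anchors
  consecutive : ∀ u v, ConsecutiveIn Q.verts u v →
    ¬ (u ∉ Q₂.verts ∧ v ∉ Q₁.verts) ∧ ¬ (u ∉ Q₁.verts ∧ v ∉ Q₂.verts)

end AnchoredPattern

/-- Merge trees whose root is labelled by the given anchored pattern. -/
inductive MergeTree {α : Type*} [LinearOrder α] : AnchoredPattern α → Type _
  | leaf (Q : AnchoredPattern α) (h : Q.IsSingleEdge) : MergeTree Q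
  | create (Q Q' : AnchoredPattern α) (h : Q.IsVertexDeletion Q') (t : MergeTree Q') :
      MergeTree Q
  | merge (Q Q₁ Q₂ : AnchoredPattern α) (h : Q.IsDivision Q₁ Q₂) (t₁ : MergeTree Q₁)
      (t₂ : MergeTree Q₂) : MergeTree Q

/-- The maximum number of anchors over the nodes of the tree. -/
def MergeTree.width {α : Type*} [LinearOrder α] :
    {Q : AnchoredPattern α} → MergeTree Q → ℕ
  | _, .leaf Q _ => Q.anchors.card
  | _, .create Q _ _ t => max Q.anchors.card t.width
  | _, .merge Q _ _ _ t₁ t₂ => max Q.anchors.card (max t₁.width t₂.width)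

/-- `p` is the merge-width of `P`: the minimum width of a merge tree for `P`. -/
def OrdPattern.HasMergeWidth {α : Type*} [LinearOrder α] (P : OrdPattern α) (p : ℕ) : Prop :=
  IsLeast {w : ℕ | ∃ Q : AnchoredPattern α, Q.toOrdPattern = P ∧
    ∃ t : MergeTree Q, t.width = w} p

/-! ### The machine model: a word RAM with structured programs

A program uses finitely many scalar variables and finitely many random-access arrays. Every
operation on words costs one unit of time. -/

namespace WordRAM

structure State where
  var : ℕ → ℕ
  arr : ℕ → ℕ → ℕ

inductive Op
  | add | sub | mul | div | mod | lt | eq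

/-- Subtraction is truncated at `0`; comparisons return `0` or `1`. -/
def Op.eval : Op → ℕ → ℕ → ℕ
  | .add, x, y => x + y
  | .sub, x, y => x - y
  | .mul, x, y => x * y
  | .div, x, y => x / y
  | .mod, x, y => x % y
  | .lt, x, y => if x < y then 1 else 0
  | .eq, x, y => if x = y then 1 else 0

inductive Expr
  | const (k : ℕ)
  | var (x : ℕ)
  | load (a : ℕ) (i : Expr)
  | bin (o : Op) (e₁ e₂ : Expr)

def Expr.eval (s : State) : Expr → ℕ
  | .const k => k
  | .var x => s.var x
  | .load a i => s.arr a (i.eval s)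
  | .bin o e₁ e₂ => o.eval (e₁.eval s) (e₂.eval s)

/-- The number of elementary operations in the evaluation of an expression. -/
def Expr.cost : Expr → ℕ
  | .const _ => 1
  | .var _ => 1
  | .load _ i => i.cost + 1
  | .bin _ e₁ e₂ => e₁.cost + e₂.cost + 1

/-- All values (and addresses) that occur in the evaluation of the expression are smaller than
`W`, so that they fit in a word of `log₂ W` bits. -/
def Expr.Fits (W : ℕ) (s : State) : Expr → Prop
  | .const k => k < W
  | .var x => s.var x < W
  | .load a i => i.Fits W s ∧ s.arr a (i.eval s) < W
  | .bin o e₁ e₂ => e₁.Fits W s ∧ e₂.Fits W s ∧ o.eval (e₁.eval s) (e₂.eval s) < W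

inductive Cmd
  | skip
  | assign (x : ℕ) (e : Expr)
  | store (a : ℕ) (i e : Expr)
  | seq (c₁ c₂ : Cmd)
  | branch (e : Expr) (c₁ c₂ : Cmd)
  | loop (e : Expr) (c : Cmd)

def State.setVar (s : State) (x v : ℕ) : State :=
  { s with var := Function.update s.var x v }

def State.setArr (s : State) (a i v : ℕ) : State :=
  { s with arr := Function.update s.arr a (Function.update (s.arr a) i v) }

/-- `Exec W c s t s'`: started in state `s`, on words with values smaller than `W`, the program
`c` halts after `t` units of time in state `s'`. There is no such `t` and `s'` if the
computation produces a value that does not fit in a word. -/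
inductive Exec (W : ℕ) : Cmd → State → ℕ → State → Prop
  | skip (s : State) : Exec W .skip s 1 s
  | assign (s : State) (x : ℕ) (e : Expr) (he : e.Fits W s) :
      Exec W (.assign x e) s (e.cost + 1) (s.setVar x (e.eval s))
  | store (s : State) (a : ℕ) (i e : Expr) (hi : i.Fits W s) (he : e.Fits W s) :
      Exec W (.store a i e) s (i.cost + e.cost + 1) (s.setArr a (i.eval s) (e.eval s))
  | seq {s s' s'' : State} {t t' : ℕ} {c₁ c₂ : Cmd}
      (h₁ : Exec W c₁ s t s') (h₂ : Exec W c₂ s' t' s'') :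
      Exec W (.seq c₁ c₂) s (t + t') s''
  | branch_true {s s' : State} {t : ℕ} {e : Expr} {c₁ c₂ : Cmd} (he : e.Fits W s)
      (hb : e.eval s ≠ 0) (h : Exec W c₁ s t s') :
      Exec W (.branch e c₁ c₂) s (e.cost + 1 + t) s'
  | branch_false {s s' : State} {t : ℕ} {e : Expr} {c₁ c₂ : Cmd} (he : e.Fits W s)
      (hb : e.eval s = 0) (h : Exec W c₂ s t s') :
      Exec W (.branch e c₁ c₂) s (e.cost + 1 + t) s'
  | loop_done {s : State} {e : Expr} {c : Cmd} (he : e.Fits W s) (hb : e.eval s = 0) :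
      Exec W (.loop e c) s (e.cost + 1) s
  | loop_step {s s' s'' : State} {t t' : ℕ} {e : Expr} {c : Cmd} (he : e.Fits W s)
      (hb : e.eval s ≠ 0) (h₁ : Exec W c s t s') (h₂ : Exec W (.loop e c) s' t' s'') :
      Exec W (.loop e c) s (e.cost + 1 + t + t') s''

end WordRAM

/-! ### The two computational problems -/

open Classical in
/-- A 0/1 matrix, stored row by row in an array. -/
noncomputable def matrixArray {n : ℕ} (A : Matrix (Fin n) (Fin n) Bool) (k : ℕ) : ℕ :=
  if ∃ i j : Fin n, k = (i : ℕ) * n + (j : ℕ) ∧ A i j = true then 1 else 0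

/-- Input of matrix multiplication: `n` in variable `0`, the matrices in arrays `0` and `1`;
everything else is `0`. -/
noncomputable def matMulInput {n : ℕ} (A B : Matrix (Fin n) (Fin n) Bool) : WordRAM.State where
  var x := if x = 0 then n else 0
  arr a := if a = 0 then matrixArray A else if a = 1 then matrixArray B else fun _ => 0

/-- Two `n × n` matrices with entries in `{0, 1}` can be multiplied in time `O(n ^ ω)` on a word
RAM with words of `O(log n)` bits. The product is written row by row in array `2`; all that is
required is that an entry is nonzero exactly if it is so in the product, so that programs for
the product over the integers and programs for the Boolean product are both covered. -/
def MatMulInTime (ω : ℝ) : Prop :=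
  ∃ (prog : WordRAM.Cmd) (c : ℕ) (C : ℝ), ∀ n : ℕ, 1 ≤ n →
    ∀ A B : Matrix (Fin n) (Fin n) Bool, ∃ (t : ℕ) (s : WordRAM.State),
      WordRAM.Exec ((n + 2) ^ c) prog (matMulInput A B) t s ∧
      (t : ℝ) ≤ C * (n : ℝ) ^ ω ∧
      ∀ i j : Fin n, s.arr 2 ((i : ℕ) * n + (j : ℕ)) ≠ 0 ↔
        ∃ k : Fin n, A i k = true ∧ B k j = true

/-- `adj` is an adjacency-list description of `G`; the order within a list is arbitrary. -/
def IsAdjacencyList {n : ℕ} (G : SimpleGraph (Fin n)) (adj : Fin n → List (Fin n)) : Prop :=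
  ∀ v : Fin n, (adj v).Nodup ∧ ∀ w : Fin n, w ∈ adj v ↔ G.Adj v w

/-- Input of pattern detection: `n` in variable `0`; array `1` holds the concatenation of the
adjacency lists of the vertices `0, …, n - 1`, and the list of vertex `i` occupies the positions
from `arr 0 i` up to `arr 0 (i + 1) - 1`; everything else is `0`. -/
def detectionInput {n : ℕ} (adj : Fin n → List (Fin n)) : WordRAM.State where
  var x := if x = 0 then n else 0
  arr a k :=
    if a = 0 then (if k ≤ n then ((List.ofFn adj).take k).flatten.length else 0)
    else if a = 1 then ((List.ofFn adj).flatten.map (fun v : Fin n => (v : ℕ))).getD k 0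
    else 0

/-- The problem of detecting the fixed pattern `P` in ordered graphs with `n` vertices and `m`
edges can be solved in time `O(T n m)` on a word RAM with words of `O(log n)` bits. The answer is
in variable `0`, with nonzero meaning yes. -/
def OrdPattern.DetectableInTime {α : Type*} [LinearOrder α] (P : OrdPattern α)
    (T : ℕ → ℕ → ℝ) : Prop :=
  ∃ (prog : WordRAM.Cmd) (c : ℕ) (C : ℝ), ∀ (n : ℕ) (G : SimpleGraph (Fin n))
    (adj : Fin n → List (Fin n)), IsAdjacencyList G adj →
      ∃ (t : ℕ) (s : WordRAM.State),
        WordRAM.Exec ((n + 2) ^ c) prog (detectionInput adj) t s ∧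
        (s.var 0 ≠ 0 ↔ P.ContainedIn G) ∧
        (1 ≤ n → (t : ℝ) ≤ C * T n G.edgeSet.ncard)

/-! ### Basic facts about the word RAM -/

namespace WordRAM

/-! A merge tree is a recipe for dynamic programming. For each label `Q`, one tabulates which
placements of its anchors in the graph extend to a placement of all of `Q`
(`AnchoredPattern.Extends`). At width `p` such a table has at most `n ^ p` entries, and the pattern
is contained in the graph exactly if the table of the root has a true entry.

The conditions on the nodes are what is needed to compute a table from those of the children.
Monotonicity of a placement has to be checked on consecutive vertices only
(`lt_of_forall_consecutiveIn`). In a division the parts share only anchors, and any two consecutive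
vertices lie in a common part, so placements of the parts that agree on the shared anchors glue
together (`AnchoredPattern.IsDivision.extends_iff`). A created vertex has no edges, so it is
constrained only by its neighbours in the order, which are anchors of the child
(`AnchoredPattern.extends_create_iff`). A node thus amounts to joins: a conjunction of two relations
in at most `p` variables each, projected to at most `p` variables.

A join takes time `n ^ (ω * p / 2)` (`TableComputable.join`). Variables that occur in only one of
the three variable sets are projected away beforehand. The others form a set `D`, contained in all
three, and sets `X`, `E`, `Z`, each contained in exactly two. For fixed values on `D`, the join is
the Boolean product of an `X` by `E` matrix and an `E` by `Z` matrix, and any two of `X`, `E`, `Z`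
have together at most `p - |D|` elements. The excess of the largest set over the second largest is
enumerated along with `D`. If `σ` variables are enumerated and the matrices have `n ^ k` rows, then
`σ + 2 * k ≤ p`, and the cost `n ^ (σ + ω * k)` is at most `n ^ (ω * p / 2)` because `2 ≤ ω`. That
inequality holds since a product can have `n ^ 2` nonzero entries, all of which must be written
(`MatMulInTime.two_le`).

For `p ≤ 1` there may be no time for a table over pairs of vertices. Single edges are then handled
by searching the adjacency lists in time `n + m`, and created vertices by prefix disjunctions
(`TableComputable.scan`).

On the machine, arrays are zero initially and are never cleared: every table gets a new array, and
every call of the matrix program gets a fresh block of addresses. `Triple` carries along the time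
bound and the polynomial bound on words. -/

theorem Expr.Fits.mono {W W' : ℕ} (h : W ≤ W') {s : State} :
    ∀ {e : Expr}, e.Fits W s → e.Fits W' s
  | .const _, he => lt_of_lt_of_le he h
  | .var _, he => lt_of_lt_of_le he h
  | .load _ _, he => ⟨he.1.mono h, lt_of_lt_of_le he.2 h⟩
  | .bin _ _ _, he => ⟨he.1.mono h, he.2.1.mono h, lt_of_lt_of_le he.2.2 h⟩

theorem Expr.Fits.eval_lt {W : ℕ} {s : State} : ∀ {e : Expr}, e.Fits W s → e.eval s < W
  | .const _, he => he
  | .var _, he => he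
  | .load _ _, he => he.2
  | .bin _ _ _, he => he.2.2

theorem Exec.mono {W W' : ℕ} (h : W ≤ W') {c : Cmd} {s s' : State} {t : ℕ}
    (hx : Exec W c s t s') : Exec W' c s t s' := by
  induction hx with
  | skip s => exact .skip s
  | assign s x e he => exact .assign s x e (he.mono h)
  | store s a i e hi he => exact .store s a i e (hi.mono h) (he.mono h)
  | seq _ _ ih₁ ih₂ => exact .seq ih₁ ih₂
  | branch_true he hb _ ih => exact .branch_true (he.mono h) hb ih
  | branch_false he hb _ ih => exact .branch_false (he.mono h) hb ih
  | loop_done he hb => exact .loop_done (he.mono h) hb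
  | loop_step he hb _ _ ih₁ ih₂ => exact .loop_step (he.mono h) hb ih₁ ih₂

/-- Multiplication is the worst case: one operation at most squares the bound on words, so an
expression of fixed size keeps polynomially bounded words polynomially bounded. -/
theorem Op.eval_lt {V x y : ℕ} (hV : 2 ≤ V) (hx : x < V) (hy : y < V) (o : Op) :
    o.eval x y < V * V := by
  have h1 : V + V ≤ V * V := by nlinarith
  cases o with
  | add => simp only [Op.eval]; omega
  | sub => simp only [Op.eval]; omega
  | mul => exact Nat.mul_lt_mul'' hx hy
  | div => exact lt_of_le_of_lt (Nat.div_le_self x y) (by omega)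
  | mod => exact lt_of_le_of_lt (Nat.mod_le x y) (by omega)
  | lt => simp only [Op.eval]; split <;> omega
  | eq => simp only [Op.eval]; split <;> omega

/-- The variables that occur in an expression. -/
def Expr.vars : Expr → Set ℕ
  | .const _ => ∅
  | .var x => {x}
  | .load _ i => i.vars
  | .bin _ e₁ e₂ => e₁.vars ∪ e₂.vars

/-- The arrays that occur in an expression. -/
def Expr.arrs : Expr → Set ℕ
  | .const _ => ∅
  | .var _ => ∅
  | .load a i => insert a i.arrs
  | .bin _ e₁ e₂ => e₁.arrs ∪ e₂.arrs

theorem Expr.eval_congr {s s' : State} : ∀ {e : Expr}, (∀ x ∈ e.vars, s.var x = s'.var x) →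
    (∀ a ∈ e.arrs, s.arr a = s'.arr a) → e.eval s = e.eval s'
  | .const _, _, _ => rfl
  | .var _, hv, _ => hv _ rfl
  | .load a i, hv, ha => by
      simp only [Expr.eval]
      rw [Expr.eval_congr (e := i) hv fun b hb => ha b (Or.inr hb), ha a (Or.inl rfl)]
  | .bin o e₁ e₂, hv, ha => by
      simp only [Expr.eval]
      rw [Expr.eval_congr (e := e₁) (fun b hb => hv b (Or.inl hb)) fun b hb => ha b (Or.inl hb),
        Expr.eval_congr (e := e₂) (fun b hb => hv b (Or.inr hb)) fun b hb => ha b (Or.inr hb)]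

theorem Expr.Fits.congr {W : ℕ} {s s' : State} : ∀ {e : Expr}, e.Fits W s →
    (∀ x ∈ e.vars, s.var x = s'.var x) → (∀ a ∈ e.arrs, s.arr a = s'.arr a) → e.Fits W s'
  | .const _, h, _, _ => h
  | .var x, h, hv, _ => by
      have := hv x rfl
      simp only [Expr.Fits] at h ⊢
      rwa [← this]
  | .load a i, h, hv, ha => by
      have hi := Expr.eval_congr (e := i) hv fun b hb => ha b (Or.inr hb)
      refine ⟨Expr.Fits.congr h.1 hv fun b hb => ha b (Or.inr hb), ?_⟩
      rw [← hi, ← ha a (Or.inl rfl)]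
      exact h.2
  | .bin o e₁ e₂, h, hv, ha => by
      have h1 := Expr.eval_congr (e := e₁) (fun b hb => hv b (Or.inl hb))
        fun b hb => ha b (Or.inl hb)
      have h2 := Expr.eval_congr (e := e₂) (fun b hb => hv b (Or.inr hb))
        fun b hb => ha b (Or.inr hb)
      refine ⟨h.1.congr (fun b hb => hv b (Or.inl hb)) fun b hb => ha b (Or.inl hb),
        h.2.1.congr (fun b hb => hv b (Or.inr hb)) fun b hb => ha b (Or.inr hb), ?_⟩
      rw [← h1, ← h2]
      exact h.2.2

@[simp] theorem State.setVar_var_self (s : State) (x v : ℕ) : (s.setVar x v).var x = v := by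
  simp [State.setVar]

theorem State.setVar_var_ne (s : State) {x y : ℕ} (v : ℕ) (h : y ≠ x) :
    (s.setVar x v).var y = s.var y := by
  simp [State.setVar, h]

@[simp] theorem State.setVar_arr (s : State) (x v : ℕ) : (s.setVar x v).arr = s.arr := rfl

@[simp] theorem State.setArr_var (s : State) (a i v : ℕ) : (s.setArr a i v).var = s.var := rfl

/-! ### Families of computations with polynomially bounded words -/

section Families

variable {ι : Type*} {n : ι → ℕ}

/-- All words in the evaluation of `e` are bounded by a polynomial in the size `n`. -/
def PolyFits (n : ι → ℕ) (P : ι → State → Prop) (e : Expr) : Prop :=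
  ∃ d : ℕ, ∀ i s, P i s → e.Fits ((n i + 2) ^ d) s

/-- The quantity `v` is bounded by a polynomial in the size `n`. -/
def PolyBdd (n : ι → ℕ) (P : ι → State → Prop) (v : ι → State → ℕ) : Prop :=
  ∃ d : ℕ, ∀ i s, P i s → v i s < (n i + 2) ^ d

theorem pow_le_pow_size (m : ℕ) {d d' : ℕ} (h : d ≤ d') : (m + 2) ^ d ≤ (m + 2) ^ d' :=
  Nat.pow_le_pow_right (by omega) h

theorem const_lt_pow_size (m k : ℕ) : k < (m + 2) ^ k :=
  lt_of_lt_of_le k.lt_two_pow_self (Nat.pow_le_pow_left (by omega) k)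

theorem PolyBdd.of_le_const {P : ι → State → Prop} {v : ι → State → ℕ} (k : ℕ)
    (h : ∀ i s, P i s → v i s ≤ k) : PolyBdd n P v :=
  ⟨k, fun i s hs => lt_of_le_of_lt (h i s hs) (const_lt_pow_size _ _)⟩

theorem PolyBdd.of_le_pow {P : ι → State → Prop} {v : ι → State → ℕ} (k : ℕ)
    (h : ∀ i s, P i s → v i s ≤ n i ^ k) : PolyBdd n P v :=
  ⟨k + 1, fun i s hs => lt_of_le_of_lt (h i s hs) (by
    calc n i ^ k ≤ (n i + 2) ^ k := Nat.pow_le_pow_left (by omega) k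
      _ < (n i + 2) ^ (k + 1) := Nat.pow_lt_pow_right (by omega) (by omega))⟩

theorem PolyFits.const {P : ι → State → Prop} (k : ℕ) : PolyFits n P (.const k) :=
  ⟨k, fun _ _ _ => const_lt_pow_size _ k⟩

theorem PolyFits.var {P : ι → State → Prop} {x : ℕ} (h : PolyBdd n P fun _ s => s.var x) :
    PolyFits n P (.var x) := h

theorem PolyFits.load {P : ι → State → Prop} {a : ℕ} {e : Expr} (he : PolyFits n P e)
    (h : PolyBdd n P fun _ s => s.arr a (e.eval s)) : PolyFits n P (.load a e) := by
  obtain ⟨d, hd⟩ := he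
  obtain ⟨d', hd'⟩ := h
  exact ⟨max d d', fun i s hs => ⟨(hd i s hs).mono (pow_le_pow_size _ (le_max_left _ _)),
    lt_of_lt_of_le (hd' i s hs) (pow_le_pow_size _ (le_max_right _ _))⟩⟩

theorem PolyFits.bin {P : ι → State → Prop} {o : Op} {e₁ e₂ : Expr} (h₁ : PolyFits n P e₁)
    (h₂ : PolyFits n P e₂) : PolyFits n P (.bin o e₁ e₂) := by
  obtain ⟨d, hd⟩ := h₁
  obtain ⟨d', hd'⟩ := h₂
  -- A common exponent for both operands, doubled on account of `Op.eval_lt`; the `1` makes the base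
  -- bound at least `2`.
  refine ⟨(d + d' + 1) + (d + d' + 1), fun i s hs => ?_⟩
  have f₁ := (hd i s hs).mono (pow_le_pow_size (n i) (show d ≤ d + d' + 1 by omega))
  have f₂ := (hd' i s hs).mono (pow_le_pow_size (n i) (show d' ≤ d + d' + 1 by omega))
  have hle : (n i + 2) ^ (d + d' + 1) ≤ (n i + 2) ^ ((d + d' + 1) + (d + d' + 1)) :=
    pow_le_pow_size _ (by omega)
  refine ⟨f₁.mono hle, f₂.mono hle, ?_⟩
  rw [pow_add (n i + 2) (d + d' + 1)]
  refine Op.eval_lt ?_ f₁.eval_lt f₂.eval_lt o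
  calc 2 ≤ n i + 2 := by omega
    _ = (n i + 2) ^ 1 := (pow_one _).symm
    _ ≤ _ := pow_le_pow_size _ (by omega)

theorem PolyFits.mono {P P' : ι → State → Prop} {e : Expr} (h : PolyFits n P e)
    (hP : ∀ i s, P' i s → P i s) : PolyFits n P' e := by
  obtain ⟨d, hd⟩ := h
  exact ⟨d, fun i s hs => hd i s (hP i s hs)⟩

/-- Total correctness with asymptotic resource bounds: on all members of the family that satisfy
`P`, the program halts in time `O(T)`, on words of `O(log n)` bits, and its initial and final
states are related by `Q`. -/
def Triple (n : ι → ℕ) (T : ι → ℝ) (P : ι → State → Prop) (c : Cmd)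
    (Q : ι → State → State → Prop) : Prop :=
  ∃ d K : ℕ, ∀ i s, P i s → ∃ (t : ℕ) (s' : State),
    Exec ((n i + 2) ^ d) c s t s' ∧ (t : ℝ) ≤ K * T i ∧ Q i s s'

variable {T T' : ι → ℝ} {P P' : ι → State → Prop} {Q Q' : ι → State → State → Prop} {c c' : Cmd}

theorem Triple.weaken (h : Triple n T P c Q) (hP : ∀ i s, P' i s → P i s)
    (hQ : ∀ i s s', P' i s → Q i s s' → Q' i s s') (hT : ∃ K : ℕ, ∀ i, T i ≤ K * T' i) :
    Triple n T' P' c Q' := by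
  obtain ⟨d, K, h⟩ := h
  obtain ⟨K', hK'⟩ := hT
  refine ⟨d, K * K', fun i s hs => ?_⟩
  obtain ⟨t, s', hx, ht, hq⟩ := h i s (hP i s hs)
  refine ⟨t, s', hx, ht.trans ?_, hQ i s s' hs hq⟩
  push_cast
  rw [mul_assoc]
  exact mul_le_mul_of_nonneg_left (hK' i) (Nat.cast_nonneg K)

/-- The constants of a triple are uniform over its index type, so the initial state can be made part
of the index. Loop invariants can then refer to the state before the loop. -/
theorem Triple.of_ghost
    (h : Triple (ι := ι × State) (fun k => n k.1) (fun k => T k.1)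
      (fun k s => s = k.2 ∧ P k.1 k.2) c (fun k _ s' => Q k.1 k.2 s')) : Triple n T P c Q := by
  obtain ⟨d, K, h⟩ := h
  exact ⟨d, K, fun i s hs => h (i, s) s ⟨rfl, hs⟩⟩

theorem Triple.seq {R : ι → State → State → Prop} (h₁ : Triple n T P c Q)
    (h₂ : Triple n T P' c' Q') (hP : ∀ i s s', P i s → Q i s s' → P' i s')
    (hR : ∀ i s s' s'', P i s → Q i s s' → Q' i s' s'' → R i s s'') :
    Triple n T P (.seq c c') R := by
  obtain ⟨d, K, h₁⟩ := h₁
  obtain ⟨d', K', h₂⟩ := h₂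
  refine ⟨max d d', K + K', fun i s hs => ?_⟩
  obtain ⟨t, s', hx, ht, hq⟩ := h₁ i s hs
  obtain ⟨t', s'', hx', ht', hq'⟩ := h₂ i s' (hP i s s' hs hq)
  refine ⟨t + t', s'', .seq (hx.mono (pow_le_pow_size _ (le_max_left _ _)))
    (hx'.mono (pow_le_pow_size _ (le_max_right _ _))), ?_, hR i s s' s'' hs hq hq'⟩
  push_cast
  linarith

theorem Triple.assign {x : ℕ} {e : Expr} (he : PolyFits n P e) :
    Triple n (fun _ => 1) P (.assign x e) (fun _ s s' => s' = s.setVar x (e.eval s)) := by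
  obtain ⟨d, hd⟩ := he
  exact ⟨d, e.cost + 1, fun i s hs => ⟨e.cost + 1, _, .assign s x e (hd i s hs), by simp, rfl⟩⟩

/-- `if e then a[f] := 1`. -/
theorem Triple.branch_store {e f : Expr} {a : ℕ} (he : PolyFits n P e)
    (hf : PolyFits n (fun i s => P i s ∧ e.eval s ≠ 0) f) :
    Triple n (fun _ => 1) P (.branch e (.store a f (.const 1)) .skip)
      (fun _ s s' => e.eval s ≠ 0 ∧ s' = s.setArr a (f.eval s) 1 ∨ e.eval s = 0 ∧ s' = s) := by
  obtain ⟨d, hd⟩ := he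
  obtain ⟨d', hd'⟩ := hf
  refine ⟨d + d' + 1, e.cost + f.cost + 3, fun i s hs => ?_⟩
  have h1 : (Expr.const 1).Fits ((n i + 2) ^ (d + d' + 1)) s := by
    simp only [Expr.Fits]
    calc 1 < n i + 2 := by omega
      _ = (n i + 2) ^ 1 := (pow_one _).symm
      _ ≤ _ := pow_le_pow_size _ (by omega)
  have he := (hd i s hs).mono (pow_le_pow_size (n i) (show d ≤ d + d' + 1 by omega))
  by_cases hb : e.eval s = 0
  · refine ⟨e.cost + 1 + 1, s, .branch_false he hb (.skip s), ?_, by simp [hb]⟩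
    push_cast
    have : (0 : ℝ) ≤ f.cost := Nat.cast_nonneg _
    linarith
  · refine ⟨e.cost + 1 + (f.cost + (Expr.const 1).cost + 1), s.setArr a (f.eval s) 1,
      .branch_true he hb (.store s a f (.const 1)
        ((hd' i s ⟨hs, hb⟩).mono (pow_le_pow_size _ (by omega))) h1), ?_, by simp [hb]⟩
    simp only [Expr.cost]
    push_cast
    linarith

/-- `for x = 0, …, L - 1 do c`. -/
def forLoop (x : ℕ) (L : Expr) (c : Cmd) : Cmd :=
  .seq (.assign x (.const 0))
    (.loop (.bin .lt (.var x) L) (.seq c (.assign x (.bin .add (.var x) (.const 1)))))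

/-- Induction on the number of remaining iterations. The body has to preserve the counter and to
establish the next invariant in the state in which the counter has already been increased, so the
increment needs no reasoning by the user. In the time bound, the `1` per iteration pays for the test
and the increment. -/
theorem Triple.forLoop {x : ℕ} {Le : Expr} {L : ι → ℕ} {Tb : ι → ℕ → ℝ}
    {Inv : ι → ℕ → State → Prop} (hTb : ∀ i k, 0 ≤ Tb i k)
    (hL : ∀ i k s, Inv i k s → Le.eval s = L i)
    (hLf : PolyFits n (fun i s => ∃ k, Inv i k s) Le)
    (hb : Triple (ι := ι × ℕ) (fun k => n k.1) (fun k => Tb k.1 k.2)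
      (fun k s => k.2 < L k.1 ∧ s.var x = k.2 ∧ Inv k.1 k.2 s) c
      (fun k _ s' => s'.var x = k.2 ∧ Inv k.1 (k.2 + 1) (s'.setVar x (k.2 + 1)))) :
    Triple n (fun i => 1 + ∑ k ∈ Finset.range (L i), (1 + Tb i k))
      (fun i s => Inv i 0 (s.setVar x 0)) (forLoop x Le c)
      (fun i _ s' => s'.var x = L i ∧ Inv i (L i) s') := by
  obtain ⟨dL, hdL⟩ := hLf
  obtain ⟨d, K, hb⟩ := hb
  set D := d + dL + 1 with hD
  set g : Expr := .bin .lt (.var x) Le with hg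
  -- Per iteration, the test costs `g.cost + 1` and the increment `4`; this gives `g.cost + 5`. The
  -- last, failing test is paid for by the leading `1`.
  have hloop : ∀ (i : ι) (r k : ℕ) (s : State), k + r = L i → s.var x = k → Inv i k s →
      ∃ (t : ℕ) (s' : State), Exec ((n i + 2) ^ D)
        (.loop g (.seq c (.assign x (.bin .add (.var x) (.const 1))))) s t s' ∧
        (t : ℝ) ≤ (K + g.cost + 5 : ℕ) * (1 + ∑ j ∈ Finset.Ico k (L i), (1 + Tb i j)) ∧
        s'.var x = L i ∧ Inv i (L i) s' := by
    intro i r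
    induction r with
    | zero =>
      intro k s hk hx hI
      have hk' : k = L i := by omega
      subst hk'
      have hLs := (hdL i s ⟨_, hI⟩)
      have hLD := hLs.mono (pow_le_pow_size (n i) (show dL ≤ D by omega))
      have hgf : g.Fits ((n i + 2) ^ D) s := by
        refine ⟨?_, hLD, ?_⟩
        · simp only [Expr.Fits]
          rw [hx, ← hL i _ s hI]
          exact hLD.eval_lt
        · simp only [Op.eval]
          have : 1 < (n i + 2) ^ D := Nat.one_lt_pow (by omega) (by omega)
          split <;> omega
      have hg0 : g.eval s = 0 := by
        simp [hg, Expr.eval, Op.eval, hx, hL i _ s hI]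
      refine ⟨_, s, .loop_done hgf hg0, ?_, hx, hI⟩
      simp only [Finset.Ico_self, Finset.sum_empty]
      push_cast
      have : (0 : ℝ) ≤ K := Nat.cast_nonneg _
      linarith
    | succ r ih =>
      intro k s hk hx hI
      have hkL : k < L i := by omega
      have hLs := (hdL i s ⟨_, hI⟩)
      have hLD := hLs.mono (pow_le_pow_size (n i) (show dL ≤ D by omega))
      have hlt := hLD.eval_lt
      rw [hL i _ s hI] at hlt
      have h1D : 1 < (n i + 2) ^ D := Nat.one_lt_pow (by omega) (by omega)
      have hgf : g.Fits ((n i + 2) ^ D) s := by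
        refine ⟨?_, hLD, ?_⟩
        · simp only [Expr.Fits]
          omega
        · simp only [Op.eval]
          split <;> omega
      have hg1 : g.eval s ≠ 0 := by
        simp [hg, Expr.eval, Op.eval, hx, hL i _ s hI, hkL]
      obtain ⟨t₁, s₁, e₁, ht₁, hx₁, hI₁⟩ := hb (i, k) s ⟨hkL, hx, hI⟩
      obtain ⟨t₂, s₂, e₂, ht₂, hx₂, hI₂⟩ := ih (k + 1) (s₁.setVar x (k + 1)) (by omega)
        (by simp) hI₁
      have hinc : Exec ((n i + 2) ^ D) (.assign x (.bin .add (.var x) (.const 1))) s₁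
          ((Expr.bin .add (.var x) (.const 1)).cost + 1) (s₁.setVar x (k + 1)) := by
        have := Exec.assign (W := (n i + 2) ^ D) s₁ x (.bin .add (.var x) (.const 1))
          ⟨by simp only [Expr.Fits]; simp only at hx₁; omega,
            by simp only [Expr.Fits]; omega,
            by simp only [Expr.eval, Op.eval]; simp only at hx₁; omega⟩
        simpa [Expr.eval, Op.eval, hx₁] using this
      refine ⟨_, s₂, .loop_step hgf hg1
        (.seq (e₁.mono (pow_le_pow_size (n i) (show d ≤ D by omega))) hinc) e₂, ?_, hx₂, hI₂⟩
      rw [Finset.sum_eq_sum_Ico_succ_bot hkL]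
      simp only [Expr.cost] at ht₁ ht₂ ⊢
      push_cast at ht₁ ht₂ ⊢
      have h3 : (0 : ℝ) ≤ K := Nat.cast_nonneg _
      have h4 : (0 : ℝ) ≤ g.cost := Nat.cast_nonneg _
      have h5 := hTb i k
      set S := ∑ j ∈ Finset.Ico (k + 1) (L i), (1 + Tb i j)
      nlinarith [mul_nonneg h4 h5]
  refine ⟨D, K + g.cost + 5 + 2, fun i s hI => ?_⟩
  have h0 : Exec ((n i + 2) ^ D) (.assign x (.const 0)) s 2 (s.setVar x 0) :=
    Exec.assign s x (.const 0) (by simp only [Expr.Fits]; positivity)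
  obtain ⟨t, s', e, ht, hx, hI'⟩ := hloop i (L i) 0 (s.setVar x 0) (by omega) (by simp) hI
  refine ⟨_, s', .seq h0 e, ?_, hx, hI'⟩
  rw [← Finset.range_eq_Ico] at ht
  push_cast at ht ⊢
  have h6 : 0 ≤ ∑ j ∈ Finset.range (L i), (1 + Tb i j) :=
    Finset.sum_nonneg fun j _ => by linarith [hTb i j]
  nlinarith

/-! ### Scattering loops -/

/-- `for x = 0, …, L - 1 do if e then a[f] := 1`. -/
def scatter (x : ℕ) (L e : Expr) (a : ℕ) (f : Expr) : Cmd :=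
  WordRAM.forLoop x L (.branch e (.store a f (.const 1)) .skip)

open Classical in
/-- The effect of `scatter` with `k` iterations. -/
noncomputable def scatterState (x : ℕ) (e : Expr) (a : ℕ) (f : Expr) (s : State) (k : ℕ) :
    State where
  var := Function.update s.var x k
  arr := Function.update s.arr a fun j =>
    if ∃ l < k, e.eval (s.setVar x l) ≠ 0 ∧ f.eval (s.setVar x l) = j then 1 else s.arr a j

theorem scatterState_succ (x : ℕ) (e : Expr) (a : ℕ) (f : Expr) (s : State) (k : ℕ) :
    (if e.eval (s.setVar x k) ≠ 0 then
      (scatterState x e a f s k).setArr a (f.eval (s.setVar x k)) 1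
      else scatterState x e a f s k).setVar x (k + 1) = scatterState x e a f s (k + 1) := by
  have hsplit : ∀ j, (∃ l < k + 1, e.eval (s.setVar x l) ≠ 0 ∧ f.eval (s.setVar x l) = j) ↔
      (e.eval (s.setVar x k) ≠ 0 ∧ f.eval (s.setVar x k) = j) ∨
      ∃ l < k, e.eval (s.setVar x l) ≠ 0 ∧ f.eval (s.setVar x l) = j := by
    intro j
    constructor
    · rintro ⟨l, hl, h⟩
      rcases Nat.lt_succ_iff_lt_or_eq.mp hl with h' | rfl
      · exact Or.inr ⟨l, h', h⟩
      · exact Or.inl h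
    · rintro (h | ⟨l, hl, h⟩)
      · exact ⟨k, by omega, h⟩
      · exact ⟨l, by omega, h⟩
  simp only [scatterState, hsplit]
  by_cases hb : e.eval (s.setVar x k) = 0
  · simp only [hb, ne_eq, not_true_eq_false, if_false, false_and, false_or]
    simp [State.setVar]
  · simp only [hb, ne_eq, not_false_eq_true, if_true, true_and]
    simp only [State.setArr, State.setVar, Function.update_idem, Function.update_self,
      State.mk.injEq, true_and]
    congr 1
    funext j
    by_cases hj : f.eval { var := Function.update s.var x k, arr := s.arr } = j
    · subst hj
      simp only [Function.update_self, true_or, if_true]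
    · rw [Function.update_of_ne (Ne.symm hj)]
      simp only [hj, false_or]
      congr

/-- Since `Le`, `e` and `f` do not read the array that is written, their values in the running state
are those in the initial state with the counter replaced. Hence the final state has a closed form,
which serves as the invariant. -/
theorem Triple.scatter {x : ℕ} {Le e : Expr} {a : ℕ} {f : Expr} {L : ι → ℕ}
    (hL : ∀ i s, P i s → Le.eval s = L i) (hLf : PolyFits n P Le)
    (hLx : x ∉ Le.vars) (hLa : a ∉ Le.arrs) (hea : a ∉ e.arrs) (hfa : a ∉ f.arrs)
    (he : PolyFits n (fun i s => ∃ s₀, P i s₀ ∧ ∃ k < L i, s = s₀.setVar x k) e)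
    (hf : PolyFits n (fun i s => (∃ s₀, P i s₀ ∧ ∃ k < L i, s = s₀.setVar x k) ∧
      e.eval s ≠ 0) f) :
    Triple n (fun i => 1 + L i) P (WordRAM.scatter x Le e a f)
      (fun i s s' => s' = scatterState x e a f s (L i)) := by
  have hvar : ∀ (g : Expr), a ∉ g.arrs → ∀ s k, g.eval (scatterState x e a f s k) =
      g.eval (s.setVar x k) := fun g hg s k =>
    Expr.eval_congr (fun y _ => rfl) fun b hb => by
      have : b ≠ a := fun h => hg (h ▸ hb)
      simp [scatterState, this]
  have hfit : ∀ (g : Expr), a ∉ g.arrs → ∀ s k W, g.Fits W (s.setVar x k) →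
      g.Fits W (scatterState x e a f s k) := fun g hg s k W h =>
    h.congr (fun y _ => rfl) fun b hb => by
      have : b ≠ a := fun h => hg (h ▸ hb)
      simp [scatterState, this]
  apply Triple.of_ghost
  have key := Triple.forLoop (ι := ι × State) (n := fun k => n k.1) (x := x) (Le := Le)
    (L := fun k => L k.1) (Tb := fun _ _ => 1)
    (Inv := fun j k s => P j.1 j.2 ∧ k ≤ L j.1 ∧ s = scatterState x e a f j.2 k)
    (c := .branch e (.store a f (.const 1)) .skip) (fun _ _ => zero_le_one) ?_ ?_ ?_
  · refine key.weaken ?_ ?_ ⟨2, fun i => ?_⟩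
    · rintro ⟨i, s₀⟩ s ⟨rfl, hs⟩
      refine ⟨hs, by simp, ?_⟩
      simp [scatterState, State.setVar]
    · rintro ⟨i, s₀⟩ s s' - ⟨-, -, -, h⟩
      exact h
    · simp only [Finset.sum_const, Finset.card_range, nsmul_eq_mul]
      push_cast
      linarith
  · rintro ⟨i, s₀⟩ k s ⟨hs, -, rfl⟩
    rw [← hL i s₀ hs]
    simp only
    rw [hvar Le hLa]
    exact Expr.eval_congr (fun y hy => State.setVar_var_ne _ _ fun (h : y = x) => hLx (h ▸ hy))
      fun _ _ => rfl
  · obtain ⟨d, hd⟩ := hLf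
    refine ⟨d, ?_⟩
    rintro ⟨i, s₀⟩ s ⟨k, hs, -, rfl⟩
    refine hfit Le hLa _ _ _ ((hd i s₀ hs).congr (fun y hy => ?_) fun _ _ => rfl)
    exact (State.setVar_var_ne _ _ fun (h : y = x) => hLx (h ▸ hy)).symm
  · refine (Triple.branch_store (ι := (ι × State) × ℕ) (n := fun k => n k.1.1) ?_ ?_).weaken
      (fun i s h => h) ?_ ⟨1, fun i => by simp⟩
    · obtain ⟨d, hd⟩ := he
      refine ⟨d, ?_⟩
      rintro ⟨⟨i, s₀⟩, k⟩ s ⟨hk, -, hs, -, rfl⟩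
      exact hfit e hea _ _ _ (hd i _ ⟨s₀, hs, k, hk, rfl⟩)
    · obtain ⟨d, hd⟩ := hf
      refine ⟨d, ?_⟩
      rintro ⟨⟨i, s₀⟩, k⟩ s ⟨⟨hk, -, hs, -, rfl⟩, hne⟩
      rw [hvar e hea] at hne
      exact hfit f hfa _ _ _ (hd i _ ⟨⟨s₀, hs, k, hk, rfl⟩, hne⟩)
    · rintro ⟨⟨i, s₀⟩, k⟩ s s' ⟨hk, -, hs, -, rfl⟩ h
      rw [hvar e hea, hvar f hfa] at h
      have hsucc := scatterState_succ x e a f s₀ k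
      rcases h with ⟨h, rfl⟩ | ⟨h, rfl⟩
      · rw [if_pos h] at hsucc
        exact ⟨by simp [scatterState], hs, hk, hsucc⟩
      · rw [if_neg (not_not.mpr h)] at hsucc
        exact ⟨by simp [scatterState], hs, hk, hsucc⟩

open Classical in
/-- The effect of two nested scattering loops on the arrays. -/
noncomputable def scatterArr₂ (x y : ℕ) (e : Expr) (a : ℕ) (f : Expr) (s : State) (k : ℕ)
    (M : ℕ → ℕ) : ℕ → ℕ → ℕ :=
  Function.update s.arr a fun j =>
    if ∃ l < k, ∃ m < M l, e.eval ((s.setVar x l).setVar y m) ≠ 0 ∧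
      f.eval ((s.setVar x l).setVar y m) = j then 1 else s.arr a j

/-- The inner bound may depend on the outer counter, as is needed to traverse adjacency lists. The
last value of the inner counter is not tracked, so the final state is described only up to the two
counters. -/
theorem Triple.scatter₂ {x y : ℕ} (hxy : x ≠ y) {Lx Ly e : Expr} {a : ℕ} {f : Expr} {L : ι → ℕ}
    {M : ι → ℕ → ℕ} (hL : ∀ i s, P i s → Lx.eval s = L i) (hLf : PolyFits n P Lx)
    (hM : ∀ i s, P i s → ∀ k < L i, Ly.eval (s.setVar x k) = M i k)
    (hMf : PolyFits n (fun i s => ∃ s₀, P i s₀ ∧ ∃ k < L i, s = s₀.setVar x k) Ly)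
    (hLx : x ∉ Lx.vars) (hLy : y ∉ Lx.vars) (hMy : y ∉ Ly.vars) (hLa : a ∉ Lx.arrs)
    (hMa : a ∉ Ly.arrs) (hea : a ∉ e.arrs) (hfa : a ∉ f.arrs)
    (he : PolyFits n (fun i s => ∃ s₀, P i s₀ ∧ ∃ k < L i, ∃ l < M i k,
      s = (s₀.setVar x k).setVar y l) e)
    (hf : PolyFits n (fun i s => (∃ s₀, P i s₀ ∧ ∃ k < L i, ∃ l < M i k,
      s = (s₀.setVar x k).setVar y l) ∧ e.eval s ≠ 0) f) :
    Triple n (fun i => 1 + ∑ k ∈ Finset.range (L i), (1 + (1 + (M i k : ℝ)))) P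
      (WordRAM.forLoop x Lx (WordRAM.scatter y Ly e a f))
      (fun i s s' => (∀ z, z ≠ x → z ≠ y → s'.var z = s.var z) ∧
        s'.arr = scatterArr₂ x y e a f s (L i) (M i)) := by
  apply Triple.of_ghost
  have hne : ∀ {g : Expr} {b : ℕ}, a ∉ g.arrs → b ∈ g.arrs → b ≠ a := fun hg hb h => hg (h ▸ hb)
  have hnx : ∀ {g : Expr} {w z : ℕ}, w ∉ g.vars → z ∈ g.vars → z ≠ w := fun hg hb h => hg (h ▸ hb)
  have hev : ∀ (g : Expr), a ∉ g.arrs → ∀ (s₀ s : State) (k l K : ℕ) (N : ℕ → ℕ), s.var x = k →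
      (∀ z, z ≠ x → z ≠ y → s.var z = s₀.var z) → s.arr = scatterArr₂ x y e a f s₀ K N →
      (∀ z ∈ g.vars, (s.setVar y l).var z = ((s₀.setVar x k).setVar y l).var z) ∧
      ∀ b ∈ g.arrs, (s.setVar y l).arr b = ((s₀.setVar x k).setVar y l).arr b := by
    intro g hg s₀ s k l K N hk hz hs
    refine ⟨fun z _ => ?_, fun b hb => ?_⟩
    · by_cases hy : z = y
      · subst hy; simp
      · rw [State.setVar_var_ne _ _ hy, State.setVar_var_ne _ _ hy]
        by_cases hx : z = x
        · subst hx; simp [hk]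
        · rw [State.setVar_var_ne _ _ hx, hz z hx hy]
    · simp [hs, scatterArr₂, hne hg hb]
  have key := Triple.forLoop (ι := ι × State) (n := fun k => n k.1) (x := x) (Le := Lx)
    (L := fun k => L k.1) (Tb := fun i k => 1 + (M i.1 k : ℝ))
    (Inv := fun j k s => P j.1 j.2 ∧ k ≤ L j.1 ∧ (∀ z, z ≠ x → z ≠ y → s.var z = j.2.var z) ∧
      s.arr = scatterArr₂ x y e a f j.2 k (M j.1))
    (c := WordRAM.scatter y Ly e a f) (fun _ _ => by positivity) ?_ ?_ ?_
  · refine key.weaken ?_ ?_ ⟨1, fun i => by simp⟩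
    · rintro ⟨i, s₀⟩ s ⟨rfl, hs⟩
      exact ⟨hs, by simp, fun z hz _ => State.setVar_var_ne _ _ hz, by simp [scatterArr₂]⟩
    · rintro ⟨i, s₀⟩ s s' - ⟨-, -, -, h⟩
      exact h
  · rintro ⟨i, s₀⟩ k s ⟨hs, -, hz, ha⟩
    rw [← hL i s₀ hs]
    exact Expr.eval_congr (fun z h => hz z (hnx hLx h) (hnx hLy h)) fun b hb => by
      simp [ha, scatterArr₂, hne hLa hb]
  · obtain ⟨d, hd⟩ := hLf
    refine ⟨d, ?_⟩
    rintro ⟨i, s₀⟩ s ⟨k, hs, -, hz, ha⟩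
    exact (hd i s₀ hs).congr (fun z h => (hz z (hnx hLx h) (hnx hLy h)).symm) fun b hb => by
      simp [ha, scatterArr₂, hne hLa hb]
  · have hMs : ∀ (g : Expr), a ∉ g.arrs → y ∉ g.vars → ∀ (s₀ s : State) (k K : ℕ) (N : ℕ → ℕ),
        s.var x = k → (∀ z, z ≠ x → z ≠ y → s.var z = s₀.var z) →
        s.arr = scatterArr₂ x y e a f s₀ K N →
        (∀ z ∈ g.vars, s.var z = (s₀.setVar x k).var z) ∧
        ∀ b ∈ g.arrs, s.arr b = (s₀.setVar x k).arr b := by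
      intro g hg hy s₀ s k K N hk hz hs
      refine ⟨fun z hzv => ?_, fun b hb => ?_⟩
      · by_cases hx : z = x
        · subst hx; simp [hk]
        · rw [State.setVar_var_ne _ _ hx, hz z hx (hnx hy hzv)]
      · simp [hs, scatterArr₂, hne hg hb]
    refine (Triple.scatter (ι := (ι × State) × ℕ) (n := fun k => n k.1.1)
      (L := fun k => M k.1.1 k.2) ?_ ?_ hMy hMa hea hfa ?_ ?_).weaken
      (fun i s h => h) ?_ ⟨1, fun i => by simp⟩
    · rintro ⟨⟨i, s₀⟩, k⟩ s ⟨hk, hx, hs, -, hz, ha⟩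
      obtain ⟨h1, h2⟩ := hMs Ly hMa hMy s₀ s k k _ hx hz ha
      rw [Expr.eval_congr h1 h2]
      exact hM i s₀ hs k hk
    · obtain ⟨d, hd⟩ := hMf
      refine ⟨d, ?_⟩
      rintro ⟨⟨i, s₀⟩, k⟩ s ⟨hk, hx, hs, -, hz, ha⟩
      obtain ⟨h1, h2⟩ := hMs Ly hMa hMy s₀ s k k _ hx hz ha
      exact (hd i _ ⟨s₀, hs, k, hk, rfl⟩).congr (fun z h => (h1 z h).symm) fun b h => (h2 b h).symm
    · obtain ⟨d, hd⟩ := he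
      refine ⟨d, ?_⟩
      rintro ⟨⟨i, s₀⟩, k⟩ _ ⟨s, ⟨hk, hx, hs, -, hz, ha⟩, l, hl, rfl⟩
      obtain ⟨h1, h2⟩ := hev e hea s₀ s k l k _ hx hz ha
      exact (hd i _ ⟨s₀, hs, k, hk, l, hl, rfl⟩).congr (fun z h => (h1 z h).symm)
        fun b h => (h2 b h).symm
    · obtain ⟨d, hd⟩ := hf
      refine ⟨d, ?_⟩
      rintro ⟨⟨i, s₀⟩, k⟩ _ ⟨⟨s, ⟨hk, hx, hs, -, hz, ha⟩, l, hl, rfl⟩, hne⟩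
      obtain ⟨h1, h2⟩ := hev e hea s₀ s k l k _ hx hz ha
      rw [Expr.eval_congr h1 h2] at hne
      obtain ⟨h1, h2⟩ := hev f hfa s₀ s k l k _ hx hz ha
      exact (hd i _ ⟨⟨s₀, hs, k, hk, l, hl, rfl⟩, hne⟩).congr (fun z h => (h1 z h).symm)
        fun b h => (h2 b h).symm
    · rintro ⟨⟨i, s₀⟩, k⟩ s s' ⟨hk, hx, hs, -, hz, ha⟩ rfl
      simp only at hk hx hs hz ha ⊢
      refine ⟨by simp [scatterState, hxy, hx], hs, hk, fun z h1 h2 => ?_, ?_⟩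
      · rw [State.setVar_var_ne _ _ h1, ← hz z h1 h2]
        simp [scatterState, h2]
      · have h1 : ∀ l, e.eval (s.setVar y l) = e.eval ((s₀.setVar x k).setVar y l) := fun l =>
          Expr.eval_congr (hev e hea s₀ s k l k _ hx hz ha).1 (hev e hea s₀ s k l k _ hx hz ha).2
        have h2 : ∀ l, f.eval (s.setVar y l) = f.eval ((s₀.setVar x k).setVar y l) := fun l =>
          Expr.eval_congr (hev f hfa s₀ s k l k _ hx hz ha).1 (hev f hfa s₀ s k l k _ hx hz ha).2
        simp only [State.setVar_arr, scatterState, h1, h2]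
        funext b
        by_cases hb : b = a
        · subst hb
          simp only [Function.update_self, ha, scatterArr₂]
          funext j
          have hsplit : (∃ l < k + 1, ∃ m < M i l,
              e.eval ((s₀.setVar x l).setVar y m) ≠ 0 ∧
                f.eval ((s₀.setVar x l).setVar y m) = j) ↔
              (∃ m < M i k, e.eval ((s₀.setVar x k).setVar y m) ≠ 0 ∧
                f.eval ((s₀.setVar x k).setVar y m) = j) ∨
              ∃ l < k, ∃ m < M i l, e.eval ((s₀.setVar x l).setVar y m) ≠ 0 ∧
                f.eval ((s₀.setVar x l).setVar y m) = j := by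
            constructor
            · rintro ⟨l, hl, h⟩
              rcases Nat.lt_succ_iff_lt_or_eq.mp hl with h' | rfl
              · exact Or.inr ⟨l, h', h⟩
              · exact Or.inl h
            · rintro (h | ⟨l, hl, h⟩)
              · exact ⟨k, by omega, h⟩
              · exact ⟨l, by omega, h⟩
          rw [if_congr hsplit rfl rfl, ite_or]
        · simp [hb, ha, scatterArr₂]

/-! ### Prefix disjunctions -/

/-- `for x = 0, …, L - 1 do if a[x] or e then a[x + 1] := 1`. -/
def prefixOr (x : ℕ) (L e : Expr) (a : ℕ) : Cmd :=
  WordRAM.forLoop x L (.branch (.bin .add (.load a (.var x)) e)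
    (.store a (.bin .add (.var x) (.const 1)) (.const 1)) .skip)

open Classical in
/-- The truth value of a proposition as a bit. -/
noncomputable def bit (p : Prop) : ℕ := if p then 1 else 0

theorem bit_ne_zero {p : Prop} : bit p ≠ 0 ↔ p := by simp [bit]

theorem bit_eq_one {p : Prop} (h : p) : bit p = 1 := by simp [bit, h]

theorem bit_eq_zero {p : Prop} (h : ¬ p) : bit p = 0 := by simp [bit, h]

theorem bit_le_one {p : Prop} : bit p ≤ 1 := by
  unfold bit
  split <;> omega

/-- The effect of `prefixOr` with `k` iterations on an array that is initially zero. -/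
noncomputable def prefixOrState (x : ℕ) (e : Expr) (a : ℕ) (s : State) (k : ℕ) : State where
  var := Function.update s.var x k
  arr := Function.update s.arr a fun j =>
    bit (j ≤ k ∧ ∃ l < j, e.eval (s.setVar x l) ≠ 0)

theorem prefixOrState_eval {x : ℕ} {e : Expr} {a : ℕ} {g : Expr} (hg : a ∉ g.arrs) (s : State)
    (k : ℕ) : g.eval (prefixOrState x e a s k) = g.eval (s.setVar x k) :=
  Expr.eval_congr (fun y _ => rfl) fun b hb => by
    have : b ≠ a := fun h => hg (h ▸ hb)
    simp [prefixOrState, this]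

theorem prefixOrState_fits {x : ℕ} {e : Expr} {a : ℕ} {g : Expr} (hg : a ∉ g.arrs) {s : State}
    {k W : ℕ} (h : g.Fits W (s.setVar x k)) : g.Fits W (prefixOrState x e a s k) :=
  h.congr (fun y _ => rfl) fun b hb => by
    have : b ≠ a := fun h => hg (h ▸ hb)
    simp [prefixOrState, this]

theorem prefixOrState_ne_zero (x : ℕ) (e : Expr) (a : ℕ) (s : State) (k : ℕ) :
    (prefixOrState x e a s k).arr a k + e.eval (s.setVar x k) ≠ 0 ↔
      ∃ l < k + 1, e.eval (s.setVar x l) ≠ 0 := by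
  have h0 : (prefixOrState x e a s k).arr a k ≠ 0 ↔ ∃ l < k, e.eval (s.setVar x l) ≠ 0 := by
    simp [prefixOrState, bit_ne_zero]
  rw [Ne, Nat.add_eq_zero_iff, not_and_or, ← Ne, h0]
  constructor
  · rintro (⟨l, hl, h⟩ | h)
    · exact ⟨l, by omega, h⟩
    · exact ⟨k, by omega, h⟩
  · rintro ⟨l, hl, h⟩
    rcases Nat.lt_succ_iff_lt_or_eq.mp hl with h' | rfl
    · exact Or.inl ⟨l, h', h⟩
    · exact Or.inr h

theorem prefixOrState_succ_of_ne_zero {x : ℕ} {e : Expr} {a : ℕ} {s : State} {k : ℕ}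
    (hE : ∃ l < k + 1, e.eval (s.setVar x l) ≠ 0) :
    ((prefixOrState x e a s k).setArr a (k + 1) 1).setVar x (k + 1) =
      prefixOrState x e a s (k + 1) := by
  simp only [prefixOrState, State.setArr]
  rw [State.setVar]
  simp only [Function.update_idem, Function.update_self, State.mk.injEq, true_and]
  congr 1
  funext j
  by_cases hj : j = k + 1
  · subst hj
    rw [Function.update_self, bit_eq_one ⟨le_rfl, hE⟩]
  · rw [Function.update_of_ne hj]
    have : j ≤ k + 1 ↔ j ≤ k := by omega
    rw [this]

theorem prefixOrState_succ_of_eq_zero {x : ℕ} {e : Expr} {a : ℕ} {s : State} {k : ℕ}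
    (hE : ¬ ∃ l < k + 1, e.eval (s.setVar x l) ≠ 0) :
    (prefixOrState x e a s k).setVar x (k + 1) = prefixOrState x e a s (k + 1) := by
  simp only [prefixOrState]
  rw [State.setVar]
  simp only [Function.update_idem, State.mk.injEq, true_and]
  congr 1
  funext j
  by_cases hj : j = k + 1
  · subst hj
    rw [bit_eq_zero (by omega), bit_eq_zero (fun h => hE h.2)]
  · have : j ≤ k + 1 ↔ j ≤ k := by omega
    rw [this]

/-- The array serves as its own accumulator: entry `x` already holds the disjunction over the
smaller indices, so all prefix disjunctions together take linear time. -/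
theorem Triple.prefixOr {x : ℕ} {Le e : Expr} {a : ℕ} {L : ι → ℕ}
    (hL : ∀ i s, P i s → Le.eval s = L i) (hLf : PolyFits n P Le) (h0 : ∀ i s, P i s → s.arr a = 0)
    (hLx : x ∉ Le.vars) (hLa : a ∉ Le.arrs) (hea : a ∉ e.arrs)
    (he : PolyFits n (fun i s => ∃ s₀, P i s₀ ∧ ∃ k < L i, s = s₀.setVar x k) e) :
    Triple n (fun i => 1 + L i) P (WordRAM.prefixOr x Le e a)
      (fun i s s' => s' = prefixOrState x e a s (L i)) := by
  apply Triple.of_ghost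
  have key := Triple.forLoop (ι := ι × State) (n := fun k => n k.1) (x := x) (Le := Le)
    (L := fun k => L k.1) (Tb := fun _ _ => 1)
    (Inv := fun j k s => P j.1 j.2 ∧ k ≤ L j.1 ∧ s = prefixOrState x e a j.2 k)
    (c := .branch (.bin .add (.load a (.var x)) e)
      (.store a (.bin .add (.var x) (.const 1)) (.const 1)) .skip) (fun _ _ => zero_le_one) ?_ ?_ ?_
  · refine key.weaken ?_ ?_ ⟨2, fun i => ?_⟩
    · rintro ⟨i, s₀⟩ s ⟨rfl, hs⟩
      refine ⟨hs, by simp, ?_⟩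
      simp only [prefixOrState, State.setVar, State.mk.injEq, true_and]
      funext b
      by_cases hb : b = a
      · subst hb
        rw [h0 i s hs, Function.update_self]
        funext j
        rw [bit_eq_zero]
        · rfl
        · rintro ⟨h, l, hl, -⟩
          omega
      · rw [Function.update_of_ne hb]
    · rintro ⟨i, s₀⟩ s s' - ⟨-, -, -, h⟩
      exact h
    · simp only [Finset.sum_const, Finset.card_range, nsmul_eq_mul]
      push_cast
      linarith
  · rintro ⟨i, s₀⟩ k s ⟨hs, -, rfl⟩
    rw [← hL i s₀ hs]
    simp only
    rw [prefixOrState_eval hLa]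
    exact Expr.eval_congr (fun y hy => State.setVar_var_ne _ _ fun (h : y = x) => hLx (h ▸ hy))
      fun _ _ => rfl
  · obtain ⟨d, hd⟩ := hLf
    refine ⟨d, ?_⟩
    rintro ⟨i, s₀⟩ s ⟨k, hs, -, rfl⟩
    refine prefixOrState_fits hLa ((hd i s₀ hs).congr (fun y hy => ?_) fun _ _ => rfl)
    exact (State.setVar_var_ne _ _ fun (h : y = x) => hLx (h ▸ hy)).symm
  · have hx : PolyFits (ι := (ι × State) × ℕ) (fun k => n k.1.1)
        (fun k s => k.2 < L k.1.1 ∧ s.var x = k.2 ∧ P k.1.1 k.1.2 ∧ k.2 ≤ L k.1.1 ∧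
          s = prefixOrState x e a k.1.2 k.2) (.var x) := by
      obtain ⟨d, hd⟩ := hLf
      refine ⟨d, ?_⟩
      rintro ⟨⟨i, s₀⟩, k⟩ s ⟨hk, hx, hs, -, -⟩
      simp only [Expr.Fits]
      rw [hx]
      exact lt_trans hk (hL i s₀ hs ▸ (hd i s₀ hs).eval_lt)
    refine (Triple.branch_store (ι := (ι × State) × ℕ) (n := fun k => n k.1.1) ?_ ?_).weaken
      (fun i s h => h) ?_ ⟨1, fun i => by simp⟩
    · refine PolyFits.bin (PolyFits.load hx (PolyBdd.of_le_const 1 ?_)) ?_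
      · rintro ⟨⟨i, s₀⟩, k⟩ s ⟨hk, -, hs, -, rfl⟩
        simp only [prefixOrState, Function.update_self]
        exact bit_le_one
      · obtain ⟨d, hd⟩ := he
        refine ⟨d, ?_⟩
        rintro ⟨⟨i, s₀⟩, k⟩ s ⟨hk, -, hs, -, rfl⟩
        exact prefixOrState_fits hea (hd i _ ⟨s₀, hs, k, hk, rfl⟩)
    · exact PolyFits.bin (hx.mono fun i s h => h.1) (PolyFits.const 1)
    · rintro ⟨⟨i, s₀⟩, k⟩ s s' ⟨hk, hxk, hs, -, rfl⟩ h
      simp only [Expr.eval, Op.eval] at hk hxk hs h ⊢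
      rw [prefixOrState_eval hea, hxk] at h
      rcases h with ⟨h, rfl⟩ | ⟨h, rfl⟩
      · rw [prefixOrState_ne_zero] at h
        exact ⟨by simp [prefixOrState], hs, hk, prefixOrState_succ_of_ne_zero h⟩
      · have h' := mt (prefixOrState_ne_zero x e a s₀ k).mpr (not_not.mpr h)
        exact ⟨by simp [prefixOrState], hs, hk, prefixOrState_succ_of_eq_zero h'⟩

end Families

end WordRAM

/-! ### Running a program inside another one -/

namespace WordRAM

/-- All variables and arrays in the expression have numbers below `V`. -/
def Expr.Below (V : ℕ) : Expr → Prop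
  | .const _ => True
  | .var x => x < V
  | .load a i => a < V ∧ i.Below V
  | .bin _ e₁ e₂ => e₁.Below V ∧ e₂.Below V

/-- All variables and arrays in the program have numbers below `V`. -/
def Cmd.Below (V : ℕ) : Cmd → Prop
  | .skip => True
  | .assign x e => x < V ∧ e.Below V
  | .store a i e => a < V ∧ i.Below V ∧ e.Below V
  | .seq c₁ c₂ => c₁.Below V ∧ c₂.Below V
  | .branch e c₁ c₂ => e.Below V ∧ c₁.Below V ∧ c₂.Below V
  | .loop e c => e.Below V ∧ c.Below V

theorem Expr.Below.mono {V V' : ℕ} (h : V ≤ V') : ∀ {e : Expr}, e.Below V → e.Below V'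
  | .const _, _ => trivial
  | .var _, he => lt_of_lt_of_le he h
  | .load _ _, he => ⟨lt_of_lt_of_le he.1 h, he.2.mono h⟩
  | .bin _ _ _, he => ⟨he.1.mono h, he.2.mono h⟩

theorem Cmd.Below.mono {V V' : ℕ} (h : V ≤ V') : ∀ {c : Cmd}, c.Below V → c.Below V'
  | .skip, _ => trivial
  | .assign _ _, hc => ⟨lt_of_lt_of_le hc.1 h, hc.2.mono h⟩
  | .store _ _ _, hc => ⟨lt_of_lt_of_le hc.1 h, hc.2.1.mono h, hc.2.2.mono h⟩
  | .seq _ _, hc => ⟨hc.1.mono h, hc.2.mono h⟩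
  | .branch _ _ _, hc => ⟨hc.1.mono h, hc.2.1.mono h, hc.2.2.mono h⟩
  | .loop _ _, hc => ⟨hc.1.mono h, hc.2.mono h⟩

theorem Expr.exists_below : ∀ e : Expr, ∃ V, e.Below V
  | .const _ => ⟨0, trivial⟩
  | .var x => ⟨x + 1, Nat.lt_succ_self x⟩
  | .load a i => by
      obtain ⟨V, hV⟩ := i.exists_below
      exact ⟨V + (a + 1), by omega, hV.mono (by omega)⟩
  | .bin _ e₁ e₂ => by
      obtain ⟨V, hV⟩ := e₁.exists_below
      obtain ⟨V', hV'⟩ := e₂.exists_below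
      exact ⟨V + V', hV.mono (by omega), hV'.mono (by omega)⟩

theorem Cmd.exists_below : ∀ c : Cmd, ∃ V, c.Below V
  | .skip => ⟨0, trivial⟩
  | .assign x e => by
      obtain ⟨V, hV⟩ := e.exists_below
      exact ⟨V + (x + 1), by omega, hV.mono (by omega)⟩
  | .store a i e => by
      obtain ⟨V, hV⟩ := i.exists_below
      obtain ⟨V', hV'⟩ := e.exists_below
      exact ⟨V + V' + (a + 1), by omega, hV.mono (by omega), hV'.mono (by omega)⟩
  | .seq c₁ c₂ => by
      obtain ⟨V, hV⟩ := c₁.exists_below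
      obtain ⟨V', hV'⟩ := c₂.exists_below
      exact ⟨V + V', hV.mono (by omega), hV'.mono (by omega)⟩
  | .branch e c₁ c₂ => by
      obtain ⟨V, hV⟩ := e.exists_below
      obtain ⟨V', hV'⟩ := c₁.exists_below
      obtain ⟨V'', hV''⟩ := c₂.exists_below
      exact ⟨V + V' + V'', hV.mono (by omega), hV'.mono (by omega), hV''.mono (by omega)⟩
  | .loop e c => by
      obtain ⟨V, hV⟩ := e.exists_below
      obtain ⟨V', hV'⟩ := c.exists_below
      exact ⟨V + V', hV.mono (by omega), hV'.mono (by omega)⟩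

/-- Variable `x` is renamed `v + x`, array `a` is renamed `M + a`, and all addresses are shifted
by the value of variable `b`. -/
def Expr.embed (v b M : ℕ) : Expr → Expr
  | .const k => .const k
  | .var x => .var (v + x)
  | .load a i => .load (M + a) (.bin .add (.var b) (i.embed v b M))
  | .bin o e₁ e₂ => .bin o (e₁.embed v b M) (e₂.embed v b M)

/-- The renaming of `Expr.embed`, for programs. -/
def Cmd.embed (v b M : ℕ) : Cmd → Cmd
  | .skip => .skip
  | .assign x e => .assign (v + x) (e.embed v b M)
  | .store a i e => .store (M + a) (.bin .add (.var b) (i.embed v b M)) (e.embed v b M)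
  | .seq c₁ c₂ => .seq (c₁.embed v b M) (c₂.embed v b M)
  | .branch e c₁ c₂ => .branch (e.embed v b M) (c₁.embed v b M) (c₂.embed v b M)
  | .loop e c => .loop (e.embed v b M) (c.embed v b M)

/-- The state `σ` holds the state `s`, up to the renaming of `Expr.embed`. Addresses are below
`B`, and they are shifted by `β`. -/
structure Embeds (v b M V B β : ℕ) (s σ : State) : Prop where
  base : σ.var b = β
  var : ∀ x < V, σ.var (v + x) = s.var x
  arr : ∀ a < V, ∀ j < B, σ.arr (M + a) (β + j) = s.arr a j

/-- The states differ only in the part of the memory that is used by an embedded program. -/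
structure SameOutside (v M V B β : ℕ) (σ σ' : State) : Prop where
  var : ∀ x < v, σ'.var x = σ.var x
  arr : ∀ a, a < M ∨ M + V ≤ a → σ'.arr a = σ.arr a
  addr : ∀ a j, j < β ∨ β + B ≤ j → σ'.arr a j = σ.arr a j

theorem SameOutside.rfl' {v M V B β : ℕ} {σ : State} : SameOutside v M V B β σ σ :=
  ⟨fun _ _ => rfl, fun _ _ => rfl, fun _ _ _ => rfl⟩

theorem SameOutside.trans {v M V B β : ℕ} {σ σ' σ'' : State} (h : SameOutside v M V B β σ σ')
    (h' : SameOutside v M V B β σ' σ'') : SameOutside v M V B β σ σ'' :=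
  ⟨fun x hx => (h'.var x hx).trans (h.var x hx), fun a ha => (h'.arr a ha).trans (h.arr a ha),
    fun a j hj => (h'.addr a j hj).trans (h.addr a j hj)⟩

/-- Only array accesses become more expensive, by one read of the base address and one addition. -/
theorem Expr.embed_cost (v b M : ℕ) : ∀ e : Expr, (e.embed v b M).cost ≤ 3 * e.cost
  | .const _ => by simp [Expr.embed, Expr.cost]
  | .var _ => by simp [Expr.embed, Expr.cost]
  | .load _ i => by
      have := i.embed_cost v b M
      simp only [Expr.embed, Expr.cost]
      omega
  | .bin _ e₁ e₂ => by
      have := e₁.embed_cost v b M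
      have := e₂.embed_cost v b M
      simp only [Expr.embed, Expr.cost]
      omega

section Embed

variable {v b M V B β W W' : ℕ}

/-- The guest's addresses are words below `W ≤ B`, so they stay in its block of size `B`, and after
the shift they are below `β + B ≤ W'`. -/
theorem Embeds.eval_and_fits {s σ : State} (h : Embeds v b M V B β s σ) (hWB : W ≤ B)
    (hW' : β + B ≤ W') : ∀ {e : Expr}, e.Below V → e.Fits W s →
    (e.embed v b M).eval σ = e.eval s ∧ (e.embed v b M).Fits W' σ
  | .const k, _, hf => ⟨rfl, by simp only [Expr.embed, Expr.Fits] at hf ⊢; omega⟩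
  | .var x, hb, hf => by
      simp only [Expr.embed, Expr.Fits, Expr.eval, Expr.Below] at hf hb ⊢
      rw [h.var x hb]
      exact ⟨rfl, by omega⟩
  | .load a i, hb, hf => by
      obtain ⟨h1, h2⟩ := h.eval_and_fits hWB hW' hb.2 hf.1
      have h3 := hf.1.eval_lt
      have h4 := hf.2
      have h5 := h.base
      simp only [Expr.embed, Expr.Fits, Expr.eval, Op.eval, h1, h5]
      rw [h.arr a hb.1 _ (by omega)]
      exact ⟨rfl, ⟨by omega, h2, by omega⟩, by omega⟩
  | .bin o e₁ e₂, hb, hf => by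
      obtain ⟨h1, h2⟩ := h.eval_and_fits hWB hW' hb.1 hf.1
      obtain ⟨h3, h4⟩ := h.eval_and_fits hWB hW' hb.2 hf.2.1
      have h5 := hf.2.2
      simp only [Expr.embed, Expr.Fits, Expr.eval, h1, h3]
      exact ⟨trivial, h2, h4, by omega⟩

/-- A simulation, step by step. The bound on words confines the guest to its block, which yields the
frame condition `SameOutside` without any assumption on the program beyond the numbers of its
variables and arrays. -/
theorem Exec.embed (hbv : b < v) (hWB : W ≤ B) (hW' : β + B ≤ W') {c : Cmd} {s s' : State}
    {t : ℕ} (hx : Exec W c s t s') : ∀ (σ : State), c.Below V → Embeds v b M V B β s σ →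
      ∃ (t' : ℕ) (σ' : State), Exec W' (c.embed v b M) σ t' σ' ∧ t' ≤ 3 * t ∧
        Embeds v b M V B β s' σ' ∧ SameOutside v M V B β σ σ' := by
  induction hx with
  | skip s => exact fun σ _ h => ⟨1, σ, .skip σ, by omega, h, .rfl'⟩
  | assign s x e he =>
    intro σ hc h
    obtain ⟨h1, h2⟩ := h.eval_and_fits hWB hW' hc.2 he
    refine ⟨_, _, .assign σ (v + x) _ h2, ?_, ⟨?_, fun y hy => ?_, h.arr⟩, ⟨fun y hy => ?_,
      fun _ _ => rfl, fun _ _ _ => rfl⟩⟩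
    · have := e.embed_cost v b M
      omega
    · rw [State.setVar_var_ne _ _ (by omega), h.base]
    · rw [h1]
      by_cases hxy : y = x
      · subst hxy; simp
      · rw [State.setVar_var_ne _ _ hxy, State.setVar_var_ne _ _ (by omega), h.var y hy]
    · rw [State.setVar_var_ne _ _ (by omega)]
  | store s a i e hi he =>
    intro σ hc h
    obtain ⟨h1, h2⟩ := h.eval_and_fits hWB hW' hc.2.1 hi
    obtain ⟨h3, h4⟩ := h.eval_and_fits hWB hW' hc.2.2 he
    have h5 := h.base
    have h6 := hi.eval_lt
    have hev : (Expr.bin .add (.var b) (i.embed v b M)).eval σ = β + i.eval s := by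
      simp only [Expr.eval, Op.eval, h1, h5]
    refine ⟨_, _, .store σ (M + a) (.bin .add (.var b) (i.embed v b M)) _ ⟨?_, h2, ?_⟩ h4, ?_,
      ⟨h5, h.var, fun a' ha' j hj => ?_⟩, ⟨fun _ _ => rfl, fun a' ha' => ?_, fun a' j hj => ?_⟩⟩
    · simp only [Expr.Fits]
      omega
    · simp only [Expr.eval, Op.eval, h1, h5]
      omega
    · have := e.embed_cost v b M
      have := i.embed_cost v b M
      simp only [Expr.cost]
      omega
    · rw [hev, h3]
      have := h.arr a' ha' j hj
      simp only [State.setArr]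
      by_cases ha : a' = a
      · subst ha
        simp only [Function.update_self]
        by_cases hij : j = i.eval s
        · subst hij; simp
        · rw [Function.update_of_ne (by omega), Function.update_of_ne hij, this]
      · rw [Function.update_of_ne (by omega), Function.update_of_ne ha, this]
    · have := hc.1
      simp only [State.setArr]
      rw [Function.update_of_ne (by omega)]
    · rw [hev]
      simp only [State.setArr]
      by_cases ha : a' = M + a
      · subst ha
        rw [Function.update_self, Function.update_of_ne (by omega)]
      · rw [Function.update_of_ne ha]
  | seq _ _ ih₁ ih₂ =>
    intro σ hc h
    obtain ⟨t₁, σ₁, e₁, ht₁, h₁, f₁⟩ := ih₁ σ hc.1 h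
    obtain ⟨t₂, σ₂, e₂, ht₂, h₂, f₂⟩ := ih₂ σ₁ hc.2 h₁
    exact ⟨_, σ₂, .seq e₁ e₂, by omega, h₂, f₁.trans f₂⟩
  | @branch_true _ _ _ e _ _ he hb _ ih =>
    intro σ hc h
    obtain ⟨h1, h2⟩ := h.eval_and_fits hWB hW' hc.1 he
    obtain ⟨t₁, σ₁, e₁, ht₁, h₁, f₁⟩ := ih σ hc.2.1 h
    have := e.embed_cost v b M
    exact ⟨_, σ₁, .branch_true h2 (h1 ▸ hb) e₁, by omega, h₁, f₁⟩
  | @branch_false _ _ _ e _ _ he hb _ ih =>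
    intro σ hc h
    obtain ⟨h1, h2⟩ := h.eval_and_fits hWB hW' hc.1 he
    obtain ⟨t₁, σ₁, e₁, ht₁, h₁, f₁⟩ := ih σ hc.2.2 h
    have := e.embed_cost v b M
    exact ⟨_, σ₁, .branch_false h2 (h1 ▸ hb) e₁, by omega, h₁, f₁⟩
  | @loop_done _ e _ he hb =>
    intro σ hc h
    obtain ⟨h1, h2⟩ := h.eval_and_fits hWB hW' hc.1 he
    have := e.embed_cost v b M
    exact ⟨_, σ, .loop_done h2 (h1 ▸ hb), by omega, h, .rfl'⟩
  | @loop_step _ _ _ _ _ e _ he hb _ _ ih₁ ih₂ =>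
    intro σ hc h
    obtain ⟨h1, h2⟩ := h.eval_and_fits hWB hW' hc.1 he
    obtain ⟨t₁, σ₁, e₁, ht₁, h₁, f₁⟩ := ih₁ σ hc.2 h
    obtain ⟨t₂, σ₂, e₂, ht₂, h₂, f₂⟩ := ih₂ σ₁ hc h₁
    have := e.embed_cost v b M
    exact ⟨_, σ₂, .loop_step h2 (h1 ▸ hb) e₁ e₂, by omega, h₂, f₁.trans f₂⟩

end Embed

/-! ### Bounds on what a computation can change -/

/-- The specification of a matrix program says only which output entries are nonzero. A caller that
reads them needs a bound on their size, and this one comes from the word size. -/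
theorem Exec.arr_lt {W K : ℕ} (hK : W ≤ K) {c : Cmd} {s s' : State} {t : ℕ}
    (hx : Exec W c s t s') : (∀ a j, s.arr a j < K) → ∀ a j, s'.arr a j < K := by
  induction hx with
  | skip | assign | loop_done => exact id
  | store s a i e hi he =>
    intro h a' j
    simp only [State.setArr]
    rw [Function.update_apply]
    split_ifs with h1
    · rw [Function.update_apply]
      split_ifs
      · exact lt_of_lt_of_le he.eval_lt hK
      · exact h a j
    · exact h a' j
  | seq _ _ ih₁ ih₂ => exact fun h => ih₂ (ih₁ h)
  | branch_true _ _ _ ih => exact ih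
  | branch_false _ _ _ ih => exact ih
  | loop_step _ _ _ _ ih₁ ih₂ => exact fun h => ih₂ (ih₁ h)

/-- Each store takes time and changes one cell. This turns the size of the output into a lower bound
on the running time. -/
theorem Exec.exists_changed {W : ℕ} {c : Cmd} {s s' : State} {t : ℕ} (hx : Exec W c s t s')
    (a : ℕ) : ∃ S : Finset ℕ, S.card ≤ t ∧ ∀ j, j ∉ S → s'.arr a j = s.arr a j := by
  classical
  induction hx with
  | skip | assign | loop_done => exact ⟨∅, by simp, fun _ _ => rfl⟩
  | store s a' i e hi he =>
    refine ⟨{i.eval s}, by simp, fun j hj => ?_⟩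
    simp only [Finset.mem_singleton] at hj
    simp only [State.setArr, Function.update_apply]
    split_ifs with h1
    · rw [h1, Function.update_of_ne hj]
    · rfl
  | seq _ _ ih₁ ih₂ =>
    obtain ⟨S₁, c₁, h₁⟩ := ih₁
    obtain ⟨S₂, c₂, h₂⟩ := ih₂
    refine ⟨S₁ ∪ S₂, (Finset.card_union_le _ _).trans (by omega), fun j hj => ?_⟩
    simp only [Finset.mem_union, not_or] at hj
    rw [h₂ j hj.2, h₁ j hj.1]
  | branch_true _ _ _ ih =>
    obtain ⟨S, c, h⟩ := ih
    exact ⟨S, by omega, h⟩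
  | branch_false _ _ _ ih =>
    obtain ⟨S, c, h⟩ := ih
    exact ⟨S, by omega, h⟩
  | loop_step _ _ _ _ ih₁ ih₂ =>
    obtain ⟨S₁, c₁, h₁⟩ := ih₁
    obtain ⟨S₂, c₂, h₂⟩ := ih₂
    refine ⟨S₁ ∪ S₂, (Finset.card_union_le _ _).trans (by omega), fun j hj => ?_⟩
    simp only [Finset.mem_union, not_or] at hj
    rw [h₂ j hj.2, h₁ j hj.1]

end WordRAM

/-! ### Matrix indices and the lower bound on the exponent -/

theorem matrixArray_le_one {n : ℕ} (A : Matrix (Fin n) (Fin n) Bool) (k : ℕ) :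
    matrixArray A k ≤ 1 := by
  unfold matrixArray
  split <;> omega

theorem index_injective {n i j i' j' : ℕ} (hj : j < n) (hj' : j' < n)
    (h : i * n + j = i' * n + j') : i = i' ∧ j = j' := by
  have hn : 0 < n := by omega
  have h1 : (i * n + j) / n = i := by
    rw [mul_comm, Nat.mul_add_div hn, Nat.div_eq_of_lt hj, add_zero]
  have h2 : (i' * n + j') / n = i' := by
    rw [mul_comm, Nat.mul_add_div hn, Nat.div_eq_of_lt hj', add_zero]
  have : i = i' := by rw [← h1, ← h2, h]
  subst this
  exact ⟨rfl, by omega⟩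

/-- A matrix product may have `n ^ 2` nonzero entries, so it takes time `n ^ 2` to write it. -/
theorem MatMulInTime.two_le {ω : ℝ} (h : MatMulInTime ω) : 2 ≤ ω := by
  obtain ⟨prog, c, C, h⟩ := h
  have key : ∀ n : ℕ, 1 ≤ n → (n : ℝ) ^ 2 ≤ C * (n : ℝ) ^ ω := by
    intro n hn
    -- For all-ones factors every entry of the product is nonzero, while the output array is zero
    -- initially, so all `n ^ 2` cells have to change.
    obtain ⟨t, s, hx, ht, hs⟩ := h n hn (fun _ _ => true) (fun _ _ => true)
    obtain ⟨S, hS, hS'⟩ := hx.exists_changed 2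
    have hmem : ∀ p : Fin n × Fin n, (p.1 : ℕ) * n + p.2 ∈ S := by
      intro p
      by_contra hp
      have h1 := (hs p.1 p.2).mpr ⟨⟨0, hn⟩, rfl, rfl⟩
      rw [hS' _ hp] at h1
      exact h1 (by simp [matMulInput])
    have hcard : n ^ 2 ≤ S.card := by
      have h2 := Finset.card_le_card_of_injOn (s := (Finset.univ : Finset (Fin n × Fin n)))
        (t := S) (fun p => (p.1 : ℕ) * n + p.2) (fun p _ => hmem p) (by
          intro p _ q _ hpq
          obtain ⟨h3, h4⟩ := index_injective p.2.2 q.2.2 hpq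
          exact Prod.ext (Fin.ext h3) (Fin.ext h4))
      simpa [sq] using h2
    have : ((n ^ 2 : ℕ) : ℝ) ≤ t := by exact_mod_cast hcard.trans hS
    push_cast at this
    exact this.trans ht
  by_contra hω
  push Not at hω
  -- If `ω < 2`, then `n ^ (2 - ω)` eventually exceeds `C`, contrary to `key`.
  have htend := (tendsto_rpow_atTop (show 0 < 2 - ω by linarith)).comp
    (tendsto_natCast_atTop_atTop (R := ℝ))
  obtain ⟨n, hn, hn1⟩ := ((htend.eventually (Filter.eventually_gt_atTop C)).and
    (Filter.eventually_ge_atTop 1)).exists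
  have hn0 : (0 : ℝ) < n := by exact_mod_cast hn1
  have h1 := key n hn1
  simp only [Function.comp] at hn
  have h2 : (n : ℝ) ^ (2 - ω) * (n : ℝ) ^ ω = (n : ℝ) ^ 2 := by
    rw [← Real.rpow_add hn0]
    norm_num
  have h3 : 0 < (n : ℝ) ^ ω := Real.rpow_pos_of_pos hn0 ω
  nlinarith

/-! ### Calling a program for matrix multiplication -/

namespace WordRAM

/-- The expression `e ^ k`. -/
def Expr.pow (e : Expr) : ℕ → Expr
  | 0 => .const 1
  | k + 1 => .bin .mul (e.pow k) e

theorem Expr.pow_eval (s : State) (e : Expr) : ∀ k, (e.pow k).eval s = e.eval s ^ k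
  | 0 => rfl
  | k + 1 => by simp only [Expr.pow, Expr.eval, Op.eval, Expr.pow_eval s e k, pow_succ]

theorem Expr.pow_vars {e : Expr} : ∀ {k : ℕ}, (e.pow k).vars ⊆ e.vars
  | 0 => by simp [Expr.pow, Expr.vars]
  | k + 1 => Set.union_subset Expr.pow_vars subset_rfl

theorem Expr.pow_arrs {e : Expr} : ∀ {k : ℕ}, (e.pow k).arrs ⊆ e.arrs
  | 0 => by simp [Expr.pow, Expr.arrs]
  | k + 1 => Set.union_subset Expr.pow_arrs subset_rfl

theorem PolyFits.pow {ι : Type*} {n : ι → ℕ} {P : ι → State → Prop} {e : Expr}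
    (h : PolyFits n P e) : ∀ k, PolyFits n P (e.pow k)
  | 0 => PolyFits.const 1
  | k + 1 => (PolyFits.pow h k).bin h

/-- Set the variables `v, …, v + V - 1` to zero. -/
def clearVars (v : ℕ) : ℕ → Cmd
  | 0 => .skip
  | V + 1 => .seq (clearVars v V) (.assign (v + V) (.const 0))

theorem exec_clearVars {W : ℕ} (hW : 0 < W) (v : ℕ) : ∀ (V : ℕ) (s : State), ∃ s' : State,
    Exec W (clearVars v V) s (2 * V + 1) s' ∧ s'.arr = s.arr ∧
      (∀ x < V, s'.var (v + x) = 0) ∧ ∀ x < v, s'.var x = s.var x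
  | 0, s => ⟨s, .skip s, rfl, fun x hx => absurd hx (by omega), fun _ _ => rfl⟩
  | V + 1, s => by
      obtain ⟨s', hx, h1, h2, h3⟩ := exec_clearVars hW v V s
      refine ⟨s'.setVar (v + V) 0, ?_, h1, fun x hx => ?_, fun x hx => ?_⟩
      · have := Exec.seq hx (Exec.assign (W := W) s' (v + V) (.const 0) hW)
        exact this
      · by_cases hxV : x = V
        · subst hxV; simp
        · rw [State.setVar_var_ne _ _ (by omega), h2 x (by omega)]
      · rw [State.setVar_var_ne _ _ (by omega), h3 x hx]

/-- A matrix multiplication program, run on matrices with `n ^ k` rows in the memory of a larger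
program, with `n` in variable `0`, all addresses being shifted by the content of variable `6`. -/
def matMulCall (prog : Cmd) (V M k : ℕ) : Cmd :=
  .seq (.seq (clearVars 8 V) (.assign 8 (Expr.pow (.var 0) k))) (prog.embed 8 6 M)

/-- The guest's variables start at `8`, above those of the caller. Its variables are cleared before
each call, but its arrays are not: the caller has to supply a block in which they hold the input and
zeros otherwise. -/
theorem exists_matMulCall {ω : ℝ} (hω : MatMulInTime ω) (k : ℕ) :
    ∃ (prog : Cmd) (V γ d K : ℕ), 3 ≤ V ∧ 2 * k ≤ γ ∧ ∀ (M D n β : ℕ) (s : State)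
      (A B : Matrix (Fin (n ^ k)) (Fin (n ^ k)) Bool), d ≤ D → 1 ≤ n →
      β + (n + 2) ^ γ ≤ (n + 2) ^ D → s.var 0 = n → s.var 6 = β →
      (∀ a < V, ∀ j < (n + 2) ^ γ, s.arr (M + a) (β + j) = (matMulInput A B).arr a j) →
      ∃ (t : ℕ) (s' : State), Exec ((n + 2) ^ D) (matMulCall prog V M k) s t s' ∧
        (t : ℝ) ≤ K * (n : ℝ) ^ (ω * k) ∧ SameOutside 8 M V ((n + 2) ^ γ) β s s' ∧
        (∀ j < (n + 2) ^ γ, s'.arr (M + 2) (β + j) < (n + 2) ^ (γ + 1)) ∧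
        ∀ i j : Fin (n ^ k), s'.arr (M + 2) (β + ((i : ℕ) * n ^ k + j)) ≠ 0 ↔
          ∃ l, A i l = true ∧ B l j = true := by
  have h2ω := hω.two_le
  obtain ⟨prog, c, C, h⟩ := hω
  obtain ⟨V₀, hV₀⟩ := prog.exists_below
  obtain ⟨d, hd⟩ := PolyFits.pow (ι := ℕ) (n := id) (P := fun n s => s.var 0 = n) (e := .var 0)
    (PolyFits.var ⟨1, fun i s hs => by simp [hs]⟩) k
  set V := V₀ + 3 with hV
  -- The block must contain all addresses of the guest, which are below `(n ^ k + 2) ^ c ≤ (n + 2) ^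
  -- ((k + 1) * c)`, and a matrix of `n ^ (2 * k)` entries.
  set γ := (k + 1) * c + 2 * k with hγ
  set pe := Expr.pow (.var 0) k with hpe
  -- The factor `3` is the overhead of `Exec.embed`; the rest pays for clearing the variables and
  -- storing the dimension.
  refine ⟨prog, V, γ, d, 3 * ⌈C⌉₊ + (2 * V + pe.cost + 2), by omega, by omega, ?_⟩
  intro M D n β s A B hdD hn hβ hs0 hs6 hin
  have hN : 1 ≤ n ^ k := Nat.one_le_pow _ _ hn
  have hW : 0 < (n + 2) ^ D := by positivity
  have hWB : (n ^ k + 2) ^ c ≤ (n + 2) ^ γ := by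
    calc (n ^ k + 2) ^ c ≤ ((n + 2) ^ (k + 1)) ^ c := by
          refine Nat.pow_le_pow_left ?_ c
          have h1 : n ^ k ≤ (n + 2) ^ k := Nat.pow_le_pow_left (by omega) k
          have h2 : 1 ≤ (n + 2) ^ k := Nat.one_le_pow _ _ (by omega)
          rw [pow_succ]
          nlinarith
      _ = (n + 2) ^ ((k + 1) * c) := (pow_mul _ _ _).symm
      _ ≤ _ := pow_le_pow_size _ (by omega)
  have hNB : n ^ k * n ^ k ≤ (n + 2) ^ γ := by
    rw [← pow_add]
    calc n ^ (k + k) ≤ (n + 2) ^ (k + k) := Nat.pow_le_pow_left (by omega) _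
      _ ≤ _ := pow_le_pow_size _ (by omega)
  obtain ⟨s₁, e₁, ha₁, hz₁, hv₁⟩ := exec_clearVars hW 8 V s
  have hs₁0 : s₁.var 0 = n := by rw [hv₁ 0 (by omega), hs0]
  have e₂ := Exec.assign (W := (n + 2) ^ D) s₁ 8 pe
    ((hd n s₁ hs₁0).mono (pow_le_pow_size _ hdD))
  have hpev : pe.eval s₁ = n ^ k := by rw [hpe, Expr.pow_eval, Expr.eval, hs₁0]
  rw [hpev] at e₂
  obtain ⟨t, s', hx, ht, hout⟩ := h (n ^ k) hN A B
  have hemb : Embeds 8 6 M V ((n + 2) ^ γ) β (matMulInput A B) (s₁.setVar 8 (n ^ k)) := by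
    refine ⟨?_, fun x hxV => ?_, fun a ha j hj => ?_⟩
    · rw [State.setVar_var_ne _ _ (by omega), hv₁ 6 (by omega), hs6]
    · by_cases hx0 : x = 0
      · subst hx0; simp [matMulInput]
      · rw [State.setVar_var_ne _ _ (by omega), hz₁ x hxV]
        simp [matMulInput, hx0]
    · rw [State.setVar_arr, ha₁, hin a ha j hj]
  obtain ⟨t', σ', e₃, ht', hemb', hout'⟩ := hx.embed (v := 8) (b := 6) (M := M) (V := V)
    (B := (n + 2) ^ γ) (β := β) (W' := (n + 2) ^ D) (by omega) hWB hβ _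
    (hV₀.mono (show V₀ ≤ V by omega)) hemb
  refine ⟨_, σ', .seq (.seq e₁ e₂) e₃, ?_, ?_, fun j hj => ?_, fun i j => ?_⟩
  · have hn1 : (1 : ℝ) ≤ n := by exact_mod_cast hn
    have h1 : (1 : ℝ) ≤ (n : ℝ) ^ (ω * k) :=
      Real.one_le_rpow hn1 (by positivity)
    have h2 : ((n ^ k : ℕ) : ℝ) ^ ω = (n : ℝ) ^ (ω * k) := by
      push_cast
      rw [← Real.rpow_natCast, ← Real.rpow_mul (by positivity), mul_comm]
    rw [h2] at ht
    have h3 : (t : ℝ) ≤ ⌈C⌉₊ * (n : ℝ) ^ (ω * k) :=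
      ht.trans (mul_le_mul_of_nonneg_right (Nat.le_ceil C) (by positivity))
    have h4 : (t' : ℝ) ≤ 3 * t := by exact_mod_cast ht'
    push_cast
    have h5 : (0 : ℝ) ≤ 2 * V + pe.cost + 2 := by positivity
    nlinarith
  · refine ⟨fun x hx8 => ?_, fun a ha => ?_, fun a j hj => ?_⟩
    · rw [hout'.var x hx8, State.setVar_var_ne _ _ (by omega), hv₁ x hx8]
    · rw [hout'.arr a ha, State.setVar_arr, ha₁]
    · rw [hout'.addr a j hj, State.setVar_arr, ha₁]
  · rw [hemb'.arr 2 (by omega) j hj]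
    -- The exponent `γ` may be `0`; with `γ + 1` the bound also covers the bits of the input, which
    -- the guest may have left in place.
    have h2 : 2 ≤ (n + 2) ^ (γ + 1) := by
      calc 2 ≤ n + 2 := by omega
        _ = (n + 2) ^ 1 := (pow_one _).symm
        _ ≤ _ := pow_le_pow_size _ (by omega)
    refine hx.arr_lt (K := (n + 2) ^ (γ + 1)) (hWB.trans (pow_le_pow_size _ (by omega)))
      (fun a j => lt_of_le_of_lt (b := 1) ?_ (by omega)) 2 j
    simp only [matMulInput]
    split_ifs
    · exact matrixArray_le_one _ _
    · exact matrixArray_le_one _ _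
    · exact Nat.zero_le 1
  · have hij : (i : ℕ) * n ^ k + j < (n + 2) ^ γ := by
      have := i.2
      have := j.2
      nlinarith
    rw [hemb'.arr 2 (by omega) _ hij]
    exact hout i j

end WordRAM

/-! ### Tuples in base `n` -/

section Tuples

variable {α : Type*}

/-- The tuple of the values of `ρ` on a list, as a number in base `n`. -/
def tupleIndex (n : ℕ) : List α → (α → ℕ) → ℕ
  | [], _ => 0
  | a :: l, ρ => ρ a + n * tupleIndex n l ρ

/-- The entries of the tuple with a given number. -/
def tupleEntry [DecidableEq α] (n : ℕ) : List α → ℕ → α → ℕ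
  | [], _, _ => 0
  | b :: l, k, a => if a = b then k % n else tupleEntry n l (k / n) a

theorem tupleIndex_congr {n : ℕ} {ρ ρ' : α → ℕ} : ∀ {l : List α}, (∀ a ∈ l, ρ a = ρ' a) →
    tupleIndex n l ρ = tupleIndex n l ρ'
  | [], _ => rfl
  | a :: l, h => by
      simp only [tupleIndex]
      rw [h a (by simp), tupleIndex_congr fun b hb => h b (by simp [hb])]

theorem tupleIndex_lt {n : ℕ} {ρ : α → ℕ} (h : ∀ a, ρ a < n) :
    ∀ l : List α, tupleIndex n l ρ < n ^ l.length
  | [] => by simp [tupleIndex]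
  | a :: l => by
      have h1 := tupleIndex_lt h l
      have h2 := h a
      simp only [tupleIndex, List.length_cons, pow_succ]
      calc ρ a + n * tupleIndex n l ρ < n + n * tupleIndex n l ρ := by omega
        _ = n * (tupleIndex n l ρ + 1) := by ring
        _ ≤ n * n ^ l.length := Nat.mul_le_mul_left _ h1
        _ = _ := mul_comm _ _

theorem tupleEntry_tupleIndex [DecidableEq α] {n : ℕ} {ρ : α → ℕ} (h : ∀ a, ρ a < n) :
    ∀ {l : List α} {a : α}, a ∈ l → tupleEntry n l (tupleIndex n l ρ) a = ρ a
  | b :: l, a, ha => by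
      have hn : 0 < n := lt_of_le_of_lt (Nat.zero_le _) (h b)
      simp only [tupleEntry, tupleIndex]
      split_ifs with hab
      · rw [Nat.add_mul_mod_self_left, Nat.mod_eq_of_lt (h b), hab]
      · rw [Nat.add_mul_div_left _ _ hn, Nat.div_eq_of_lt (h b), zero_add]
        exact tupleEntry_tupleIndex h (List.mem_of_ne_of_mem hab ha)

theorem tupleEntry_lt [DecidableEq α] {n : ℕ} (hn : 0 < n) (a : α) : ∀ (l : List α) (k : ℕ),
    tupleEntry n l k a < n
  | [], _ => hn
  | b :: l, k => by
      simp only [tupleEntry]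
      split_ifs
      · exact Nat.mod_lt _ hn
      · exact tupleEntry_lt hn a l _

theorem tupleIndex_inj [DecidableEq α] {n : ℕ} {ρ ρ' : α → ℕ} (h : ∀ a, ρ a < n)
    (h' : ∀ a, ρ' a < n)
    {l : List α} : tupleIndex n l ρ = tupleIndex n l ρ' ↔ ∀ a ∈ l, ρ a = ρ' a := by
  refine ⟨fun he a ha => ?_, tupleIndex_congr⟩
  rw [← tupleEntry_tupleIndex h ha, he, tupleEntry_tupleIndex h' ha]

namespace WordRAM

/-- The expression for `tupleIndex`, with `n` in variable `0`. -/
def Expr.tupleIndex (η : α → Expr) : List α → Expr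
  | [] => .const 0
  | a :: l => .bin .add (η a) (.bin .mul (.var 0) (Expr.tupleIndex η l))

/-- The expression for `tupleEntry`, with `n` in variable `0`. -/
def Expr.tupleEntry [DecidableEq α] (a : α) : List α → Expr → Expr
  | [], _ => .const 0
  | b :: l, e => if a = b then .bin .mod e (.var 0) else
      Expr.tupleEntry a l (.bin .div e (.var 0))

theorem Expr.tupleIndex_eval (s : State) (η : α → Expr) : ∀ l : List α,
    (Expr.tupleIndex η l).eval s = _root_.tupleIndex (s.var 0) l fun a => (η a).eval s
  | [] => rfl
  | a :: l => by
      simp only [Expr.tupleIndex, Expr.eval, Op.eval, Expr.tupleIndex_eval s η l,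
        _root_.tupleIndex]

theorem Expr.tupleEntry_eval [DecidableEq α] (s : State) (a : α) : ∀ (l : List α) (e : Expr),
    (Expr.tupleEntry a l e).eval s = _root_.tupleEntry (s.var 0) l (e.eval s) a
  | [], _ => rfl
  | b :: l, e => by
      simp only [Expr.tupleEntry, _root_.tupleEntry]
      split_ifs
      · rfl
      · rw [Expr.tupleEntry_eval s a l]
        rfl

theorem Expr.notMem_arrs_tupleIndex {x : ℕ} {η : α → Expr} (h : ∀ a, x ∉ (η a).arrs) :
    ∀ l : List α, x ∉ (Expr.tupleIndex η l).arrs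
  | [] => by simp [Expr.tupleIndex, Expr.arrs]
  | a :: l => by
      have := Expr.notMem_arrs_tupleIndex h l
      simp [Expr.tupleIndex, Expr.arrs, h a, this]

theorem Expr.notMem_arrs_tupleEntry [DecidableEq α] {x : ℕ} {a : α} :
    ∀ {l : List α} {e : Expr}, x ∉ e.arrs →
    x ∉ (Expr.tupleEntry a l e).arrs
  | [], _, _ => by simp [Expr.tupleEntry, Expr.arrs]
  | b :: l, e, h => by
      simp only [Expr.tupleEntry]
      split_ifs
      · simp [Expr.arrs, h]
      · exact Expr.notMem_arrs_tupleEntry (by simp [Expr.arrs, h])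

theorem PolyFits.tupleIndex {ι : Type*} {n : ι → ℕ} {P : ι → State → Prop} {η : α → Expr}
    (h0 : PolyFits n P (.var 0)) (h : ∀ a, PolyFits n P (η a)) :
    ∀ l : List α, PolyFits n P (Expr.tupleIndex η l)
  | [] => PolyFits.const 0
  | a :: l => (h a).bin (h0.bin (PolyFits.tupleIndex h0 h l))

theorem PolyFits.tupleEntry [DecidableEq α] {ι : Type*} {n : ι → ℕ} {P : ι → State → Prop}
    (h0 : PolyFits n P (.var 0)) {a : α} : ∀ {l : List α} {e : Expr}, PolyFits n P e →
    PolyFits n P (Expr.tupleEntry a l e)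
  | [], _, _ => PolyFits.const 0
  | b :: l, e, h => by
      simp only [Expr.tupleEntry]
      split_ifs
      · exact h.bin h0
      · exact PolyFits.tupleEntry h0 (h.bin h0)

end WordRAM

end Tuples

/-! ### Computing tables of relations -/

open WordRAM

/-- An input of pattern detection, with at least one vertex. -/
structure DetectionInstance where
  n : ℕ
  pos : 1 ≤ n
  G : SimpleGraph (Fin n)
  adj : Fin n → List (Fin n)
  isAdj : IsAdjacencyList G adj

namespace DetectionInstance

/-- Adjacency of vertices that are given as numbers. -/
def Adj (I : DetectionInstance) (x y : ℕ) : Prop :=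
  ∃ (hx : x < I.n) (hy : y < I.n), I.G.Adj ⟨x, hx⟩ ⟨y, hy⟩

/-- The memory holds the input in arrays `0` and `1` and the adjacency matrix in array `2`, and
the arrays from number `M` on have not been used. -/
structure Ready (I : DetectionInstance) (M : ℕ) (s : State) : Prop where
  size : s.var 0 = I.n
  fresh : ∀ a, M ≤ a → s.arr a = 0
  offsets : s.arr 0 = (detectionInput I.adj).arr 0
  lists : s.arr 1 = (detectionInput I.adj).arr 1
  matrix_le : ∀ j, s.arr 2 j ≤ 1
  matrix : ∀ x < I.n, ∀ y < I.n, s.arr 2 (x * I.n + y) ≠ 0 ↔ I.Adj x y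

theorem Ready.transfer {I : DetectionInstance} {M M' : ℕ} {s s' : State} (h : I.Ready M s)
    (h0 : s'.var 0 = s.var 0) (ha : ∀ a < 3, s'.arr a = s.arr a)
    (hM : ∀ a, M' ≤ a → s'.arr a = 0) : I.Ready M' s' where
  size := h0.trans h.size
  fresh := hM
  offsets := (ha 0 (by omega)).trans h.offsets
  lists := (ha 1 (by omega)).trans h.lists
  matrix_le j := by rw [ha 2 (by omega)]; exact h.matrix_le j
  matrix x hx y hy := by rw [ha 2 (by omega)]; exact h.matrix x hx y hy

theorem Ready.setVar {I : DetectionInstance} {M : ℕ} {s : State} (h : I.Ready M s) {x : ℕ}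
    (hx : x ≠ 0) (v : ℕ) : I.Ready M (s.setVar x v) :=
  h.transfer (State.setVar_var_ne _ _ (Ne.symm hx)) (fun _ _ => rfl) h.fresh

end DetectionInstance

section Tables

variable {α : Type*}

/-- Array `t` holds the table of the relation `R`, the values of the variables in `A` being
the index. -/
def IsTable (n : ℕ) (s : State) (t : ℕ) (A : Finset α) (R : (α → ℕ) → Prop) : Prop :=
  (∀ j, s.arr t j ≤ 1) ∧
    ∀ ρ : α → ℕ, (∀ a, ρ a < n) → (s.arr t (tupleIndex n A.toList ρ) ≠ 0 ↔ R ρ)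

/-- A table of the relation `R` between vertices, which depends on the variables in `A`, can be
computed in time `O(T)`, without changing the arrays in use. -/
def TableComputable (T : DetectionInstance → ℝ) (A : Finset α)
    (R : DetectionInstance → (α → ℕ) → Prop) : Prop :=
  ∀ M, 3 ≤ M → ∃ (c : Cmd) (M' t : ℕ), M ≤ M' ∧ t < M' ∧
    Triple DetectionInstance.n T (fun I s => I.Ready M s) c (fun I s s' =>
      I.Ready M' s' ∧ (∀ a < M, s'.arr a = s.arr a) ∧ IsTable I.n s' t A (R I))

theorem IsTable.congr_arr {n : ℕ} {s s' : State} {t : ℕ} {A : Finset α} {R : (α → ℕ) → Prop}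
    (h : IsTable n s t A R) (ha : s'.arr t = s.arr t) : IsTable n s' t A R := by
  unfold IsTable
  rw [ha]
  exact h

theorem TableComputable.congr {T : DetectionInstance → ℝ} {A : Finset α}
    {R R' : DetectionInstance → (α → ℕ) → Prop} (h : TableComputable T A R)
    (hR : ∀ (I : DetectionInstance) ρ, (∀ a, ρ a < I.n) → (R I ρ ↔ R' I ρ)) :
    TableComputable T A R' := by
  intro M hM
  obtain ⟨c, M', t, h1, h2, h3⟩ := h M hM
  refine ⟨c, M', t, h1, h2, h3.weaken (fun _ _ h => h) ?_ ⟨1, fun I => by simp⟩⟩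
  rintro I s s' - ⟨h4, h5, h6, h7⟩
  exact ⟨h4, h5, h6, fun ρ hρ => (h7 ρ hρ).trans (hR I ρ hρ)⟩

theorem scatterState_arr_ne_zero {x : ℕ} {e : Expr} {a : ℕ} {f : Expr} {s : State} {k j : ℕ} :
    (scatterState x e a f s k).arr a j ≠ 0 ↔
      (∃ l < k, e.eval (s.setVar x l) ≠ 0 ∧ f.eval (s.setVar x l) = j) ∨ s.arr a j ≠ 0 := by
  simp only [scatterState, Function.update_self]
  split_ifs with h'
  · exact iff_of_true one_ne_zero (Or.inl h')
  · exact ⟨Or.inr, fun h => h.resolve_left h'⟩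

theorem scatterState_arr_le_one {x : ℕ} {e : Expr} {a : ℕ} {f : Expr} {s : State} {k j : ℕ}
    (h : s.arr a j ≤ 1) : (scatterState x e a f s k).arr a j ≤ 1 := by
  simp only [scatterState, Function.update_self]
  split_ifs
  · exact le_rfl
  · exact h

theorem scatterState_arr_ne {x : ℕ} {e : Expr} {a : ℕ} {f : Expr} {s : State} {k : ℕ} {b : ℕ}
    (h : b ≠ a) : (scatterState x e a f s k).arr b = s.arr b := by
  simp [scatterState, h]

theorem scatterState_var_ne {x : ℕ} {e : Expr} {a : ℕ} {f : Expr} {s : State} {k : ℕ} {y : ℕ}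
    (h : y ≠ x) : (scatterState x e a f s k).var y = s.var y := by
  simp [scatterState, h]

/-- The index ranges over `n ^ d` values, and bits are scattered into a new array. -/
theorem triple_scatter_table {P : DetectionInstance → State → Prop} {M d : ℕ} (hM : 3 ≤ M)
    (hP : ∀ I s, P I s → I.Ready M s) {A : Finset α} {R : DetectionInstance → (α → ℕ) → Prop}
    {e f : Expr} (hea : M ∉ e.arrs) (hfa : M ∉ f.arrs)
    (he : PolyFits DetectionInstance.n
      (fun I s => ∃ s₀, P I s₀ ∧ ∃ k < I.n ^ d, s = s₀.setVar 2 k) e)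
    (hf : PolyFits DetectionInstance.n
      (fun I s => ∃ s₀, P I s₀ ∧ ∃ k < I.n ^ d, s = s₀.setVar 2 k) f)
    (hR : ∀ I s, P I s → ∀ ρ : α → ℕ, (∀ a, ρ a < I.n) →
      ((∃ l < I.n ^ d, e.eval (s.setVar 2 l) ≠ 0 ∧
        f.eval (s.setVar 2 l) = tupleIndex I.n A.toList ρ) ↔ R I ρ)) :
    Triple DetectionInstance.n (fun I => (I.n : ℝ) ^ d) P
      (scatter 2 (Expr.pow (.var 0) d) e M f) (fun I s s' =>
        I.Ready (M + 1) s' ∧ (∀ a < M, s'.arr a = s.arr a) ∧ IsTable I.n s' M A (R I)) := by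
  have h0 : PolyFits DetectionInstance.n P (.var 0) :=
    PolyFits.var (PolyBdd.of_le_pow 1 fun I s hs => by rw [(hP I s hs).size, pow_one])
  refine (Triple.scatter (L := fun I => I.n ^ d) (fun I s hs => ?_) (h0.pow d) ?_ ?_ hea hfa he
    (hf.mono fun I s h => h.1)).weaken (fun _ _ h => h) ?_ ⟨2, fun I => ?_⟩
  · rw [Expr.pow_eval, Expr.eval, (hP I s hs).size]
  · exact fun h => by simpa [Expr.vars] using Expr.pow_vars h
  · exact fun h => by simpa [Expr.arrs] using Expr.pow_arrs h
  · rintro I s s' hs rfl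
    have hr := hP I s hs
    have h0 := hr.fresh M le_rfl
    refine ⟨hr.transfer (scatterState_var_ne (by omega))
      (fun a ha => scatterState_arr_ne (by omega)) fun a ha => ?_,
      fun a ha => scatterState_arr_ne (by omega), fun j => scatterState_arr_le_one (by simp [h0]),
      fun ρ hρ => ?_⟩
    · rw [scatterState_arr_ne (by omega)]
      exact hr.fresh a (by omega)
    · rw [scatterState_arr_ne_zero, h0, Pi.zero_apply, ne_self_iff_false, or_false]
      exact hR I s hs ρ hρ
  · have : (1 : ℝ) ≤ (I.n : ℝ) ^ d := one_le_pow₀ (by exact_mod_cast I.pos)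
    push_cast
    linarith

/-- Every variable in `A` is a digit of the loop counter in variable `2`. -/
theorem polyFits_tupleEntry [DecidableEq α] {P : DetectionInstance → State → Prop} {M d : ℕ}
    (hP : ∀ I s, P I s → I.Ready M s) (l : List α) (a : α) :
    PolyFits DetectionInstance.n
      (fun I s => ∃ s₀, P I s₀ ∧ ∃ k < I.n ^ d, s = s₀.setVar 2 k)
      (Expr.tupleEntry a l (.var 2)) := by
  refine PolyFits.tupleEntry ?_ ?_
  · refine PolyFits.var (PolyBdd.of_le_pow 1 ?_)
    rintro I s ⟨s₀, hs, k, hk, rfl⟩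
    rw [State.setVar_var_ne _ _ (by omega), (hP I s₀ hs).size, pow_one]
  · refine PolyFits.var (PolyBdd.of_le_pow d ?_)
    rintro I s ⟨s₀, hs, k, hk, rfl⟩
    rw [State.setVar_var_self]
    exact hk.le

theorem polyFits_size {P : DetectionInstance → State → Prop} {M d : ℕ}
    (hP : ∀ I s, P I s → I.Ready M s) :
    PolyFits DetectionInstance.n
      (fun I s => ∃ s₀, P I s₀ ∧ ∃ k < I.n ^ d, s = s₀.setVar 2 k) (.var 0) := by
  refine PolyFits.var (PolyBdd.of_le_pow 1 ?_)
  rintro I s ⟨s₀, hs, k, hk, rfl⟩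
  rw [State.setVar_var_ne _ _ (by omega), (hP I s₀ hs).size, pow_one]

/-- Relations that are decided by an expression. -/
theorem TableComputable.of_expr [DecidableEq α] {T : DetectionInstance → ℝ} {A : Finset α}
    {R : DetectionInstance → (α → ℕ) → Prop} {e : Expr} (hT : ∀ I, (I.n : ℝ) ^ A.card ≤ T I)
    (hRA : ∀ (I : DetectionInstance) ρ ρ', (∀ a ∈ A, ρ a = ρ' a) → R I ρ → R I ρ')
    (hea : ∀ a ∈ e.arrs, a < 3)
    (he : ∀ M, PolyFits DetectionInstance.n
      (fun I s => ∃ s₀, I.Ready M s₀ ∧ ∃ k < I.n ^ A.card, s = s₀.setVar 2 k) e)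
    (hR : ∀ (I : DetectionInstance) M s k, I.Ready M s → s.var 2 = k →
      (e.eval s ≠ 0 ↔ R I (tupleEntry I.n A.toList k))) : TableComputable T A R := by
  intro M hM
  refine ⟨_, M + 1, M, by omega, by omega, (triple_scatter_table (d := A.card) (e := e)
    (f := Expr.tupleIndex (fun a => Expr.tupleEntry a A.toList (.var 2)) A.toList) hM
    (fun _ _ h => h) (fun h => ?_) ?_ (he M) ?_ ?_).weaken (fun _ _ h => h) (fun _ _ _ _ h => h)
    ⟨1, fun I => by simpa using hT I⟩⟩
  · have := hea M h
    omega
  · exact Expr.notMem_arrs_tupleIndex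
      (fun a => Expr.notMem_arrs_tupleEntry (by simp [Expr.arrs])) _
  · exact PolyFits.tupleIndex (polyFits_size fun _ _ h => h)
      (fun a => polyFits_tupleEntry (fun _ _ h => h) _ _) _
  · intro I s hs ρ hρ
    have hn : 0 < I.n := I.pos
    have hev : ∀ l, (Expr.tupleIndex (fun a => Expr.tupleEntry a A.toList (.var 2))
        A.toList).eval (s.setVar 2 l) = tupleIndex I.n A.toList (tupleEntry I.n A.toList l) := by
      intro l
      simp only [Expr.tupleIndex_eval, Expr.tupleEntry_eval, (hs.setVar two_ne_zero l).size,
        Expr.eval, State.setVar_var_self]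
    constructor
    · rintro ⟨l, hl, h1, h2⟩
      rw [hR I M _ l (hs.setVar two_ne_zero l) (by simp)] at h1
      rw [hev, tupleIndex_inj (fun a => tupleEntry_lt hn a _ _) hρ] at h2
      exact hRA I _ _ (fun a ha => h2 a (Finset.mem_toList.mpr ha)) h1
    · intro h
      have hlt := tupleIndex_lt hρ A.toList
      rw [Finset.length_toList] at hlt
      refine ⟨_, hlt, ?_, ?_⟩
      · rw [hR I M _ _ (hs.setVar two_ne_zero _) (State.setVar_var_self _ _ _)]
        exact hRA I _ _ (fun a ha =>
          (tupleEntry_tupleIndex hρ (Finset.mem_toList.mpr ha)).symm) h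
      · rw [hev]
        exact tupleIndex_congr fun a ha => tupleEntry_tupleIndex hρ ha

/-- Existential quantification. -/
theorem TableComputable.project [DecidableEq α] {T : DetectionInstance → ℝ}
    {A A' : Finset α} (hA : A' ⊆ A)
    {R : DetectionInstance → (α → ℕ) → Prop} (h : TableComputable T A R)
    (hT : ∀ I, (I.n : ℝ) ^ A.card ≤ T I) :
    TableComputable T A' (fun I ρ => ∃ ρ' : α → ℕ, (∀ a, ρ' a < I.n) ∧
      (∀ a ∈ A', ρ' a = ρ a) ∧ R I ρ') := by
  intro M hM
  obtain ⟨c, M', t, h1, h2, h3⟩ := h M hM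
  set η : α → Expr := fun a => Expr.tupleEntry a A.toList (.var 2) with hη
  have hηa : ∀ x a, x ∉ (η a).arrs := fun x a => Expr.notMem_arrs_tupleEntry (by simp [Expr.arrs])
  have hP : ∀ I s, (DetectionInstance.Ready I M' s ∧ IsTable I.n s t A (R I)) → I.Ready M' s :=
    fun _ _ h => h.1
  have hidx : ∀ l : List α, PolyFits DetectionInstance.n (fun I s => ∃ s₀,
      (DetectionInstance.Ready I M' s₀ ∧ IsTable I.n s₀ t A (R I)) ∧
        ∃ k < I.n ^ A.card, s = s₀.setVar 2 k) (Expr.tupleIndex η l) := fun l =>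
    PolyFits.tupleIndex (polyFits_size hP) (fun a => polyFits_tupleEntry hP _ _) _
  refine ⟨_, M' + 1, M', by omega, by omega, h3.seq ((triple_scatter_table (d := A.card)
    (P := fun I s => DetectionInstance.Ready I M' s ∧ IsTable I.n s t A (R I))
    (e := .load t (Expr.tupleIndex η A.toList)) (f := Expr.tupleIndex η A'.toList) (A := A')
    (R := fun I ρ => ∃ ρ' : α → ℕ, (∀ a, ρ' a < I.n) ∧ (∀ a ∈ A', ρ' a = ρ a) ∧ R I ρ')
    (by omega : 3 ≤ M') hP ?_ ?_ ?_ (hidx _) ?_).weaken (fun _ _ h => h)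
      (fun _ _ _ _ h => h) ⟨1, fun I => by simpa using hT I⟩)
    (fun I s s' hs hs' => ⟨hs'.1, hs'.2.2⟩) (fun I s s' s'' hs hs' hs'' => ⟨hs''.1, fun a ha =>
      (hs''.2.1 a (by omega)).trans (hs'.2.1 a ha), hs''.2.2⟩)⟩
  · simp only [Expr.arrs, Set.mem_insert_iff, not_or]
    exact ⟨by omega, Expr.notMem_arrs_tupleIndex (hηa _) _⟩
  · exact Expr.notMem_arrs_tupleIndex (hηa _) _
  · refine PolyFits.load (hidx _) (PolyBdd.of_le_const 1 ?_)
    rintro I s ⟨s₀, hs, k, hk, rfl⟩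
    exact hs.2.1 _
  · rintro I s ⟨hs, ht⟩ ρ hρ
    have hn : 0 < I.n := I.pos
    have hev : ∀ (B : List α) l, (Expr.tupleIndex η B).eval (s.setVar 2 l) =
        tupleIndex I.n B (tupleEntry I.n A.toList l) := by
      intro B l
      simp only [hη, Expr.tupleIndex_eval, Expr.tupleEntry_eval, (hs.setVar two_ne_zero l).size,
        Expr.eval, State.setVar_var_self]
    have hload : ∀ l, (Expr.load t (Expr.tupleIndex η A.toList)).eval (s.setVar 2 l) ≠ 0 ↔
        R I (tupleEntry I.n A.toList l) := by
      intro l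
      rw [← ht.2 _ fun a => tupleEntry_lt hn a _ _, Expr.eval, hev, State.setVar_arr]
    constructor
    · rintro ⟨l, hl, h4, h5⟩
      rw [hload] at h4
      rw [hev, tupleIndex_inj (fun a => tupleEntry_lt hn a _ _) hρ] at h5
      exact ⟨_, fun a => tupleEntry_lt hn a _ _, fun a ha => h5 a (Finset.mem_toList.mpr ha), h4⟩
    · rintro ⟨ρ', hρ', hag, h⟩
      have hlt := tupleIndex_lt hρ' A.toList
      rw [Finset.length_toList] at hlt
      refine ⟨_, hlt, ?_, ?_⟩
      -- The decoded assignment agrees with `ρ'` on `A` only. The table does not see more than that,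
      -- so the relation is transferred through the table.
      · rw [hload, ← ht.2 _ fun a => tupleEntry_lt hn a _ _,
          tupleIndex_congr fun a ha => tupleEntry_tupleIndex hρ' ha, ht.2 _ hρ']
        exact h
      · rw [hev]
        refine tupleIndex_congr fun a ha => ?_
        rw [Finset.mem_toList] at ha
        rw [tupleEntry_tupleIndex hρ' (Finset.mem_toList.mpr (hA ha)), hag a ha]

end Tables

/-! ### Joining tables by matrix multiplication -/

section Join

variable {α : Type*}

/-- The index into the table involves only the variables in `A`. The mere existence of a table
therefore shows that the relation, on values below `n`, depends on these variables only. -/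
theorem IsTable.congr_on {n : ℕ} {s : State} {t : ℕ} {A : Finset α} {R : (α → ℕ) → Prop}
    (h : IsTable n s t A R) {ρ ρ' : α → ℕ} (hρ : ∀ a, ρ a < n) (hρ' : ∀ a, ρ' a < n)
    (ha : ∀ a ∈ A, ρ a = ρ' a) : R ρ ↔ R ρ' := by
  rw [← h.2 ρ hρ, ← h.2 ρ' hρ', tupleIndex_congr fun a h => ha a (Finset.mem_toList.mp h)]

theorem matrixArray_ne_zero {n : ℕ} (A : Matrix (Fin n) (Fin n) Bool) (j : ℕ) :
    matrixArray A j ≠ 0 ↔ ∃ i l : Fin n, j = (i : ℕ) * n + l ∧ A i l = true := by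
  unfold matrixArray
  split_ifs with h <;> simp [h]

theorem eq_of_le_one_of_ne_zero_iff {a b : ℕ} (ha : a ≤ 1) (hb : b ≤ 1)
    (h : a ≠ 0 ↔ b ≠ 0) : a = b := by
  omega

theorem div_mul_add_mod_lt {N j : ℕ} (hj : j < N * N) : j / N < N ∧ j % N < N := by
  have hN : 0 < N := Nat.pos_of_ne_zero (by rintro rfl; simp at hj)
  exact ⟨Nat.div_lt_of_lt_mul hj, Nat.mod_lt _ hN⟩

/-- The data of a join: the variables in `S` are enumerated, and for each choice of their values
the tables in arrays `t₁` and `t₂` are regarded as matrices with `n ^ k` rows, whose indices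
give the values of the variables in `X`, `E` and `Z`. The matrices are multiplied in the arrays
`M, …, M + V - 1`, in blocks of size `(n + 2) ^ γ`. -/
structure JoinData (α : Type*) where
  S : Finset α
  X : Finset α
  E : Finset α
  Z : Finset α
  A₁ : Finset α
  A₂ : Finset α
  A : Finset α
  k : ℕ
  γ : ℕ
  V : ℕ
  M : ℕ
  t₁ : ℕ
  t₂ : ℕ
  R₁ : DetectionInstance → (α → ℕ) → Prop
  R₂ : DetectionInstance → (α → ℕ) → Prop

namespace JoinData

variable (J : JoinData α)

/-- The number of rows. -/
def rows : Expr := Expr.pow (.var 0) J.k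

/-- The row index of the loop counter in variable `2`. -/
def row : Expr := .bin .div (.var 2) J.rows

/-- The column index of the loop counter in variable `2`. -/
def col : Expr := .bin .mod (.var 2) J.rows

theorem rows_eval {I : DetectionInstance} {s : State} (h : s.var 0 = I.n) :
    J.rows.eval s = I.n ^ J.k := by
  rw [rows, Expr.pow_eval, Expr.eval, h]

theorem notMem_arrs_rows (x : ℕ) : x ∉ J.rows.arrs :=
  fun h => by simpa [Expr.arrs] using Expr.pow_arrs h

theorem notMem_vars_rows {x : ℕ} (hx : x ≠ 0) : x ∉ J.rows.vars :=
  fun h => by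
    have := Expr.pow_vars h
    simp [Expr.vars] at this
    omega

/-- The index type of the stages of an iteration: instance, state before the loop, and loop
counter. -/
abbrev Stage := (DetectionInstance × State) × ℕ

theorem polyFits_of_le {P : Stage → State → Prop} {x : ℕ} (d : ℕ)
    (h : ∀ κ s, P κ s → s.var x ≤ κ.1.1.n ^ d) :
    PolyFits (fun κ : Stage => κ.1.1.n) P (.var x) :=
  PolyFits.var (PolyBdd.of_le_pow (n := fun κ : Stage => κ.1.1.n) d h)

variable [DecidableEq α]

/-- The conditions under which the join is correct. -/
structure Valid (J : JoinData α) : Prop where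
  three_le_M : 3 ≤ J.M
  three_le_V : 3 ≤ J.V
  t₁_lt : J.t₁ < J.M
  t₂_lt : J.t₂ < J.M
  two_mul_le : 2 * J.k ≤ J.γ
  A₁_sub : J.A₁ ⊆ J.S ∪ J.X ∪ J.E
  A₂_sub : J.A₂ ⊆ J.S ∪ J.E ∪ J.Z
  A_sub : J.A ⊆ J.S ∪ J.X ∪ J.Z
  disj_XE : Disjoint J.X J.E
  disj_XZ : Disjoint J.X J.Z
  disj_EZ : Disjoint J.E J.Z
  X_le : J.X.card ≤ J.k
  E_le : J.E.card ≤ J.k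
  Z_le : J.Z.card ≤ J.k

/-- The assignment with the given tuple numbers. -/
noncomputable def assignment (n c r m q : ℕ) (a : α) : ℕ :=
  if a ∈ J.S then tupleEntry n J.S.toList c a
  else if a ∈ J.X then tupleEntry n J.X.toList r a
  else if a ∈ J.E then tupleEntry n J.E.toList m a
  else tupleEntry n J.Z.toList q a

/-- The expressions for `assignment`, with the number of the tuple on `S` in variable `4`. -/
noncomputable def env (eX eE eZ : Expr) (a : α) : Expr :=
  if a ∈ J.S then Expr.tupleEntry a J.S.toList (.var 4)
  else if a ∈ J.X then Expr.tupleEntry a J.X.toList eX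
  else if a ∈ J.E then Expr.tupleEntry a J.E.toList eE
  else Expr.tupleEntry a J.Z.toList eZ

theorem assignment_lt {n : ℕ} (hn : 0 < n) (c r m q : ℕ) (a : α) :
    J.assignment n c r m q a < n := by
  unfold assignment
  split_ifs <;> exact tupleEntry_lt hn a _ _

theorem env_eval (s : State) (eX eE eZ : Expr) (a : α) : (J.env eX eE eZ a).eval s =
    J.assignment (s.var 0) (s.var 4) (eX.eval s) (eE.eval s) (eZ.eval s) a := by
  unfold env assignment
  split_ifs <;> exact Expr.tupleEntry_eval _ _ _ _

theorem notMem_arrs_env {x : ℕ} {eX eE eZ : Expr} (h₁ : x ∉ eX.arrs) (h₂ : x ∉ eE.arrs)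
    (h₃ : x ∉ eZ.arrs) (a : α) : x ∉ (J.env eX eE eZ a).arrs := by
  unfold env
  split_ifs
  · exact Expr.notMem_arrs_tupleEntry (by simp [Expr.arrs])
  · exact Expr.notMem_arrs_tupleEntry h₁
  · exact Expr.notMem_arrs_tupleEntry h₂
  · exact Expr.notMem_arrs_tupleEntry h₃

theorem polyFits_env {ι : Type*} {n : ι → ℕ} {P : ι → State → Prop} {eX eE eZ : Expr}
    (h0 : PolyFits n P (.var 0)) (h4 : PolyFits n P (.var 4)) (h₁ : PolyFits n P eX)
    (h₂ : PolyFits n P eE) (h₃ : PolyFits n P eZ) (a : α) :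
    PolyFits n P (J.env eX eE eZ a) := by
  unfold env
  split_ifs
  · exact PolyFits.tupleEntry h0 h4
  · exact PolyFits.tupleEntry h0 h₁
  · exact PolyFits.tupleEntry h0 h₂
  · exact PolyFits.tupleEntry h0 h₃

/-- The variables of the first table lie in `S`, `X` and `E`, so the number of the tuple on `Z` is
never consulted. Together with the next two lemmas this justifies a dummy index `0` in each factor
and in the address of the result. -/
theorem assignment_congr_Z (hJ : J.Valid) {n c r m q q' : ℕ} {a : α} (ha : a ∈ J.A₁) :
    J.assignment n c r m q a = J.assignment n c r m q' a := by
  have := hJ.A₁_sub ha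
  simp only [Finset.mem_union] at this
  unfold assignment
  split_ifs <;> tauto

theorem assignment_congr_X (hJ : J.Valid) {n c r r' m q : ℕ} {a : α} (ha : a ∈ J.A₂) :
    J.assignment n c r m q a = J.assignment n c r' m q a := by
  have h1 := hJ.A₂_sub ha
  have h2 : a ∈ J.X → a ∉ J.E := fun h => Finset.disjoint_left.mp hJ.disj_XE h
  have h3 : a ∈ J.X → a ∉ J.Z := fun h => Finset.disjoint_left.mp hJ.disj_XZ h
  simp only [Finset.mem_union] at h1
  unfold assignment
  split_ifs <;> tauto

theorem assignment_congr_E (hJ : J.Valid) {n c r m m' q : ℕ} {a : α} (ha : a ∈ J.A) :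
    J.assignment n c r m q a = J.assignment n c r m' q a := by
  have h1 := hJ.A_sub ha
  have h2 : a ∈ J.X → a ∉ J.E := fun h => Finset.disjoint_left.mp hJ.disj_XE h
  have h3 : a ∈ J.E → a ∉ J.Z := fun h => Finset.disjoint_left.mp hJ.disj_EZ h
  simp only [Finset.mem_union] at h1
  unfold assignment
  split_ifs <;> tauto

theorem assignment_tupleIndex {n : ℕ} {ρ : α → ℕ} (hρ : ∀ a, ρ a < n) {a : α}
    (ha : a ∈ J.S ∪ J.X ∪ J.E ∪ J.Z) :
    J.assignment n (tupleIndex n J.S.toList ρ) (tupleIndex n J.X.toList ρ)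
      (tupleIndex n J.E.toList ρ) (tupleIndex n J.Z.toList ρ) a = ρ a := by
  simp only [Finset.mem_union] at ha
  unfold assignment
  split_ifs with h1 h2 h3
  · exact tupleEntry_tupleIndex hρ (Finset.mem_toList.mpr h1)
  · exact tupleEntry_tupleIndex hρ (Finset.mem_toList.mpr h2)
  · exact tupleEntry_tupleIndex hρ (Finset.mem_toList.mpr h3)
  · exact tupleEntry_tupleIndex hρ (Finset.mem_toList.mpr (by tauto))

/-- The entry with number `j` of the joined table is set for the tuple `c` on `S`. -/
def Hit (I : DetectionInstance) (c j : ℕ) : Prop :=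
  ∃ r < I.n ^ J.k, ∃ m < I.n ^ J.k, ∃ q < I.n ^ J.k,
    J.R₁ I (J.assignment I.n c r m q) ∧ J.R₂ I (J.assignment I.n c r m q) ∧
      tupleIndex I.n J.A.toList (J.assignment I.n c r m q) = j

/-- A witness is encoded by its tuples on `S`, `X`, `E` and `Z`. Decoding recovers it on the union
of these sets, which contains all variables of both tables and of the result. -/
theorem exists_hit_iff (hJ : J.Valid) {I : DetectionInstance} {s : State}
    (h₁ : IsTable I.n s J.t₁ J.A₁ (J.R₁ I)) (h₂ : IsTable I.n s J.t₂ J.A₂ (J.R₂ I)) {ρ : α → ℕ}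
    (hρ : ∀ a, ρ a < I.n) : (∃ c < I.n ^ J.S.card, J.Hit I c (tupleIndex I.n J.A.toList ρ)) ↔
      ∃ ρ' : α → ℕ, (∀ a, ρ' a < I.n) ∧ (∀ a ∈ J.A, ρ' a = ρ a) ∧ J.R₁ I ρ' ∧ J.R₂ I ρ' := by
  constructor
  · rintro ⟨c, hc, r, hr, m, hm, q, hq, hR₁, hR₂, hidx⟩
    have hlt := J.assignment_lt I.pos c r m q
    rw [tupleIndex_inj hlt hρ] at hidx
    exact ⟨_, hlt, fun a ha => hidx a (Finset.mem_toList.mpr ha), hR₁, hR₂⟩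
  · rintro ⟨ρ', hρ', hag, hR₁, hR₂⟩
    have hle : ∀ B : Finset α, B.card ≤ J.k → tupleIndex I.n B.toList ρ' < I.n ^ J.k :=
      fun B hB => by
        have := tupleIndex_lt hρ' B.toList
        rw [Finset.length_toList] at this
        exact this.trans_le (Nat.pow_le_pow_right I.pos hB)
    have hS := tupleIndex_lt hρ' J.S.toList
    rw [Finset.length_toList] at hS
    have hlt := fun c r m q => J.assignment_lt I.pos (c := c) (r := r) (m := m) (q := q)
    refine ⟨_, hS, _, hle _ hJ.X_le, _, hle _ hJ.E_le, _, hle _ hJ.Z_le, ?_, ?_, ?_⟩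
    · refine (h₁.congr_on (hlt _ _ _ _) hρ' fun a ha => J.assignment_tupleIndex hρ' ?_).mpr hR₁
      have := hJ.A₁_sub ha
      simp only [Finset.mem_union] at this ⊢
      tauto
    · refine (h₂.congr_on (hlt _ _ _ _) hρ' fun a ha => J.assignment_tupleIndex hρ' ?_).mpr hR₂
      have := hJ.A₂_sub ha
      simp only [Finset.mem_union] at this ⊢
      tauto
    · refine tupleIndex_congr fun a ha => ?_
      rw [Finset.mem_toList] at ha
      rw [J.assignment_tupleIndex hρ', hag a ha]
      have := hJ.A_sub ha
      simp only [Finset.mem_union] at this ⊢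
      tauto

/-- The state within the loop over the tuples on `S`, which was started in state `s₀`. -/
structure Common (I : DetectionInstance) (s₀ : State) (c : ℕ) (s : State) : Prop where
  ready : I.Ready J.M s₀
  table₁ : IsTable I.n s₀ J.t₁ J.A₁ (J.R₁ I)
  table₂ : IsTable I.n s₀ J.t₂ J.A₂ (J.R₂ I)
  size : s.var 0 = I.n
  old : ∀ a < J.M, s.arr a = s₀.arr a
  fresh : ∀ a, J.M + J.V + 1 ≤ a → s.arr a = 0
  out_le : ∀ j, s.arr (J.M + J.V) j ≤ 1
  out : ∀ j, s.arr (J.M + J.V) j ≠ 0 ↔ ∃ c' < c, J.Hit I c' j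

/-- The loop invariant. -/
structure Inv (I : DetectionInstance) (s₀ : State) (c : ℕ) (s : State) : Prop
    extends J.Common I s₀ c s where
  clean : ∀ a < J.V, ∀ j, c * (I.n + 2) ^ J.γ ≤ j → s.arr (J.M + a) j = 0

variable {J}

theorem Common.transfer {I : DetectionInstance} {s₀ : State} {c : ℕ} {s s' : State}
    (h : J.Common I s₀ c s) (h0 : s'.var 0 = s.var 0)
    (ha : ∀ a, a < J.M ∨ J.M + J.V ≤ a → s'.arr a = s.arr a) : J.Common I s₀ c s' where
  ready := h.ready
  table₁ := h.table₁
  table₂ := h.table₂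
  size := h0.trans h.size
  old a h1 := (ha a (Or.inl h1)).trans (h.old a h1)
  fresh a h1 := (ha a (Or.inr (by omega))).trans (h.fresh a h1)
  out_le j := by rw [ha _ (Or.inr le_rfl)]; exact h.out_le j
  out j := by rw [ha _ (Or.inr le_rfl)]; exact h.out j

variable (J)

/-- An iteration has been started; the base address is in variable `6`. -/
structure Started (I : DetectionInstance) (s₀ : State) (c : ℕ) (s : State) : Prop
    extends J.Common I s₀ c s where
  counter_lt : c < I.n ^ J.S.card
  counter : s.var 4 = c
  base : s.var 6 = c * (I.n + 2) ^ J.γ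

variable {J}

theorem Started.transfer {I : DetectionInstance} {s₀ : State} {c : ℕ} {s s' : State}
    (h : J.Started I s₀ c s) (hv : ∀ x < 8, x ≠ 2 → s'.var x = s.var x)
    (ha : ∀ a, a < J.M ∨ J.M + J.V ≤ a → s'.arr a = s.arr a) : J.Started I s₀ c s' where
  toCommon := h.toCommon.transfer (hv 0 (by omega) (by omega)) ha
  counter_lt := h.counter_lt
  counter := (hv 4 (by omega) (by omega)).trans h.counter
  base := (hv 6 (by omega) (by omega)).trans h.base

variable (J)

open Classical in
/-- The first factor. -/
noncomputable def mat₁ (I : DetectionInstance) (c : ℕ) :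
    Matrix (Fin (I.n ^ J.k)) (Fin (I.n ^ J.k)) Bool :=
  fun r m => decide (J.R₁ I (J.assignment I.n c r m 0))

open Classical in
/-- The second factor. -/
noncomputable def mat₂ (I : DetectionInstance) (c : ℕ) :
    Matrix (Fin (I.n ^ J.k)) (Fin (I.n ^ J.k)) Bool :=
  fun m q => decide (J.R₂ I (J.assignment I.n c 0 m q))

/-- Copy a table into the matrix in array `b`. -/
def fillCmd (t : ℕ) (l : List α) (η : α → Expr) (b : ℕ) : Cmd :=
  scatter 2 (.bin .mul J.rows J.rows) (.load t (Expr.tupleIndex η l)) b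
    (.bin .add (.var 6) (.var 2))

/-- Copy the product into the new table. -/
noncomputable def outCmd : Cmd :=
  scatter 2 (.bin .mul J.rows J.rows) (.load (J.M + 2) (.bin .add (.var 6) (.var 2)))
    (J.M + J.V) (Expr.tupleIndex (J.env J.row (.const 0) J.col) J.A.toList)

/-- Words that occur in the scattering loops are polynomially bounded. -/
theorem polyFits_started {P : Stage → State → Prop} (hP : ∀ κ s, P κ s → ∃ s₁ l,
      J.Started κ.1.1 κ.1.2 κ.2 s₁ ∧ l < κ.1.1.n ^ J.k * κ.1.1.n ^ J.k ∧ s = s₁.setVar 2 l) :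
    PolyFits (fun κ : Stage => κ.1.1.n) P (.var 0) ∧
    PolyFits (fun κ : Stage => κ.1.1.n) P (.var 2) ∧
    PolyFits (fun κ : Stage => κ.1.1.n) P (.var 4) ∧
    PolyFits (fun κ : Stage => κ.1.1.n) P (.var 6) := by
  refine ⟨polyFits_of_le 1 ?_, polyFits_of_le (J.k + J.k) ?_, polyFits_of_le J.S.card ?_,
    PolyFits.var ⟨J.S.card + J.γ, ?_⟩⟩ <;> intro κ s hs <;>
    obtain ⟨s₁, l, hs₁, hl, rfl⟩ := hP κ s hs
  · rw [State.setVar_var_ne _ _ (by omega), hs₁.size, pow_one]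
  · rw [State.setVar_var_self, pow_add]
    exact hl.le
  · rw [State.setVar_var_ne _ _ (by omega), hs₁.counter]
    exact hs₁.counter_lt.le
  · simp only
    rw [State.setVar_var_ne _ _ (by omega), hs₁.base, pow_add]
    refine Nat.mul_lt_mul_of_pos_right (hs₁.counter_lt.trans_le ?_) (by positivity)
    exact Nat.pow_le_pow_left (by omega) _

/-- Both factors are filled in the same way: each tuple number is the row, the column, or the dummy
`0`. Only ones are written, the block being zero beforehand. -/
theorem triple_fill (t : ℕ) (l : List α) (b : ℕ) (eX eE eZ : Expr) (ht : t < J.M)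
    (hb : J.M ≤ b ∧ b < J.M + J.V) (hX : eX = .const 0 ∨ eX = J.row ∨ eX = J.col)
    (hE : eE = .const 0 ∨ eE = J.row ∨ eE = J.col) (hZ : eZ = .const 0 ∨ eZ = J.row ∨ eZ = J.col)
    {P : Stage → State → Prop} (hP : ∀ κ s, P κ s → J.Started κ.1.1 κ.1.2 κ.2 s)
    (ht1 : ∀ κ s, P κ s → ∀ j, s.arr t j ≤ 1) :
    Triple (fun κ : Stage => κ.1.1.n) (fun κ => 1 + (κ.1.1.n ^ J.k * κ.1.1.n ^ J.k : ℕ)) P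
      (J.fillCmd t l (J.env eX eE eZ) b)
      (fun κ s s' => s' = scatterState 2 (.load t (Expr.tupleIndex (J.env eX eE eZ) l)) b
        (.bin .add (.var 6) (.var 2)) s (κ.1.1.n ^ J.k * κ.1.1.n ^ J.k)) := by
  have harr : ∀ {e : Expr}, e = .const 0 ∨ e = J.row ∨ e = J.col → ∀ x, x ∉ e.arrs := by
    rintro e (rfl | rfl | rfl) x <;> simp [Expr.arrs, row, col, J.notMem_arrs_rows x]
  obtain ⟨f0, f2, f4, f6⟩ := J.polyFits_started (P := fun κ s => ∃ s₀, P κ s₀ ∧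
      ∃ k < κ.1.1.n ^ J.k * κ.1.1.n ^ J.k, s = s₀.setVar 2 k) (fun κ s h => by
    obtain ⟨s₁, h1, l, hl, rfl⟩ := h
    exact ⟨s₁, l, hP _ _ h1, hl, rfl⟩)
  have hfit : ∀ {e : Expr}, e = .const 0 ∨ e = J.row ∨ e = J.col →
      PolyFits (fun κ : Stage => κ.1.1.n) (fun κ s => ∃ s₀, P κ s₀ ∧
        ∃ k < κ.1.1.n ^ J.k * κ.1.1.n ^ J.k, s = s₀.setVar 2 k) e := by
    rintro e (rfl | rfl | rfl)
    · exact PolyFits.const 0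
    · exact f2.bin (f0.pow _)
    · exact f2.bin (f0.pow _)
  have g0 : PolyFits (fun κ : Stage => κ.1.1.n) P (.var 0) :=
    polyFits_of_le 1 fun κ s h => by rw [(hP κ s h).size, pow_one]
  refine Triple.scatter (fun κ s h => ?_) ((g0.pow _).bin (g0.pow _)) ?_ ?_ ?_ ?_ ?_ ?_
  · simp only [Expr.eval, Op.eval, J.rows_eval (hP κ s h).size]
  · simp [Expr.vars, J.notMem_vars_rows (show 2 ≠ 0 by omega)]
  · simp [Expr.arrs, J.notMem_arrs_rows]
  · simp only [Expr.arrs, Set.mem_insert_iff, not_or]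
    exact ⟨by omega, Expr.notMem_arrs_tupleIndex
      (J.notMem_arrs_env (harr hX _) (harr hE _) (harr hZ _)) _⟩
  · simp [Expr.arrs]
  · refine PolyFits.load (PolyFits.tupleIndex f0
      (J.polyFits_env f0 f4 (hfit hX) (hfit hE) (hfit hZ)) _) (PolyBdd.of_le_const 1 ?_)
    rintro κ s ⟨s₁, h1, l, hl, rfl⟩
    exact ht1 _ _ h1 _
  · exact (f6.bin f2).mono fun κ s h => h.1

/-- Quotient and remainder of the loop counter by `n ^ k` are the row and the column, so the cell
written for the counter `l` is cell `l` of the row-by-row layout. -/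
theorem fill_arr {I : DetectionInstance} {s₀ s : State} {c : ℕ} (hs : J.Started I s₀ c s)
    {t b : ℕ} {B : Finset α} {R : (α → ℕ) → Prop} (ht : IsTable I.n s t B R)
    {η : α → Expr} {ρ : ℕ → ℕ → α → ℕ} (hρ : ∀ r q a, ρ r q a < I.n)
    (hη : ∀ l a, (η a).eval (s.setVar 2 l) = ρ (l / I.n ^ J.k) (l % I.n ^ J.k) a)
    (hb : ∀ j, s.arr b (c * (I.n + 2) ^ J.γ + j) = 0)
    {A : Matrix (Fin (I.n ^ J.k)) (Fin (I.n ^ J.k)) Bool}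
    (hA : ∀ i j : Fin (I.n ^ J.k), A i j = true ↔ R (ρ i j)) (j : ℕ) :
    (scatterState 2 (.load t (Expr.tupleIndex η B.toList)) b (.bin .add (.var 6) (.var 2)) s
      (I.n ^ J.k * I.n ^ J.k)).arr b (c * (I.n + 2) ^ J.γ + j) = matrixArray A j := by
  have hload : ∀ l, (Expr.load t (Expr.tupleIndex η B.toList)).eval (s.setVar 2 l) ≠ 0 ↔
      R (ρ (l / I.n ^ J.k) (l % I.n ^ J.k)) := by
    intro l
    rw [← ht.2 _ (hρ _ _), Expr.eval, Expr.tupleIndex_eval, State.setVar_arr,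
      State.setVar_var_ne _ _ (by omega), hs.size]
    simp only [hη]
  have hadd : ∀ l, (Expr.bin .add (.var 6) (.var 2)).eval (s.setVar 2 l) =
      c * (I.n + 2) ^ J.γ + l := by
    intro l
    simp only [Expr.eval, Op.eval, State.setVar_var_self]
    rw [State.setVar_var_ne _ _ (by omega), hs.base]
  refine eq_of_le_one_of_ne_zero_iff (scatterState_arr_le_one (by simp [hb]))
    (matrixArray_le_one _ _) ?_
  rw [scatterState_arr_ne_zero, hb, ne_self_iff_false, or_false, matrixArray_ne_zero]
  constructor
  · rintro ⟨l, hl, h1, h2⟩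
    rw [hload] at h1
    rw [hadd] at h2
    obtain rfl : l = j := by omega
    obtain ⟨h3, h4⟩ := div_mul_add_mod_lt hl
    exact ⟨⟨_, h3⟩, ⟨_, h4⟩, (Nat.div_add_mod' l _).symm, (hA _ _).mpr h1⟩
  · rintro ⟨r, q, rfl, h⟩
    have hN : 0 < I.n ^ J.k := lt_of_le_of_lt (Nat.zero_le _) r.2
    have hdiv : ((r : ℕ) * I.n ^ J.k + q) / I.n ^ J.k = r := by
      rw [mul_comm, Nat.mul_add_div hN, Nat.div_eq_of_lt q.2, add_zero]
    have hmod : ((r : ℕ) * I.n ^ J.k + q) % I.n ^ J.k = q := by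
      rw [mul_comm, Nat.mul_add_mod, Nat.mod_eq_of_lt q.2]
    refine ⟨(r : ℕ) * I.n ^ J.k + q, ?_, ?_, hadd _⟩
    · have h1 := r.2
      have h2 := q.2
      nlinarith
    · rw [hload, hdiv, hmod]
      exact (hA r q).mp h

/-- The memory for the product is empty. -/
structure Clean (I : DetectionInstance) (s₀ : State) (c : ℕ) (s : State) : Prop
    extends J.Started I s₀ c s where
  clean : ∀ a < J.V, ∀ j, s.arr (J.M + a) (c * (I.n + 2) ^ J.γ + j) = 0

/-- The first factor is in its place. -/
structure FilledOne (I : DetectionInstance) (s₀ : State) (c : ℕ) (s : State) : Prop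
    extends J.Started I s₀ c s where
  factor : ∀ j, s.arr J.M (c * (I.n + 2) ^ J.γ + j) = matrixArray (J.mat₁ I c) j
  clean : ∀ a < J.V, a ≠ 0 → ∀ j, s.arr (J.M + a) (c * (I.n + 2) ^ J.γ + j) = 0

/-- Both factors are in their place. -/
structure FilledBoth (I : DetectionInstance) (s₀ : State) (c : ℕ) (s : State) : Prop
    extends J.Started I s₀ c s where
  input : ∀ a < J.V, ∀ j, s.arr (J.M + a) (c * (I.n + 2) ^ J.γ + j) =
    (matMulInput (J.mat₁ I c) (J.mat₂ I c)).arr a j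

/-- The product has been computed. -/
structure Multiplied (I : DetectionInstance) (s₀ : State) (c : ℕ) (s : State) : Prop
    extends J.Started I s₀ c s where
  clean : ∀ a < J.V, ∀ j, (c + 1) * (I.n + 2) ^ J.γ ≤ j → s.arr (J.M + a) j = 0
  bdd : ∀ j < (I.n + 2) ^ J.γ,
    s.arr (J.M + 2) (c * (I.n + 2) ^ J.γ + j) < (I.n + 2) ^ (J.γ + 1)
  product : ∀ r < I.n ^ J.k, ∀ q < I.n ^ J.k,
    s.arr (J.M + 2) (c * (I.n + 2) ^ J.γ + (r * I.n ^ J.k + q)) ≠ 0 ↔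
      ∃ m < I.n ^ J.k, J.R₁ I (J.assignment I.n c r m q) ∧ J.R₂ I (J.assignment I.n c r m q)

variable {J}

theorem Started.isTable₁ {I : DetectionInstance} {s₀ s : State} {c : ℕ} (hJ : J.Valid)
    (hs : J.Started I s₀ c s) : IsTable I.n s J.t₁ J.A₁ (J.R₁ I) :=
  hs.table₁.congr_arr (hs.old _ hJ.t₁_lt)

theorem Started.isTable₂ {I : DetectionInstance} {s₀ s : State} {c : ℕ} (hJ : J.Valid)
    (hs : J.Started I s₀ c s) : IsTable I.n s J.t₂ J.A₂ (J.R₂ I) :=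
  hs.table₂.congr_arr (hs.old _ hJ.t₂_lt)

theorem Started.env_eval {I : DetectionInstance} {s₀ s : State} {c : ℕ}
    (hs : J.Started I s₀ c s) (eX eE eZ : Expr) (l : ℕ) (a : α) :
    (J.env eX eE eZ a).eval (s.setVar 2 l) = J.assignment I.n c (eX.eval (s.setVar 2 l))
      (eE.eval (s.setVar 2 l)) (eZ.eval (s.setVar 2 l)) a := by
  rw [JoinData.env_eval, State.setVar_var_ne _ _ (by omega), State.setVar_var_ne _ _ (by omega),
    hs.size, hs.counter]

theorem Started.row_eval {I : DetectionInstance} {s₀ s : State} {c : ℕ}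
    (hs : J.Started I s₀ c s) (l : ℕ) : J.row.eval (s.setVar 2 l) = l / I.n ^ J.k := by
  rw [row, Expr.eval, J.rows_eval (I := I) (by
    rw [State.setVar_var_ne _ _ (by omega), hs.size]), Expr.eval, State.setVar_var_self, Op.eval]

theorem Started.col_eval {I : DetectionInstance} {s₀ s : State} {c : ℕ}
    (hs : J.Started I s₀ c s) (l : ℕ) : J.col.eval (s.setVar 2 l) = l % I.n ^ J.k := by
  rw [col, Expr.eval, J.rows_eval (I := I) (by
    rw [State.setVar_var_ne _ _ (by omega), hs.size]), Expr.eval, State.setVar_var_self, Op.eval]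

theorem triple_start : Triple (fun κ : Stage => κ.1.1.n) (fun _ => 1)
    (fun κ s => κ.2 < κ.1.1.n ^ J.S.card ∧ s.var 4 = κ.2 ∧ J.Inv κ.1.1 κ.1.2 κ.2 s)
    (.assign 6 (.bin .mul (.var 4) (Expr.pow (.bin .add (.var 0) (.const 2)) J.γ)))
    (fun κ _ s' => J.Clean κ.1.1 κ.1.2 κ.2 s') := by
  refine (Triple.assign ?_).weaken (fun _ _ h => h) ?_ ⟨1, fun κ => by simp⟩
  · refine PolyFits.bin (polyFits_of_le J.S.card fun κ s h => h.2.1.trans_le h.1.le)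
      (PolyFits.pow (PolyFits.bin (polyFits_of_le 1 fun κ s h => ?_) (PolyFits.const 2)) _)
    rw [h.2.2.size, pow_one]
  · rintro κ s s' ⟨h1, h2, h3⟩ rfl
    have hev : (Expr.bin .mul (.var 4) (Expr.pow (.bin .add (.var 0) (.const 2)) J.γ)).eval s =
        κ.2 * (κ.1.1.n + 2) ^ J.γ := by
      simp only [Expr.eval, Op.eval, Expr.pow_eval, h2, h3.size]
    rw [hev]
    exact { toCommon := h3.toCommon.transfer (State.setVar_var_ne _ _ (by omega)) fun _ _ => rfl
            counter_lt := h1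
            counter := (State.setVar_var_ne _ _ (by omega)).trans h2
            base := State.setVar_var_self _ _ _
            clean := fun a ha j => h3.clean a ha _ (Nat.le_add_right _ _) }

theorem triple_fillOne (hJ : J.Valid) : Triple (fun κ : Stage => κ.1.1.n)
    (fun κ => 1 + (κ.1.1.n ^ J.k * κ.1.1.n ^ J.k : ℕ))
    (fun κ s => J.Clean κ.1.1 κ.1.2 κ.2 s)
    (J.fillCmd J.t₁ J.A₁.toList (J.env J.row J.col (.const 0)) J.M)
    (fun κ _ s' => J.FilledOne κ.1.1 κ.1.2 κ.2 s') := by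
  have hV := hJ.three_le_V
  refine (J.triple_fill J.t₁ J.A₁.toList J.M J.row J.col (.const 0) hJ.t₁_lt ⟨le_rfl, by omega⟩
    (by simp) (by simp) (by simp) (fun κ s h => h.toStarted)
    (fun κ s h => (h.isTable₁ hJ).1)).weaken (fun _ _ h => h) ?_ ⟨1, fun κ => by simp⟩
  rintro ⟨⟨I, s₀⟩, c⟩ s s' hs rfl
  refine { toStarted := hs.toStarted.transfer (fun x _ hx => scatterState_var_ne hx)
            (fun a ha => scatterState_arr_ne (by omega))
           factor := ?_
           clean := fun a ha ha0 j => ?_ }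
  · refine J.fill_arr hs.toStarted (hs.isTable₁ hJ)
      (ρ := fun r q => J.assignment I.n c r q 0) (fun r q a => J.assignment_lt I.pos _ _ _ _ _)
      (fun l a => ?_) (fun j => ?_) fun i j => ?_
    · rw [hs.toStarted.env_eval, hs.row_eval, hs.col_eval, Expr.eval]
    · exact hs.clean 0 (by omega) j
    · simp [mat₁]
  · rw [scatterState_arr_ne (by omega)]
    exact hs.clean a ha j

theorem triple_fillBoth (hJ : J.Valid) : Triple (fun κ : Stage => κ.1.1.n)
    (fun κ => 1 + (κ.1.1.n ^ J.k * κ.1.1.n ^ J.k : ℕ))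
    (fun κ s => J.FilledOne κ.1.1 κ.1.2 κ.2 s)
    (J.fillCmd J.t₂ J.A₂.toList (J.env (.const 0) J.row J.col) (J.M + 1))
    (fun κ _ s' => J.FilledBoth κ.1.1 κ.1.2 κ.2 s') := by
  have hV := hJ.three_le_V
  refine (J.triple_fill J.t₂ J.A₂.toList (J.M + 1) (.const 0) J.row J.col hJ.t₂_lt
    ⟨by omega, by omega⟩ (by simp) (by simp) (by simp) (fun κ s h => h.toStarted)
    (fun κ s h => (h.isTable₂ hJ).1)).weaken (fun _ _ h => h) ?_ ⟨1, fun κ => by simp⟩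
  rintro ⟨⟨I, s₀⟩, c⟩ s s' hs rfl
  refine { toStarted := hs.toStarted.transfer (fun x _ hx => scatterState_var_ne hx)
            (fun a ha => scatterState_arr_ne (by omega))
           input := fun a ha j => ?_ }
  by_cases ha1 : a = 1
  · subst ha1
    refine (J.fill_arr hs.toStarted (hs.isTable₂ hJ) (A := J.mat₂ I c)
      (ρ := fun r q => J.assignment I.n c 0 r q) (fun r q a => J.assignment_lt I.pos _ _ _ _ _)
      (fun l a => ?_) (fun j => ?_) (fun i j => ?_) j).trans ?_
    · rw [hs.toStarted.env_eval, hs.row_eval, hs.col_eval, Expr.eval]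
    · exact hs.clean 1 (by omega) (by omega) j
    · simp [mat₂]
    · simp [matMulInput]
  · rw [scatterState_arr_ne (by omega)]
    by_cases ha0 : a = 0
    · subst ha0
      simpa [matMulInput] using hs.factor j
    · rw [hs.clean a ha ha0 j]
      simp [matMulInput, ha0, ha1]

theorem _root_.matrixArray_eq_zero {n : ℕ} (A : Matrix (Fin n) (Fin n) Bool) {j : ℕ}
    (hj : n * n ≤ j) : matrixArray A j = 0 := by
  by_contra h
  obtain ⟨i, l, rfl, -⟩ := (matrixArray_ne_zero A j).mp h
  have h1 := i.2
  have h2 := l.2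
  nlinarith

end JoinData

end Join

section Join

variable {α : Type*} [DecidableEq α]

namespace JoinData

variable {J : JoinData α}

/-- Iteration `c` uses the block of addresses that starts at `c * (n + 2) ^ γ`, which no earlier
iteration has touched. Clearing a used block could take longer than the product, because its size is
an arbitrary polynomial. As `c < n ^ |S|`, the addresses remain polynomially bounded. -/
theorem triple_multiply (hJ : J.Valid) {ω : ℝ} {prog : Cmd} {d K : ℕ}
    (hprog : ∀ (M D n β : ℕ) (s : State)
      (A B : Matrix (Fin (n ^ J.k)) (Fin (n ^ J.k)) Bool), d ≤ D → 1 ≤ n →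
      β + (n + 2) ^ J.γ ≤ (n + 2) ^ D → s.var 0 = n → s.var 6 = β →
      (∀ a < J.V, ∀ j < (n + 2) ^ J.γ, s.arr (M + a) (β + j) = (matMulInput A B).arr a j) →
      ∃ (t : ℕ) (s' : State), Exec ((n + 2) ^ D) (matMulCall prog J.V M J.k) s t s' ∧
        (t : ℝ) ≤ K * (n : ℝ) ^ (ω * J.k) ∧ SameOutside 8 M J.V ((n + 2) ^ J.γ) β s s' ∧
        (∀ j < (n + 2) ^ J.γ, s'.arr (M + 2) (β + j) < (n + 2) ^ (J.γ + 1)) ∧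
        ∀ i j : Fin (n ^ J.k), s'.arr (M + 2) (β + ((i : ℕ) * n ^ J.k + j)) ≠ 0 ↔
          ∃ l, A i l = true ∧ B l j = true) :
    Triple (fun κ : Stage => κ.1.1.n) (fun κ => (κ.1.1.n : ℝ) ^ (ω * J.k))
      (fun κ s => J.FilledBoth κ.1.1 κ.1.2 κ.2 s) (matMulCall prog J.V J.M J.k)
      (fun κ _ s' => J.Multiplied κ.1.1 κ.1.2 κ.2 s') := by
  refine ⟨d + (J.S.card + J.γ), K, ?_⟩
  rintro ⟨⟨I, s₀⟩, c⟩ s hs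
  simp only at hs ⊢
  have hβ : c * (I.n + 2) ^ J.γ + (I.n + 2) ^ J.γ ≤ (I.n + 2) ^ (d + (J.S.card + J.γ)) := by
    have h1 : c + 1 ≤ I.n ^ J.S.card := hs.counter_lt
    calc c * (I.n + 2) ^ J.γ + (I.n + 2) ^ J.γ = (c + 1) * (I.n + 2) ^ J.γ := by ring
      _ ≤ (I.n + 2) ^ J.S.card * (I.n + 2) ^ J.γ :=
          Nat.mul_le_mul_right _ (h1.trans (Nat.pow_le_pow_left (by omega) _))
      _ = (I.n + 2) ^ (J.S.card + J.γ) := (pow_add _ _ _).symm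
      _ ≤ _ := pow_le_pow_size _ (by omega)
  obtain ⟨t, s', hx, ht, hso, hbd, hout⟩ := hprog J.M _ I.n _ s (J.mat₁ I c) (J.mat₂ I c)
    (Nat.le_add_right _ _) I.pos hβ hs.size hs.base fun a ha j _ => hs.input a ha j
  refine ⟨t, s', hx, ht, ?_⟩
  refine { toStarted := hs.toStarted.transfer (fun x hx _ => hso.var x hx) hso.arr
           clean := fun a ha j hj => ?_
           bdd := hbd
           product := fun r hr q hq => ?_ }
  · have hNB : I.n ^ J.k * I.n ^ J.k ≤ (I.n + 2) ^ J.γ := by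
      rw [← pow_add]
      calc I.n ^ (J.k + J.k) ≤ (I.n + 2) ^ (J.k + J.k) := Nat.pow_le_pow_left (by omega) _
        _ ≤ _ := pow_le_pow_size _ (by have := hJ.two_mul_le; omega)
    -- Cells beyond the block are untouched by the call, and they were zero before it because both
    -- factors fit into the block.
    obtain ⟨j', rfl⟩ : ∃ j', j = c * (I.n + 2) ^ J.γ + ((I.n + 2) ^ J.γ + j') :=
      ⟨j - (c + 1) * (I.n + 2) ^ J.γ, by rw [add_mul, one_mul] at hj ⊢; omega⟩
    rw [hso.addr _ _ (Or.inr (by omega)), hs.input a ha]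
    simp only [matMulInput]
    split_ifs
    · exact matrixArray_eq_zero _ (by omega)
    · exact matrixArray_eq_zero _ (by omega)
    · rfl
  · rw [hout ⟨r, hr⟩ ⟨q, hq⟩]
    have hlt := J.assignment_lt (n := I.n) I.pos
    simp only [mat₁, mat₂, decide_eq_true_eq]
    have e₁ : ∀ m, J.R₁ I (J.assignment I.n c r m 0) ↔ J.R₁ I (J.assignment I.n c r m q) :=
      fun m => hs.table₁.congr_on (hlt _ _ _ _) (hlt _ _ _ _)
        fun a ha => J.assignment_congr_Z hJ ha
    have e₂ : ∀ m, J.R₂ I (J.assignment I.n c 0 m q) ↔ J.R₂ I (J.assignment I.n c r m q) :=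
      fun m => hs.table₂.congr_on (hlt _ _ _ _) (hlt _ _ _ _)
        fun a ha => J.assignment_congr_X hJ ha
    constructor
    · rintro ⟨m, h1, h2⟩
      exact ⟨m, m.2, (e₁ m).mp h1, (e₂ m).mp h2⟩
    · rintro ⟨m, hm, h1, h2⟩
      exact ⟨⟨m, hm⟩, (e₁ m).mpr h1, (e₂ m).mpr h2⟩

theorem triple_out (hJ : J.Valid) : Triple (fun κ : Stage => κ.1.1.n)
    (fun κ => 1 + (κ.1.1.n ^ J.k * κ.1.1.n ^ J.k : ℕ))
    (fun κ s => J.Multiplied κ.1.1 κ.1.2 κ.2 s) J.outCmd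
    (fun κ _ s' => s'.var 4 = κ.2 ∧
      J.Inv κ.1.1 κ.1.2 (κ.2 + 1) (s'.setVar 4 (κ.2 + 1))) := by
  have hV := hJ.three_le_V
  obtain ⟨f0, f2, f4, f6⟩ := J.polyFits_started (P := fun κ s => ∃ s₁,
      J.Multiplied κ.1.1 κ.1.2 κ.2 s₁ ∧
      ∃ k < κ.1.1.n ^ J.k * κ.1.1.n ^ J.k, s = s₁.setVar 2 k) (fun κ s h => by
    obtain ⟨s₁, h1, l, hl, rfl⟩ := h
    exact ⟨s₁, l, h1.toStarted, hl, rfl⟩)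
  have g0 : PolyFits (fun κ : Stage => κ.1.1.n) (fun κ s => J.Multiplied κ.1.1 κ.1.2 κ.2 s)
      (.var 0) := polyFits_of_le 1 fun κ s h => by rw [h.size, pow_one]
  have hadd : ∀ {I : DetectionInstance} {s₀ : State} {c : ℕ} {s : State},
      J.Started I s₀ c s → ∀ l, (Expr.bin .add (.var 6) (.var 2)).eval (s.setVar 2 l) =
      c * (I.n + 2) ^ J.γ + l := by
    intro I s₀ c s hs l
    simp only [Expr.eval, Op.eval, State.setVar_var_self]
    rw [State.setVar_var_ne _ _ (by omega), hs.base]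
  have hNB : ∀ n : ℕ, n ^ J.k * n ^ J.k ≤ (n + 2) ^ J.γ := by
    intro n
    rw [← pow_add]
    calc n ^ (J.k + J.k) ≤ (n + 2) ^ (J.k + J.k) := Nat.pow_le_pow_left (by omega) _
      _ ≤ _ := pow_le_pow_size _ (by have := hJ.two_mul_le; omega)
  refine (Triple.scatter (L := fun κ : Stage => κ.1.1.n ^ J.k * κ.1.1.n ^ J.k)
    (Le := .bin .mul J.rows J.rows)
    (fun κ s h => ?_) ((g0.pow _).bin (g0.pow _)) ?_ ?_ ?_ ?_ ?_ ?_).weaken (fun _ _ h => h) ?_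
    ⟨1, fun κ => by simp⟩
  · simp only [Expr.eval, Op.eval, J.rows_eval h.size]
  · simp [Expr.vars, J.notMem_vars_rows (show 2 ≠ 0 by omega)]
  · simp [Expr.arrs, J.notMem_arrs_rows]
  · simp [Expr.arrs]
    omega
  · exact Expr.notMem_arrs_tupleIndex (J.notMem_arrs_env
      (by simp [row, Expr.arrs, J.notMem_arrs_rows]) (by simp [Expr.arrs])
      (by simp [col, Expr.arrs, J.notMem_arrs_rows])) _
  · refine PolyFits.load (f6.bin f2) ⟨J.γ + 1, ?_⟩
    rintro κ s ⟨s₁, h1, l, hl, rfl⟩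
    simp only
    rw [hadd h1.toStarted]
    exact h1.bdd l (hl.trans_le (hNB _))
  · exact (PolyFits.tupleIndex f0 (J.polyFits_env f0 f4 (f2.bin (f0.pow _)) (PolyFits.const 0)
      (f2.bin (f0.pow _))) _).mono fun κ s h => h.1
  · rintro ⟨⟨I, s₀⟩, c⟩ s s' hs rfl
    simp only at hs ⊢
    have hload : ∀ l, l < I.n ^ J.k * I.n ^ J.k →
        ((Expr.load (J.M + 2) (.bin .add (.var 6) (.var 2))).eval (s.setVar 2 l) ≠ 0 ↔
        ∃ m < I.n ^ J.k, J.R₁ I (J.assignment I.n c (l / I.n ^ J.k) m (l % I.n ^ J.k)) ∧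
          J.R₂ I (J.assignment I.n c (l / I.n ^ J.k) m (l % I.n ^ J.k))) := by
      intro l hl
      obtain ⟨h1, h2⟩ := div_mul_add_mod_lt hl
      rw [← hs.product _ h1 _ h2, Expr.eval, hadd hs.toStarted, State.setVar_arr,
        Nat.div_add_mod']
    -- The middle index is arbitrary, as the result has no variable in `E` outside `S`; the program
    -- uses `0`.
    have hidx : ∀ l m, (Expr.tupleIndex (J.env J.row (.const 0) J.col) J.A.toList).eval
        (s.setVar 2 l) = tupleIndex I.n J.A.toList
          (J.assignment I.n c (l / I.n ^ J.k) m (l % I.n ^ J.k)) := by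
      intro l m
      rw [Expr.tupleIndex_eval, State.setVar_var_ne _ _ (by omega), hs.size]
      refine tupleIndex_congr fun a ha => ?_
      rw [hs.toStarted.env_eval, hs.row_eval, hs.col_eval]
      exact J.assignment_congr_E hJ (Finset.mem_toList.mp ha)
    refine ⟨by rw [scatterState_var_ne (by omega), hs.counter], ?_⟩
    refine { ready := hs.ready
             table₁ := hs.table₁
             table₂ := hs.table₂
             size := ?_
             old := fun a ha => ?_
             fresh := fun a ha => ?_
             out_le := fun j => ?_
             out := fun j => ?_
             clean := fun a ha j hj => ?_ }
    · rw [State.setVar_var_ne _ _ (by omega), scatterState_var_ne (by omega), hs.size]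
    · rw [State.setVar_arr, scatterState_arr_ne (by omega), hs.old a ha]
    · rw [State.setVar_arr, scatterState_arr_ne (by omega), hs.fresh a ha]
    · rw [State.setVar_arr]
      exact scatterState_arr_le_one (hs.out_le j)
    · rw [State.setVar_arr, scatterState_arr_ne_zero, hs.out]
      have hit : (∃ l < I.n ^ J.k * I.n ^ J.k,
          (Expr.load (J.M + 2) (.bin .add (.var 6) (.var 2))).eval (s.setVar 2 l) ≠ 0 ∧
          (Expr.tupleIndex (J.env J.row (.const 0) J.col) J.A.toList).eval (s.setVar 2 l) = j) ↔
          J.Hit I c j := by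
        constructor
        · rintro ⟨l, hl, h1, h2⟩
          obtain ⟨m, hm, h3, h4⟩ := (hload l hl).mp h1
          obtain ⟨h5, h6⟩ := div_mul_add_mod_lt hl
          exact ⟨_, h5, m, hm, _, h6, h3, h4, (hidx l m).symm.trans h2⟩
        · rintro ⟨r, hr, m, hm, q, hq, h3, h4, h5⟩
          have hN : 0 < I.n ^ J.k := by omega
          have hdiv : (r * I.n ^ J.k + q) / I.n ^ J.k = r := by
            rw [mul_comm, Nat.mul_add_div hN, Nat.div_eq_of_lt hq, add_zero]
          have hmod : (r * I.n ^ J.k + q) % I.n ^ J.k = q := by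
            rw [mul_comm, Nat.mul_add_mod, Nat.mod_eq_of_lt hq]
          have hlt : r * I.n ^ J.k + q < I.n ^ J.k * I.n ^ J.k := by nlinarith
          refine ⟨r * I.n ^ J.k + q, hlt, ?_, ?_⟩
          · rw [hload _ hlt, hdiv, hmod]
            exact ⟨m, hm, h3, h4⟩
          · rw [hidx _ m, hdiv, hmod]
            exact h5
      rw [hit]
      constructor
      · rintro (h | ⟨c', hc', h⟩)
        · exact ⟨c, by omega, h⟩
        · exact ⟨c', by omega, h⟩
      · rintro ⟨c', hc', h⟩
        rcases Nat.lt_succ_iff_lt_or_eq.mp hc' with h' | rfl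
        · exact Or.inr ⟨c', h', h⟩
        · exact Or.inl h
    · rw [State.setVar_arr, scatterState_arr_ne (by omega)]
      exact hs.clean a ha j hj

end JoinData

/-- The case of a join in which the variables have been divided suitably. -/
theorem TableComputable.join_of_partition {ω : ℝ} (hω : MatMulInTime ω)
    {T : DetectionInstance → ℝ} {A₁ A₂ A S X E Z : Finset α} {k : ℕ}
    {R₁ R₂ : DetectionInstance → (α → ℕ) → Prop} (h₁ : TableComputable T A₁ R₁)
    (h₂ : TableComputable T A₂ R₂) (hA₁ : A₁ ⊆ S ∪ X ∪ E) (hA₂ : A₂ ⊆ S ∪ E ∪ Z)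
    (hA : A ⊆ S ∪ X ∪ Z) (hXE : Disjoint X E) (hXZ : Disjoint X Z) (hEZ : Disjoint E Z)
    (hX : X.card ≤ k) (hE : E.card ≤ k) (hZ : Z.card ≤ k)
    (hT : ∀ I : DetectionInstance, (I.n : ℝ) ^ S.card * (I.n : ℝ) ^ (ω * k) ≤ T I) :
    TableComputable T A (fun I ρ => ∃ ρ' : α → ℕ, (∀ a, ρ' a < I.n) ∧
      (∀ a ∈ A, ρ' a = ρ a) ∧ R₁ I ρ' ∧ R₂ I ρ') := by
  have h2ω := hω.two_le
  obtain ⟨prog, V, γ, d, K, hV, hγ, hprog⟩ := exists_matMulCall hω k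
  intro M hM
  obtain ⟨c₁, M₁, t₁, hM₁, ht₁, H₁⟩ := h₁ M hM
  obtain ⟨c₂, M₂, t₂, hM₂, ht₂, H₂⟩ := h₂ M₁ (hM.trans hM₁)
  let J : JoinData α := ⟨S, X, E, Z, A₁, A₂, A, k, γ, V, M₂, t₁, t₂, R₁, R₂⟩
  have hJ : J.Valid := ⟨by simp only [J]; omega, hV, by simp only [J]; omega, ht₂, hγ, hA₁, hA₂, hA,
    hXE, hXZ, hEZ, hX, hE, hZ⟩
  let Tb : JoinData.Stage → ℝ := fun κ => (κ.1.1.n : ℝ) ^ (ω * k)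
  have hTb1 : ∀ κ, 1 ≤ Tb κ := fun κ =>
    Real.one_le_rpow (by exact_mod_cast κ.1.1.pos) (by positivity)
  -- By `2 ≤ ω`, reading and writing the matrices is no more expensive than multiplying them.
  have hsq : ∀ κ : JoinData.Stage, ((κ.1.1.n ^ k * κ.1.1.n ^ k : ℕ) : ℝ) ≤ Tb κ := by
    intro κ
    push_cast
    rw [← pow_add, ← Real.rpow_natCast]
    refine Real.rpow_le_rpow_of_exponent_le (by exact_mod_cast κ.1.1.pos) ?_
    push_cast
    have : (0 : ℝ) ≤ k := Nat.cast_nonneg k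
    nlinarith
  have hfillT : ∃ K : ℕ, ∀ κ : JoinData.Stage,
      1 + ((κ.1.1.n ^ k * κ.1.1.n ^ k : ℕ) : ℝ) ≤ K * Tb κ :=
    ⟨2, fun κ => by have := hTb1 κ; have := hsq κ; push_cast at *; linarith⟩
  have hstart : Triple (fun κ : JoinData.Stage => κ.1.1.n) Tb _ _ _ :=
    (JoinData.triple_start (J := J)).weaken (fun _ _ h => h) (fun _ _ _ _ h => h)
      ⟨1, fun κ => by simpa using hTb1 κ⟩
  have hone : Triple (fun κ : JoinData.Stage => κ.1.1.n) Tb _ _ _ :=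
    (JoinData.triple_fillOne hJ).weaken (fun _ _ h => h) (fun _ _ _ _ h => h) hfillT
  have hboth : Triple (fun κ : JoinData.Stage => κ.1.1.n) Tb _ _ _ :=
    (JoinData.triple_fillBoth hJ).weaken (fun _ _ h => h) (fun _ _ _ _ h => h) hfillT
  have hmult : Triple (fun κ : JoinData.Stage => κ.1.1.n) Tb _ _ _ :=
    JoinData.triple_multiply hJ (ω := ω) (prog := prog) (d := d) (K := K) hprog
  have hout : Triple (fun κ : JoinData.Stage => κ.1.1.n) Tb _ _ _ :=
    (JoinData.triple_out hJ).weaken (fun _ _ h => h) (fun _ _ _ _ h => h) hfillT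
  have h12 := hstart.seq hone (R := fun κ _ s' => J.FilledOne κ.1.1 κ.1.2 κ.2 s')
    (fun _ _ _ _ h => h) (fun _ _ _ _ _ _ h => h)
  have h123 := h12.seq hboth (R := fun κ _ s' => J.FilledBoth κ.1.1 κ.1.2 κ.2 s')
    (fun _ _ _ _ h => h) (fun _ _ _ _ _ _ h => h)
  have h1234 := h123.seq hmult (R := fun κ _ s' => J.Multiplied κ.1.1 κ.1.2 κ.2 s')
    (fun _ _ _ _ h => h) (fun _ _ _ _ _ _ h => h)
  have hbody := h1234.seq hout (R := fun κ _ s' => s'.var 4 = κ.2 ∧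
      J.Inv κ.1.1 κ.1.2 (κ.2 + 1) (s'.setVar 4 (κ.2 + 1)))
    (fun _ _ _ _ h => h) (fun _ _ _ _ _ _ h => h)
  have hloop := Triple.forLoop (ι := DetectionInstance × State) (n := fun κ => κ.1.n) (x := 4)
    (Le := Expr.pow (.var 0) S.card) (L := fun κ => κ.1.n ^ S.card)
    (Tb := fun κ _ => (κ.1.n : ℝ) ^ (ω * k)) (Inv := fun κ c s => J.Inv κ.1 κ.2 c s)
    (fun κ _ => by positivity) (fun κ c s h => by rw [Expr.pow_eval, Expr.eval, h.size])
    (PolyFits.pow (PolyFits.var (PolyBdd.of_le_pow 1 fun κ s h => by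
      obtain ⟨c, h⟩ := h
      rw [h.size, pow_one])) _) hbody
  have hjoin := Triple.of_ghost (n := DetectionInstance.n) (T := T)
    (P := fun I s => I.Ready M₂ s ∧ IsTable I.n s t₁ A₁ (R₁ I) ∧ IsTable I.n s t₂ A₂ (R₂ I))
    (Q := fun I s s' => I.Ready (M₂ + V + 1) s' ∧ (∀ a < M₂, s'.arr a = s.arr a) ∧
      IsTable I.n s' (M₂ + V) A (fun ρ => ∃ ρ' : α → ℕ, (∀ a, ρ' a < I.n) ∧
        (∀ a ∈ A, ρ' a = ρ a) ∧ R₁ I ρ' ∧ R₂ I ρ'))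
    (hloop.weaken (T' := fun κ => T κ.1) ?_ ?_ ⟨3, ?_⟩)
  · refine ⟨_, M₂ + V + 1, M₂ + V, by omega, by omega, ((H₁.seq H₂
      (R := fun I s s' => (I.Ready M₂ s' ∧ IsTable I.n s' t₁ A₁ (R₁ I) ∧
        IsTable I.n s' t₂ A₂ (R₂ I)) ∧ ∀ a < M, s'.arr a = s.arr a)
      (fun I s s' _ h => h.1) ?_).seq hjoin (fun I s s' _ h => h.1) ?_)⟩
    · rintro I s s' s'' - ⟨-, h2, h3⟩ ⟨h4, h5, h6⟩
      exact ⟨⟨h4, h3.congr_arr (h5 _ ht₁), h6⟩, fun a ha =>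
        (h5 a (by omega)).trans (h2 a ha)⟩
    · rintro I s s' s'' - ⟨-, h1⟩ ⟨h2, h3, h4⟩
      exact ⟨h2, fun a ha => (h3 a (by omega)).trans (h1 a ha), h4⟩
  · rintro ⟨I, s₀⟩ s ⟨rfl, h1, h2, h3⟩
    simp only at h1 h2 h3 ⊢
    exact { ready := h1
            table₁ := h2
            table₂ := h3
            size := (State.setVar_var_ne _ _ (by omega)).trans h1.size
            old := fun _ _ => rfl
            fresh := fun a ha => h1.fresh a (by simp only [J] at ha; omega)
            out_le := fun j => by
              rw [State.setVar_arr, h1.fresh _ (by simp only [J]; omega)]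
              exact Nat.zero_le _
            out := fun j => by
              rw [State.setVar_arr, h1.fresh _ (by simp only [J]; omega)]
              simp
            clean := fun a ha j _ => by
              rw [State.setVar_arr, h1.fresh _ (by simp only [J]; omega)]
              rfl }
  · rintro ⟨I, s₀⟩ s s' - ⟨-, h⟩
    simp only at h ⊢
    refine ⟨h.ready.transfer (h.size.trans h.ready.size.symm) (fun a ha => h.old a ?_) h.fresh,
      h.old, h.out_le, fun ρ hρ => ?_⟩
    · simp only [J]
      omega
    · rw [h.out]
      exact J.exists_hit_iff hJ h.table₁ h.table₂ hρ
  · rintro ⟨I, s₀⟩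
    -- With `N = n ^ |S|` iterations of cost `X = n ^ (ω * k)`, the loop costs `1 + N * (1 + X)`,
    -- which is at most `3 * N * X` since both are at least `1`.
    have h1 : (1 : ℝ) ≤ (I.n : ℝ) ^ (ω * k) :=
      Real.one_le_rpow (by exact_mod_cast I.pos) (by positivity)
    have h2 : (1 : ℝ) ≤ (I.n : ℝ) ^ S.card := one_le_pow₀ (by exact_mod_cast I.pos)
    have h3 := hT I
    simp only [Finset.sum_const, Finset.card_range, nsmul_eq_mul]
    push_cast
    nlinarith

/-! ### Balancing the dimensions of the matrix product -/

/-- Take for `k` the second largest cardinality and for `U` a part of the largest set that makes up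
its excess over `k`. Then `|U| + 2 * k` is the sum of the two largest cardinalities. -/
theorem exists_balancing_subset_of_le {F₁ F₂ F₃ : Finset α} {q : ℕ} (h2 : F₂.card ≤ F₁.card)
    (h3 : F₃.card ≤ F₁.card) (h12 : F₁.card + F₂.card ≤ q) (h13 : F₁.card + F₃.card ≤ q) :
    ∃ (U : Finset α) (k : ℕ), U.card + 2 * k ≤ q ∧ (F₁ \ U).card ≤ k ∧ (F₂ \ U).card ≤ k ∧
      (F₃ \ U).card ≤ k := by
  obtain ⟨U, hU, hc⟩ := Finset.exists_subset_card_eq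
    (show F₁.card - max F₂.card F₃.card ≤ F₁.card by omega)
  refine ⟨U, max F₂.card F₃.card, by omega, ?_, (Finset.card_le_card Finset.sdiff_subset).trans
    (le_max_left _ _), (Finset.card_le_card Finset.sdiff_subset).trans (le_max_right _ _)⟩
  rw [Finset.card_sdiff_of_subset hU]
  omega

theorem exists_balancing_subset {F₁ F₂ F₃ : Finset α} {q : ℕ} (h12 : F₁.card + F₂.card ≤ q)
    (h13 : F₁.card + F₃.card ≤ q) (h23 : F₂.card + F₃.card ≤ q) :
    ∃ (U : Finset α) (k : ℕ), U.card + 2 * k ≤ q ∧ (F₁ \ U).card ≤ k ∧ (F₂ \ U).card ≤ k ∧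
      (F₃ \ U).card ≤ k := by
  by_cases ha : F₂.card ≤ F₁.card ∧ F₃.card ≤ F₁.card
  · exact exists_balancing_subset_of_le ha.1 ha.2 h12 h13
  · by_cases hb : F₁.card ≤ F₂.card ∧ F₃.card ≤ F₂.card
    · obtain ⟨U, k, h, h1, h2, h3⟩ :=
        exists_balancing_subset_of_le hb.1 hb.2 (by omega) h23
      exact ⟨U, k, h, h2, h1, h3⟩
    · obtain ⟨U, k, h, h1, h2, h3⟩ := exists_balancing_subset_of_le (F₁ := F₃) (F₂ := F₁)
        (F₃ := F₂) (by omega) (by omega) (by omega) (by omega : _ ≤ q)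
      exact ⟨U, k, h, h2, h3, h1⟩

/-- Since `2 ≤ ω`, one has `σ + ω * k ≤ ω * (σ + 2 * k) / 2`. An enumerated variable costs a factor
`n`, and the budget grants `n ^ (ω / 2)` for it. -/
theorem rpow_join_le {n : ℕ} (hn : 1 ≤ n) {ω : ℝ} (hω : 2 ≤ ω) {σ k p : ℕ}
    (h : σ + 2 * k ≤ p) : (n : ℝ) ^ σ * (n : ℝ) ^ (ω * k) ≤ (n : ℝ) ^ (ω * p / 2) := by
  have hn' : (1 : ℝ) ≤ n := by exact_mod_cast hn
  rw [← Real.rpow_natCast, ← Real.rpow_add (by linarith)]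
  refine Real.rpow_le_rpow_of_exponent_le hn' ?_
  have h1 : (σ : ℝ) + 2 * k ≤ p := by exact_mod_cast h
  have h2 : (0 : ℝ) ≤ σ := Nat.cast_nonneg σ
  nlinarith

theorem pow_le_rpow_width {n : ℕ} (hn : 1 ≤ n) {ω : ℝ} (hω : 2 ≤ ω) {q p : ℕ} (h : q ≤ p) :
    (n : ℝ) ^ q ≤ (n : ℝ) ^ (ω * p / 2) := by
  simpa using rpow_join_le hn hω (σ := q) (k := 0) (by omega)

theorem union_subset_union_sdiff {D F G S : Finset α} (h : D ⊆ S) :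
    D ∪ F ∪ G ⊆ S ∪ F \ S ∪ G \ S := by
  intro a ha
  have := @h a
  simp only [Finset.mem_union, Finset.mem_sdiff] at ha ⊢
  tauto

/-- The inclusions say that every variable occurs in at least two of the three sets. So it is a row
variable `X`, a summation variable `E`, a column variable `Z`, or common to all three sets (`D`). -/
theorem TableComputable.join_of_subset {ω : ℝ} (hω : MatMulInTime ω)
    {T : DetectionInstance → ℝ} {A₁ A₂ A : Finset α} {p : ℕ}
    {R₁ R₂ : DetectionInstance → (α → ℕ) → Prop} (h₁ : TableComputable T A₁ R₁)
    (h₂ : TableComputable T A₂ R₂) (hA₁ : A₁ ⊆ A₂ ∪ A) (hA₂ : A₂ ⊆ A₁ ∪ A)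
    (hA : A ⊆ A₁ ∪ A₂) (hp₁ : A₁.card ≤ p) (hp₂ : A₂.card ≤ p) (hp : A.card ≤ p)
    (hT : ∀ I : DetectionInstance, (I.n : ℝ) ^ (ω * p / 2) ≤ T I) :
    TableComputable T A (fun I ρ => ∃ ρ' : α → ℕ, (∀ a, ρ' a < I.n) ∧
      (∀ a ∈ A, ρ' a = ρ a) ∧ R₁ I ρ' ∧ R₂ I ρ') := by
  set X := A₁ \ A₂ with hX
  set E := (A₁ ∩ A₂) \ A with hE
  set Z := A₂ \ A₁ with hZ
  set D := A₁ ∩ A₂ ∩ A with hD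
  -- The sets `A₁`, `A₂` and `A` are the disjoint unions of `D` with two of `X`, `E`, `Z`, which
  -- bounds the pairwise sums of cardinalities.
  have c1 : X.card + E.card + D.card ≤ p := by
    rw [← Finset.card_union_of_disjoint, ← Finset.card_union_of_disjoint]
    · exact (Finset.card_le_card (by grind)).trans hp₁
    · rw [Finset.disjoint_left]; grind
    · rw [Finset.disjoint_left]; grind
  have c2 : E.card + Z.card + D.card ≤ p := by
    rw [← Finset.card_union_of_disjoint, ← Finset.card_union_of_disjoint]
    · exact (Finset.card_le_card (by grind)).trans hp₂
    · rw [Finset.disjoint_left]; grind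
    · rw [Finset.disjoint_left]; grind
  have c3 : X.card + Z.card + D.card ≤ p := by
    rw [← Finset.card_union_of_disjoint, ← Finset.card_union_of_disjoint]
    · exact (Finset.card_le_card (by grind)).trans hp
    · rw [Finset.disjoint_left]; grind
    · rw [Finset.disjoint_left]; grind
  have b1 : A₁ ⊆ D ∪ X ∪ E := by grind
  have b2 : A₂ ⊆ D ∪ E ∪ Z := by grind
  have b3 : A ⊆ D ∪ X ∪ Z := by grind
  have d1 : Disjoint X E := by rw [Finset.disjoint_left]; grind
  have d2 : Disjoint X Z := by rw [Finset.disjoint_left]; grind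
  have d3 : Disjoint E Z := by rw [Finset.disjoint_left]; grind
  clear_value X E Z D
  obtain ⟨U, k, hU, u1, u2, u3⟩ := exists_balancing_subset (F₁ := X) (F₂ := E) (F₃ := Z)
    (q := p - D.card) (by omega) (by omega) (by omega)
  have hle : ∀ F : Finset α, F \ (D ∪ U) ⊆ F \ U := fun F =>
    Finset.sdiff_subset_sdiff subset_rfl Finset.subset_union_right
  refine h₁.join_of_partition hω h₂ (S := D ∪ U) (X := X \ (D ∪ U)) (E := E \ (D ∪ U))
    (Z := Z \ (D ∪ U)) (k := k) (b1.trans (union_subset_union_sdiff Finset.subset_union_left))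
    (b2.trans (union_subset_union_sdiff Finset.subset_union_left))
    (b3.trans (union_subset_union_sdiff Finset.subset_union_left))
    (d1.mono Finset.sdiff_subset Finset.sdiff_subset)
    (d2.mono Finset.sdiff_subset Finset.sdiff_subset)
    (d3.mono Finset.sdiff_subset Finset.sdiff_subset)
    ((Finset.card_le_card (hle X)).trans u1) ((Finset.card_le_card (hle E)).trans u2)
    ((Finset.card_le_card (hle Z)).trans u3) fun I =>
      (rpow_join_le I.pos hω.two_le (p := p) ?_).trans (hT I)
  have := Finset.card_union_le D U
  omega

/-- Conjunction and existential quantification. -/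
theorem TableComputable.join {ω : ℝ} (hω : MatMulInTime ω)
    {T : DetectionInstance → ℝ} {A₁ A₂ A : Finset α} {p : ℕ}
    {R₁ R₂ : DetectionInstance → (α → ℕ) → Prop} (h₁ : TableComputable T A₁ R₁)
    (h₂ : TableComputable T A₂ R₂)
    (hR₁ : ∀ (I : DetectionInstance) ρ ρ', (∀ a ∈ A₁, ρ a = ρ' a) → R₁ I ρ → R₁ I ρ')
    (hR₂ : ∀ (I : DetectionInstance) ρ ρ', (∀ a ∈ A₂, ρ a = ρ' a) → R₂ I ρ → R₂ I ρ')
    (hA : A ⊆ A₁ ∪ A₂) (hp₁ : A₁.card ≤ p) (hp₂ : A₂.card ≤ p) (hp : A.card ≤ p)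
    (hT : ∀ I : DetectionInstance, (I.n : ℝ) ^ (ω * p / 2) ≤ T I) :
    TableComputable T A (fun I ρ => ∃ ρ' : α → ℕ, (∀ a, ρ' a < I.n) ∧
      (∀ a ∈ A, ρ' a = ρ a) ∧ R₁ I ρ' ∧ R₂ I ρ') := by
  have hTp : ∀ {q : ℕ}, q ≤ p → ∀ I : DetectionInstance, (I.n : ℝ) ^ q ≤ T I := fun hq I =>
    (pow_le_rpow_width I.pos hω.two_le hq).trans (hT I)
  -- A variable that occurs in one of the two tables only, and not in the result, can be quantified
  -- within that table.
  have h₁' := h₁.project (A' := A₁ ∩ (A₂ ∪ A)) Finset.inter_subset_left (hTp hp₁)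
  have h₂' := h₂.project (A' := A₂ ∩ (A₁ ∪ A)) Finset.inter_subset_left (hTp hp₂)
  refine (h₁'.join_of_subset hω h₂' (A := A) (by grind) (by grind) (by grind)
    ((Finset.card_le_card Finset.inter_subset_left).trans hp₁)
    ((Finset.card_le_card Finset.inter_subset_left).trans hp₂) hp hT).congr fun I ρ hρ => ?_
  constructor
  · rintro ⟨ρ', hρ', hag, ⟨ρ₁, hρ₁, hag₁, h1⟩, ρ₂, hρ₂, hag₂, h2⟩
    -- The quantified variables of the two tables are disjoint, so the witnesses can be combined; on
    -- `A₁ ∩ A₂` and on `A` both were required to agree with `ρ'`.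
    refine ⟨fun a => if a ∈ A₁ then ρ₁ a else if a ∈ A₂ then ρ₂ a else ρ' a, fun a => ?_,
      fun a ha => ?_, hR₁ I _ _ (fun a ha => ?_) h1, hR₂ I _ _ (fun a ha => ?_) h2⟩
    · simp only
      split_ifs
      exacts [hρ₁ a, hρ₂ a, hρ' a]
    · rw [← hag a ha]
      simp only
      split_ifs with ha1 ha2
      · exact hag₁ a (by simp [ha, ha1])
      · exact hag₂ a (by simp [ha, ha2])
      · rfl
    · rw [if_pos ha]
    · rw [if_pos ha]
      split_ifs with ha1
      · rw [hag₁ a (by simp [ha, ha1]), hag₂ a (by simp [ha, ha1])]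
      · rfl
  · rintro ⟨ρ', hρ', hag, h1, h2⟩
    exact ⟨ρ', hρ', hag, ⟨ρ', hρ', fun _ _ => rfl, h1⟩, ρ', hρ', fun _ _ => rfl, h2⟩

end Join

/-! ### Adjacency lists -/

namespace DetectionInstance

variable (I : DetectionInstance)

/-- The length of the list of vertex `x`. -/
def deg (x : ℕ) : ℕ := if h : x < I.n then (I.adj ⟨x, h⟩).length else 0

/-- The position of the list of vertex `x`. -/
def offset (x : ℕ) : ℕ := (detectionInput I.adj).arr 0 x

/-- The number at position `j` of the concatenated lists. -/
def entry (j : ℕ) : ℕ := (detectionInput I.adj).arr 1 j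

theorem offset_eq {x : ℕ} (hx : x ≤ I.n) :
    I.offset x = ((List.ofFn I.adj).take x).flatten.length := by
  simp [offset, detectionInput, hx]

theorem offset_succ {x : ℕ} (hx : x < I.n) : I.offset (x + 1) = I.offset x + I.deg x := by
  rw [I.offset_eq hx, I.offset_eq hx.le, deg, dif_pos hx,
    ← List.take_concat_get' (List.ofFn I.adj) x (by simpa using hx)]
  simp

theorem entry_offset_add {x : ℕ} (hx : x < I.n) {l : ℕ} (hl : l < (I.adj ⟨x, hx⟩).length) :
    I.entry (I.offset x + l) = (I.adj ⟨x, hx⟩)[l] := by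
  have hsplit : (List.ofFn I.adj).flatten = ((List.ofFn I.adj).take x).flatten ++
      (I.adj ⟨x, hx⟩ ++ ((List.ofFn I.adj).drop (x + 1)).flatten) := by
    conv_lhs => rw [← List.take_append_drop x (List.ofFn I.adj), List.flatten_append,
      List.drop_eq_getElem_cons (by simpa using hx), List.flatten_cons]
    simp
  simp only [entry, detectionInput, one_ne_zero, if_false, if_true]
  rw [I.offset_eq hx.le]
  generalize ((List.ofFn I.adj).take x).flatten = pre at *
  rw [hsplit, List.map_append, List.getD_append_right _ _ _ _
      (by rw [List.length_map]; exact Nat.le_add_right _ _),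
    List.length_map, Nat.add_sub_cancel_left, List.map_append,
    List.getD_append _ _ _ _ (by simpa using hl), List.getD_eq_getElem _ _ (by simpa using hl),
    List.getElem_map]

theorem adj_iff {x : ℕ} (hx : x < I.n) (y : ℕ) :
    I.Adj x y ↔ ∃ l < I.deg x, I.entry (I.offset x + l) = y := by
  rw [deg, dif_pos hx]
  constructor
  · rintro ⟨hx', hy, h⟩
    obtain ⟨l, hl, he⟩ := List.getElem_of_mem (((I.isAdj ⟨x, hx⟩).2 ⟨y, hy⟩).mpr h)
    exact ⟨l, hl, by rw [I.entry_offset_add hx hl, he]⟩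
  · rintro ⟨l, hl, rfl⟩
    rw [I.entry_offset_add hx hl]
    exact ⟨hx, Fin.is_lt _, ((I.isAdj ⟨x, hx⟩).2 _).mp (List.getElem_mem hl)⟩

theorem deg_le (x : ℕ) : I.deg x ≤ I.n := by
  unfold deg
  split_ifs with h
  · simpa using (I.isAdj ⟨x, h⟩).1.length_le_card
  · exact Nat.zero_le _

theorem offset_le {x : ℕ} (hx : x ≤ I.n) : I.offset x ≤ x * I.n := by
  induction x with
  | zero => simp [I.offset_eq]
  | succ x ih =>
    rw [I.offset_succ hx, add_mul, one_mul]
    exact Nat.add_le_add (ih (by omega)) (I.deg_le x)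

theorem entry_le (j : ℕ) : I.entry j ≤ I.n := by
  simp only [entry, detectionInput, one_ne_zero, if_false, if_true]
  rw [List.getD_eq_getElem?_getD]
  rcases h : (List.map (fun v : Fin I.n => (v : ℕ)) (List.ofFn I.adj).flatten)[j]? with _ | v
  · simp
  · obtain ⟨w, -, rfl⟩ := List.mem_map.mp (List.mem_of_getElem? h)
    simp

theorem sum_deg : ∑ x ∈ Finset.range I.n, I.deg x = 2 * I.G.edgeSet.ncard := by
  classical
  rw [Finset.sum_range, ← SimpleGraph.coe_edgeFinset, Set.ncard_coe_finset,
    ← SimpleGraph.sum_degrees_eq_twice_card_edges]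
  refine Finset.sum_congr rfl fun x _ => ?_
  rw [deg, dif_pos x.2, ← SimpleGraph.card_neighborFinset_eq_degree,
    ← List.toFinset_card_of_nodup (I.isAdj x).1]
  congr 1
  ext y
  simp [(I.isAdj x).2 y]

/-- By the handshake lemma the left-hand side is `1 + (δ + 2) * n + 2 * m`, and the leading `1` is
at most `n`. -/
theorem sum_deg_add_le (δ : ℕ) : (1 : ℝ) + ∑ x ∈ Finset.range I.n,
    (1 + (1 + ((I.deg x + δ : ℕ) : ℝ))) ≤ (δ + 3 : ℕ) * ((I.n : ℝ) + I.G.edgeSet.ncard) := by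
  have h1 : (1 : ℝ) ≤ I.n := by exact_mod_cast I.pos
  have h2 : (∑ x ∈ Finset.range I.n, (I.deg x : ℝ)) = 2 * I.G.edgeSet.ncard := by
    exact_mod_cast I.sum_deg
  push_cast
  simp only [Finset.sum_add_distrib, h2, Finset.sum_const, Finset.card_range, nsmul_eq_mul]
  have h3 : (0 : ℝ) ≤ I.G.edgeSet.ncard := Nat.cast_nonneg _
  have h4 : (0 : ℝ) ≤ δ := Nat.cast_nonneg _
  nlinarith [mul_nonneg h4 h3]

end DetectionInstance

open DetectionInstance

/-- The input arrays are in place. -/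
structure HoldsInput (I : DetectionInstance) (s : State) : Prop where
  size : s.var 0 = I.n
  offsets : s.arr 0 = I.offset
  lists : s.arr 1 = I.entry

theorem DetectionInstance.Ready.holdsInput {I : DetectionInstance} {M : ℕ} {s : State}
    (h : I.Ready M s) : HoldsInput I s := ⟨h.size, h.offsets, h.lists⟩

/-- The number of list positions (plus `δ`) of the vertex in variable `2`. -/
def degExpr (δ : ℕ) : Expr :=
  .bin .add (.bin .sub (.load 0 (.bin .add (.var 2) (.const 1))) (.load 0 (.var 2))) (.const δ)

/-- The list entry of the vertex in variable `2` at the position in variable `4`. -/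
def entryExpr : Expr := .load 1 (.bin .add (.load 0 (.var 2)) (.var 4))

/-- `for x = 0, …, n - 1 do for y = 0, …, deg x + δ - 1 do if e then a[f] := 1`. -/
def listLoop (δ : ℕ) (e : Expr) (a : ℕ) (f : Expr) : Cmd :=
  forLoop 2 (.var 0) (scatter 4 (degExpr δ) e a f)

/-- The states within the inner loop of `listLoop`. -/
def InListLoop (P : DetectionInstance → State → Prop) (δ : ℕ) (I : DetectionInstance)
    (s : State) : Prop :=
  ∃ s₀, P I s₀ ∧ ∃ k < I.n, ∃ l < I.deg k + δ, s = (s₀.setVar 2 k).setVar 4 l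

section ListLoop

variable {P : DetectionInstance → State → Prop} {δ : ℕ}

theorem InListLoop.var_zero {I : DetectionInstance} {s : State} (hP : ∀ I s, P I s → HoldsInput I s)
    (h : InListLoop P δ I s) : s.var 0 = I.n := by
  obtain ⟨s₀, h₀, k, -, l, -, rfl⟩ := h
  rw [State.setVar_var_ne _ _ (by omega), State.setVar_var_ne _ _ (by omega), (hP I s₀ h₀).size]

theorem polyFits_inListLoop_zero (hP : ∀ I s, P I s → HoldsInput I s) :
    PolyFits DetectionInstance.n (InListLoop P δ) (.var 0) :=
  PolyFits.var (PolyBdd.of_le_pow 1 fun I s h => by rw [h.var_zero hP, pow_one])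

theorem polyFits_inListLoop_two :
    PolyFits DetectionInstance.n (InListLoop P δ) (.var 2) := by
  refine PolyFits.var (PolyBdd.of_le_pow 1 ?_)
  rintro I s ⟨s₀, h₀, k, hk, l, -, rfl⟩
  rw [State.setVar_var_ne _ _ (by omega), State.setVar_var_self, pow_one]
  exact hk.le

theorem polyFits_inListLoop_four :
    PolyFits DetectionInstance.n (InListLoop P δ) (.var 4) := by
  refine PolyFits.var ⟨1 + δ, ?_⟩
  rintro I s ⟨s₀, h₀, k, hk, l, hl, rfl⟩
  simp only [State.setVar_var_self]
  have h1 := I.deg_le k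
  have h2 := const_lt_pow_size I.n δ
  rw [pow_add, pow_one]
  nlinarith

theorem polyFits_entryExpr (hP : ∀ I s, P I s → HoldsInput I s) :
    PolyFits DetectionInstance.n (InListLoop P δ) entryExpr := by
  refine PolyFits.load (PolyFits.bin (PolyFits.load polyFits_inListLoop_two
    (PolyBdd.of_le_pow 2 ?_)) polyFits_inListLoop_four) (PolyBdd.of_le_pow 1 ?_)
  · rintro I s ⟨s₀, h₀, k, hk, l, hl, rfl⟩
    simp only [Expr.eval, State.setVar_arr, (hP I s₀ h₀).offsets]
    rw [State.setVar_var_ne _ _ (by omega), State.setVar_var_self, sq]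
    exact (I.offset_le hk.le).trans (Nat.mul_le_mul_right _ hk.le)
  · rintro I s ⟨s₀, h₀, k, hk, l, hl, rfl⟩
    simp only [State.setVar_arr, (hP I s₀ h₀).lists, pow_one]
    exact I.entry_le _

theorem entryExpr_eval {I : DetectionInstance} {s : State} (h : HoldsInput I s) (k l : ℕ) :
    entryExpr.eval ((s.setVar 2 k).setVar 4 l) = I.entry (I.offset k + l) := by
  simp only [entryExpr, Expr.eval, Op.eval, State.setVar_arr, h.lists, h.offsets,
    State.setVar_var_self]
  rw [State.setVar_var_ne _ _ (by omega), State.setVar_var_self]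

/-- The inner loop runs `deg x + δ` times, which adds up to `O(n + m)`. The slack `δ` gives the
search for a non-neighbour its one extra trial. -/
theorem triple_listLoop (hP : ∀ I s, P I s → HoldsInput I s) {e : Expr} {a : ℕ} {f : Expr}
    (ha : 2 ≤ a) (hea : a ∉ e.arrs) (hfa : a ∉ f.arrs)
    (he : PolyFits DetectionInstance.n (InListLoop P δ) e)
    (hf : PolyFits DetectionInstance.n (fun I s => InListLoop P δ I s ∧ e.eval s ≠ 0) f) :
    Triple DetectionInstance.n (fun I => (I.n : ℝ) + I.G.edgeSet.ncard) P (listLoop δ e a f)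
      (fun I s s' => s'.var 0 = s.var 0 ∧
        s'.arr = scatterArr₂ 2 4 e a f s I.n (fun k => I.deg k + δ)) := by
  have g0 : PolyFits DetectionInstance.n P (.var 0) :=
    PolyFits.var (PolyBdd.of_le_pow 1 fun I s h => by rw [(hP I s h).size, pow_one])
  have g2 : PolyFits DetectionInstance.n
      (fun I s => ∃ s₀, P I s₀ ∧ ∃ k < I.n, s = s₀.setVar 2 k) (.var 2) := by
    refine PolyFits.var (PolyBdd.of_le_pow 1 ?_)
    rintro I s ⟨s₀, h₀, k, hk, rfl⟩
    rw [State.setVar_var_self, pow_one]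
    exact hk.le
  refine (Triple.scatter₂ (x := 2) (y := 4) (Lx := .var 0) (Ly := degExpr δ)
    (L := DetectionInstance.n) (M := fun I k => I.deg k + δ) (by omega)
    (fun I s h => (hP I s h).size) g0 (fun I s h k hk => ?_) ?_ (by simp [Expr.vars]) (by simp [Expr.vars]) (by simp [degExpr, Expr.vars])
    (by simp [Expr.arrs]) (by simp [degExpr, Expr.arrs]; omega) hea hfa he hf).weaken
    (fun _ _ h => h) (fun I s s' _ h => ⟨h.1 0 (by omega) (by omega), h.2⟩)
    ⟨δ + 3, fun I => I.sum_deg_add_le δ⟩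
  · have h1 := I.offset_succ hk
    simp only [degExpr, Expr.eval, Op.eval, State.setVar_arr, State.setVar_var_self,
      (hP I s h).offsets]
    omega
  · refine PolyFits.bin (PolyFits.bin (PolyFits.load (g2.bin (PolyFits.const 1))
      (PolyBdd.of_le_pow 2 ?_)) (PolyFits.load g2 (PolyBdd.of_le_pow 2 ?_))) (PolyFits.const δ)
    · rintro I s ⟨s₀, h₀, k, hk, rfl⟩
      simp only [Expr.eval, Op.eval, State.setVar_arr, State.setVar_var_self,
        (hP I s₀ h₀).offsets, sq]
      exact (I.offset_le hk).trans (Nat.mul_le_mul_right _ hk)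
    · rintro I s ⟨s₀, h₀, k, hk, rfl⟩
      simp only [Expr.eval, State.setVar_arr, State.setVar_var_self,
        (hP I s₀ h₀).offsets, sq]
      exact (I.offset_le hk.le).trans (Nat.mul_le_mul_right _ hk.le)

end ListLoop

theorem scatterArr₂_ne {x y : ℕ} {e : Expr} {a : ℕ} {f : Expr} {s : State} {k : ℕ} {M : ℕ → ℕ}
    {b : ℕ} (h : b ≠ a) : scatterArr₂ x y e a f s k M b = s.arr b := by
  simp [scatterArr₂, h]

theorem scatterArr₂_le_one {x y : ℕ} {e : Expr} {a : ℕ} {f : Expr} {s : State} {k : ℕ}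
    {M : ℕ → ℕ} (h : s.arr a = 0) (j : ℕ) : scatterArr₂ x y e a f s k M a j ≤ 1 := by
  simp only [scatterArr₂, Function.update_self, h, Pi.zero_apply]
  split_ifs <;> omega

theorem scatterArr₂_ne_zero {x y : ℕ} {e : Expr} {a : ℕ} {f : Expr} {s : State} {k : ℕ}
    {M : ℕ → ℕ} (h : s.arr a = 0) (j : ℕ) : scatterArr₂ x y e a f s k M a j ≠ 0 ↔
      ∃ l < k, ∃ m < M l, e.eval ((s.setVar x l).setVar y m) ≠ 0 ∧
        f.eval ((s.setVar x l).setVar y m) = j := by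
  simp only [scatterArr₂, Function.update_self, h, Pi.zero_apply]
  split_ifs with h' <;> simp [h']

/-- Writing the adjacency matrix into array `2`. Memory is zero initially, so that the time is
linear. -/
def matrixCmd : Cmd := listLoop 0 (.const 1) 2 (.bin .add (.bin .mul (.var 2) (.var 0)) entryExpr)

theorem triple_matrixCmd : Triple DetectionInstance.n
    (fun I => (I.n : ℝ) + I.G.edgeSet.ncard) (fun I s => s = detectionInput I.adj) matrixCmd
    (fun I _ s' => I.Ready 3 s') := by
  have hP : ∀ (I : DetectionInstance) s, s = detectionInput I.adj → HoldsInput I s := by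
    rintro I s rfl
    exact ⟨by simp [detectionInput], rfl, rfl⟩
  refine (triple_listLoop hP le_rfl (by simp [Expr.arrs]) (by simp [Expr.arrs, entryExpr])
    (PolyFits.const 1) (((polyFits_inListLoop_two.bin (polyFits_inListLoop_zero hP)).bin
      (polyFits_entryExpr hP)).mono fun _ _ h => h.1)).weaken (fun _ _ h => h) ?_
      ⟨1, fun I => by simp⟩
  rintro I s s' hs ⟨h1, h2⟩
  have hin := hP I s hs
  have h0 : ∀ a, 2 ≤ a → s.arr a = 0 := by
    intro a ha
    subst hs
    funext j
    simp [detectionInput, show a ≠ 0 by omega, show a ≠ 1 by omega]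
  refine ⟨h1.trans hin.size, fun a ha => ?_, ?_, ?_, fun j => ?_, fun x hx y hy => ?_⟩
  · rw [h2, scatterArr₂_ne (by omega), h0 a (by omega)]
  · rw [h2, scatterArr₂_ne (by omega), hin.offsets]
    rfl
  · rw [h2, scatterArr₂_ne (by omega), hin.lists]
    rfl
  · rw [h2]
    exact scatterArr₂_le_one (h0 2 le_rfl) j
  · rw [h2, scatterArr₂_ne_zero (h0 2 le_rfl)]
    have hev : ∀ k l, (Expr.bin .add (.bin .mul (.var 2) (.var 0)) entryExpr).eval
        ((s.setVar 2 k).setVar 4 l) = k * I.n + I.entry (I.offset k + l) := by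
      intro k l
      simp only [Expr.eval, Op.eval, entryExpr_eval hin]
      rw [State.setVar_var_ne _ _ (by omega), State.setVar_var_self,
        State.setVar_var_ne _ _ (by omega), State.setVar_var_ne _ _ (by omega), hin.size]
    simp only [hev]
    constructor
    · rintro ⟨k, hk, l, hl, -, h⟩
      have hadj := (I.adj_iff hk _).mpr ⟨l, hl, rfl⟩
      obtain ⟨rfl, rfl⟩ := index_injective hadj.2.1 hy h
      exact hadj
    · intro h
      obtain ⟨l, hl, rfl⟩ := (I.adj_iff hx y).mp h
      exact ⟨x, hx, l, hl, by simp [Expr.eval], rfl⟩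

/-! ### Unary relations -/

section Unary

variable {α : Type*}

theorem tupleIndex_singleton (n : ℕ) (u : α) (ρ : α → ℕ) :
    tupleIndex n ({u} : Finset α).toList ρ = ρ u := by
  simp [tupleIndex]

/-- Unary relations that are decided by a search in the adjacency list. -/
theorem TableComputable.of_listLoop {T : DetectionInstance → ℝ}
    (hT : ∀ I, (I.n : ℝ) + I.G.edgeSet.ncard ≤ T I) {δ : ℕ} {e : Expr} (u : α)
    {r : DetectionInstance → ℕ → Prop} (hea : ∀ a ∈ e.arrs, a < 3)
    (he : ∀ M, PolyFits DetectionInstance.n (InListLoop (fun I s => I.Ready M s) δ) e)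
    (hr : ∀ (I : DetectionInstance) M s, I.Ready M s → ∀ x < I.n,
      ((∃ l < I.deg x + δ, e.eval ((s.setVar 2 x).setVar 4 l) ≠ 0) ↔ r I x)) :
    TableComputable T {u} (fun I ρ => r I (ρ u)) := by
  intro M hM
  refine ⟨_, M + 1, M, by omega, by omega, (triple_listLoop (δ := δ) (e := e) (a := M)
    (f := .var 2) (fun I s h => Ready.holdsInput h) (by omega)
    (fun h => by have := hea M h; omega) (by simp [Expr.arrs]) (he M)
    (polyFits_inListLoop_two.mono fun _ _ h => h.1)).weaken (fun _ _ h => h) ?_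
    ⟨1, fun I => by simpa using hT I⟩⟩
  rintro I s s' hs ⟨h1, h2⟩
  have h0 := hs.fresh M le_rfl
  refine ⟨hs.transfer h1 (fun a ha => ?_) (fun a ha => ?_), fun a ha => ?_, fun j => ?_,
    fun ρ hρ => ?_⟩
  · rw [h2, scatterArr₂_ne (by omega)]
  · rw [h2, scatterArr₂_ne (by omega), hs.fresh a (by omega)]
  · rw [h2, scatterArr₂_ne (by omega)]
  · rw [h2]
    exact scatterArr₂_le_one h0 j
  · simp only
    rw [h2, scatterArr₂_ne_zero h0, tupleIndex_singleton, ← hr I M s hs _ (hρ u)]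
    have hev : ∀ k l, (Expr.var 2).eval ((s.setVar 2 k).setVar 4 l) = k := by
      intro k l
      rw [Expr.eval, State.setVar_var_ne _ _ (by omega), State.setVar_var_self]
    simp only [hev]
    constructor
    · rintro ⟨k, hk, l, hl, h, rfl⟩
      exact ⟨l, hl, h⟩
    · rintro ⟨l, hl, h⟩
      exact ⟨_, hρ u, l, hl, h, rfl⟩

/-- The pigeonhole principle: distinct neighbours occupy distinct positions in the list. -/
theorem DetectionInstance.le_deg (I : DetectionInstance) {x k : ℕ} (hx : x < I.n) {g : ℕ → ℕ}
    (hg : ∀ l < k, ∀ l' < k, g l = g l' → l = l') (h : ∀ l < k, I.Adj x (g l)) :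
    k ≤ I.deg x := by
  have h1 : (Finset.range k).image g ⊆
      (Finset.range (I.deg x)).image fun l => I.entry (I.offset x + l) := by
    intro y hy
    obtain ⟨l, hl, rfl⟩ := Finset.mem_image.mp hy
    obtain ⟨m, hm, he⟩ := (I.adj_iff hx _).mp (h l (Finset.mem_range.mp hl))
    exact Finset.mem_image.mpr ⟨m, Finset.mem_range.mpr hm, he⟩
  have h2 := (Finset.card_le_card h1).trans Finset.card_image_le
  rwa [Finset.card_image_of_injOn, Finset.card_range, Finset.card_range] at h2
  intro l hl l' hl' h
  exact hg l (by simpa using hl) l' (by simpa using hl') h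

/-- A non-neighbour is found after at most `deg x` neighbours. -/
theorem DetectionInstance.exists_not_adj (I : DetectionInstance) {x : ℕ} (hx : x < I.n)
    {g : ℕ → ℕ} {q : ℕ → Prop} (hq : ∀ l l', l ≤ l' → q l' → q l)
    (hg : ∀ l l', q l → q l' → g l = g l' → l = l') (h : ∃ l, q l ∧ ¬ I.Adj x (g l)) :
    ∃ l < I.deg x + 1, q l ∧ ¬ I.Adj x (g l) := by
  classical
  have h1 := Nat.find_spec h
  refine ⟨Nat.find h, Nat.lt_succ_of_le (I.le_deg hx (g := g) (fun l hl l' hl' => ?_)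
    fun l hl => ?_), h1⟩
  · exact hg l l' (hq _ _ hl.le h1.1) (hq _ _ hl'.le h1.1)
  · by_contra h2
    exact Nat.find_min h hl ⟨hq _ _ hl.le h1.1, h2⟩

variable {T : DetectionInstance → ℝ}

theorem tableComputable_exists_adj_gt
    (hT : ∀ I, (I.n : ℝ) + I.G.edgeSet.ncard ≤ T I) (u : α) :
    TableComputable T {u} (fun I ρ => ∃ y, ρ u < y ∧ I.Adj (ρ u) y) := by
  refine TableComputable.of_listLoop hT (δ := 0) (e := .bin .lt (.var 2) entryExpr) u
    (r := fun I x => ∃ y, x < y ∧ I.Adj x y) (by simp [Expr.arrs, entryExpr])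
    (fun M => polyFits_inListLoop_two.bin (polyFits_entryExpr fun _ _ h => Ready.holdsInput h)) ?_
  intro I M s hs x hx
  have hev : ∀ l, (Expr.bin .lt (.var 2) entryExpr).eval ((s.setVar 2 x).setVar 4 l) ≠ 0 ↔
      x < I.entry (I.offset x + l) := by
    intro l
    rw [Expr.eval, entryExpr_eval hs.holdsInput, Expr.eval, State.setVar_var_ne _ _ (by omega),
      State.setVar_var_self]
    simp [Op.eval]
  simp only [hev, I.adj_iff hx, add_zero]
  constructor
  · rintro ⟨l, hl, h⟩
    exact ⟨_, h, l, hl, rfl⟩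
  · rintro ⟨y, h, l, hl, rfl⟩
    exact ⟨l, hl, h⟩

theorem tableComputable_exists_adj_lt
    (hT : ∀ I, (I.n : ℝ) + I.G.edgeSet.ncard ≤ T I) (u : α) :
    TableComputable T {u} (fun I ρ => ∃ y, y < ρ u ∧ I.Adj (ρ u) y) := by
  refine TableComputable.of_listLoop hT (δ := 0) (e := .bin .lt entryExpr (.var 2)) u
    (r := fun I x => ∃ y, y < x ∧ I.Adj x y) (by simp [Expr.arrs, entryExpr])
    (fun M => (polyFits_entryExpr fun _ _ h => Ready.holdsInput h).bin polyFits_inListLoop_two) ?_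
  intro I M s hs x hx
  have hev : ∀ l, (Expr.bin .lt entryExpr (.var 2)).eval ((s.setVar 2 x).setVar 4 l) ≠ 0 ↔
      I.entry (I.offset x + l) < x := by
    intro l
    rw [Expr.eval, entryExpr_eval hs.holdsInput, Expr.eval, State.setVar_var_ne _ _ (by omega),
      State.setVar_var_self]
    simp [Op.eval]
  simp only [hev, I.adj_iff hx, add_zero]
  constructor
  · rintro ⟨l, hl, h⟩
    exact ⟨_, h, l, hl, rfl⟩
  · rintro ⟨y, h, l, hl, rfl⟩
    exact ⟨l, hl, h⟩

/-- Search for the first `l` with `q`, such that the entry of the adjacency matrix in the row of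
the vertex in variable `2` and the column given by `g` is `0`. -/
theorem tableComputable_exists_not_adj
    (hT : ∀ I, (I.n : ℝ) + I.G.edgeSet.ncard ≤ T I) (u : α) {qe ge : Expr} {q : ℕ → ℕ → ℕ → Prop}
    {g : ℕ → ℕ → ℕ} (hqa : qe.arrs = ∅) (hga : ge.arrs = ∅)
    (hqf : ∀ M, PolyFits DetectionInstance.n (InListLoop (fun I s => I.Ready M s) 1) qe)
    (hgf : ∀ M, PolyFits DetectionInstance.n (InListLoop (fun I s => I.Ready M s) 1) ge)
    (hqe : ∀ (I : DetectionInstance) M s x l, I.Ready M s →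
      (qe.eval ((s.setVar 2 x).setVar 4 l) ≠ 0 ↔ q I.n x l))
    (hge : ∀ (I : DetectionInstance) M s x l, I.Ready M s →
      ge.eval ((s.setVar 2 x).setVar 4 l) = g x l)
    (hq : ∀ n x l l', l ≤ l' → q n x l' → q n x l)
    (hg : ∀ n x l l', q n x l → q n x l' → g x l = g x l' → l = l')
    (hgn : ∀ n x l, x < n → q n x l → g x l < n) :
    TableComputable T {u} (fun I ρ => ∃ l, q I.n (ρ u) l ∧ ¬ I.Adj (ρ u) (g (ρ u) l)) := by
  refine TableComputable.of_listLoop hT (δ := 1) (e := .bin .mul qe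
    (.bin .eq (.load 2 (.bin .add (.bin .mul (.var 2) (.var 0)) ge)) (.const 0))) u
    (r := fun I x => ∃ l, q I.n x l ∧ ¬ I.Adj x (g x l)) ?_ (fun M => ?_) ?_
  · simp [Expr.arrs, hqa, hga]
  · refine (hqf M).bin (PolyFits.bin (PolyFits.load (PolyFits.bin (polyFits_inListLoop_two.bin
      (polyFits_inListLoop_zero fun _ _ h => Ready.holdsInput h)) (hgf M))
      (PolyBdd.of_le_const 1 ?_)) (PolyFits.const 0))
    -- The candidate may lie outside the graph, so that the address leaves the row. The load is
    -- harmless since the bound on array `2` holds at all addresses.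
    rintro I s ⟨s₀, h₀, k, hk, l, hl, rfl⟩
    exact h₀.matrix_le _
  · intro I M s hs x hx
    have hev : ∀ l, (Expr.bin .mul qe (.bin .eq (.load 2 (.bin .add (.bin .mul (.var 2)
        (.var 0)) ge)) (.const 0))).eval ((s.setVar 2 x).setVar 4 l) ≠ 0 ↔
        q I.n x l ∧ ¬ I.Adj x (g x l) := by
      intro l
      have h2 : ((s.setVar 2 x).setVar 4 l).var 2 = x := by
        rw [State.setVar_var_ne _ _ (by omega), State.setVar_var_self]
      have h0 : ((s.setVar 2 x).setVar 4 l).var 0 = I.n := by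
        rw [State.setVar_var_ne _ _ (by omega), State.setVar_var_ne _ _ (by omega), hs.size]
      simp only [Expr.eval, Op.eval, h2, h0, hge I M s x l hs, State.setVar_arr, ne_eq,
        mul_eq_zero, not_or]
      rw [← ne_eq, hqe I M s x l hs]
      refine and_congr_right fun hql => ?_
      rw [← hs.matrix x hx _ (hgn _ _ _ hx hql)]
      simp
    simp only [hev]
    exact ⟨fun ⟨l, _, h⟩ => ⟨l, h⟩, fun h => I.exists_not_adj hx (hq _ _) (hg _ _) h⟩

/-- The candidates are tried in the order `x + 1`, `x + 2`, …, so that those within the graph form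
an initial segment. -/
theorem tableComputable_exists_not_adj_gt
    (hT : ∀ I, (I.n : ℝ) + I.G.edgeSet.ncard ≤ T I) (u : α) :
    TableComputable T {u} (fun I ρ => ∃ y, ρ u < y ∧ y < I.n ∧ ¬ I.Adj (ρ u) y) := by
  have hgf : ∀ M, PolyFits DetectionInstance.n (InListLoop (fun I s => I.Ready M s) 1)
      (.bin .add (.var 2) (.bin .add (.const 1) (.var 4))) := fun M =>
    polyFits_inListLoop_two.bin ((PolyFits.const 1).bin polyFits_inListLoop_four)
  have hge : ∀ (s : State) x l, (Expr.bin .add (.var 2) (.bin .add (.const 1) (.var 4))).eval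
      ((s.setVar 2 x).setVar 4 l) = x + (1 + l) := by
    intro s x l
    simp only [Expr.eval, Op.eval, State.setVar_var_self]
    rw [State.setVar_var_ne _ _ (by omega), State.setVar_var_self]
  refine (tableComputable_exists_not_adj hT u
    (qe := .bin .lt (.bin .add (.var 2) (.bin .add (.const 1) (.var 4))) (.var 0))
    (ge := .bin .add (.var 2) (.bin .add (.const 1) (.var 4)))
    (q := fun n x l => x + (1 + l) < n) (g := fun x l => x + (1 + l)) (by simp [Expr.arrs])
    (by simp [Expr.arrs])
    (fun M => (hgf M).bin (polyFits_inListLoop_zero fun _ _ h => Ready.holdsInput h)) hgf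
    ?_ (fun I M s x l _ => hge s x l) (fun n x l l' _ _ => by omega)
    (fun n x l l' _ _ _ => by omega) (fun n x l _ h => h)).congr ?_
  · intro I M s x l hs
    rw [Expr.eval, hge, Expr.eval, State.setVar_var_ne _ _ (by omega),
      State.setVar_var_ne _ _ (by omega), hs.size]
    simp [Op.eval]
  · intro I ρ hρ
    constructor
    · rintro ⟨l, h1, h2⟩
      exact ⟨_, by omega, h1, h2⟩
    · rintro ⟨y, h1, h2, h3⟩
      obtain ⟨l, rfl⟩ : ∃ l, y = ρ u + (1 + l) := ⟨y - ρ u - 1, by omega⟩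
      exact ⟨l, h2, h3⟩

theorem tableComputable_exists_not_adj_lt
    (hT : ∀ I, (I.n : ℝ) + I.G.edgeSet.ncard ≤ T I) (u : α) :
    TableComputable T {u} (fun I ρ => ∃ y, y < ρ u ∧ ¬ I.Adj (ρ u) y) := by
  refine (tableComputable_exists_not_adj hT u
    (qe := .bin .lt (.var 4) (.var 2))
    (ge := .bin .sub (.var 2) (.bin .add (.const 1) (.var 4)))
    (q := fun _ x l => l < x) (g := fun x l => x - (1 + l)) (by simp [Expr.arrs])
    (by simp [Expr.arrs]) (fun M => polyFits_inListLoop_four.bin polyFits_inListLoop_two)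
    (fun M => polyFits_inListLoop_two.bin ((PolyFits.const 1).bin polyFits_inListLoop_four))
    ?_ ?_ (fun n x l l' _ _ => by omega)
    (fun n x l l' _ _ _ => by omega) (fun n x l _ h => by omega)).congr ?_
  · intro I M s x l hs
    simp only [Expr.eval, Op.eval, State.setVar_var_self]
    rw [State.setVar_var_ne _ _ (by omega), State.setVar_var_self]
    simp
  · intro I M s x l hs
    simp only [Expr.eval, Op.eval, State.setVar_var_self]
    rw [State.setVar_var_ne _ _ (by omega), State.setVar_var_self]
  · intro I ρ hρ
    constructor
    · rintro ⟨l, h1, h2⟩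
      exact ⟨_, by omega, h2⟩
    · rintro ⟨y, h1, h3⟩
      refine ⟨ρ u - y - 1, by omega, ?_⟩
      rwa [show ρ u - (1 + (ρ u - y - 1)) = y by omega]

/-- A scan of the values of a unary relation in the order given by the involution `γ`. -/
theorem TableComputable.scan (hT : ∀ I, (I.n : ℝ) ≤ T I) {u v : α}
    {r : DetectionInstance → ℕ → Prop} (h : TableComputable T {u} fun I ρ => r I (ρ u))
    {ge : Expr} {γ : ℕ → ℕ → ℕ} (hga : ge.arrs = ∅)
    (hgf : ∀ P : DetectionInstance → State → Prop, (∃ M, ∀ I s, P I s → I.Ready M s) →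
      PolyFits DetectionInstance.n (fun I s => ∃ s₀, P I s₀ ∧ ∃ k < I.n, s = s₀.setVar 2 k) ge)
    (hge : ∀ (I : DetectionInstance) M s l, I.Ready M s → ge.eval (s.setVar 2 l) = γ I.n l)
    (hγ : ∀ n l, l < n → γ n l < n ∧ γ n (γ n l) = l) :
    TableComputable T {v} (fun I ρ => ∃ l < γ I.n (ρ v), r I (γ I.n l)) := by
  intro M hM
  obtain ⟨c, M', t, h1, h2, h3⟩ := h M hM
  let P : DetectionInstance → State → Prop := fun I s =>
    I.Ready M' s ∧ IsTable I.n s t {u} fun ρ => r I (ρ u)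
  -- The intermediate array holds the prefix disjunctions in scanning order. It is not a table yet:
  -- its index is a position in the scan, not a vertex.
  let P' : DetectionInstance → State → Prop := fun I s => I.Ready (M' + 1) s ∧
    (∀ j, s.arr M' j ≤ 1) ∧ ∀ j < I.n, s.arr M' j ≠ 0 ↔ ∃ l < j, r I (γ I.n l)
  have hload : ∀ I s, P I s → ∀ l < I.n, (Expr.load t ge).eval (s.setVar 2 l) ≠ 0 ↔
      r I (γ I.n l) := by
    intro I s hs l hl
    have h4 := hs.2.2 (fun _ => γ I.n l) fun _ => (hγ _ _ hl).1
    simp only [tupleIndex_singleton] at h4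
    rw [Expr.eval, hge I M' s l hs.1, ← h4, State.setVar_arr]
  have hpre : Triple DetectionInstance.n (fun I => (I.n : ℝ)) P
      (prefixOr 2 (.var 0) (.load t ge) M')
      (fun I s s' => P' I s' ∧ ∀ a < M', s'.arr a = s.arr a) := by
    refine (Triple.prefixOr (x := 2) (Le := .var 0) (e := .load t ge) (a := M')
      (L := DetectionInstance.n) (fun I s hs => hs.1.size) ?_ (fun I s hs => hs.1.fresh M' le_rfl)
      (by simp [Expr.vars]) (by simp [Expr.arrs]) (by simp [Expr.arrs, hga]; omega)
      ?_).weaken (fun _ _ h => h) ?_ ⟨2, fun I => ?_⟩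
    · exact PolyFits.var (PolyBdd.of_le_pow 1 fun I s hs => by rw [hs.1.size, pow_one])
    · refine PolyFits.load (hgf P ⟨M', fun I s h => h.1⟩) (PolyBdd.of_le_const 1 ?_)
      rintro I s ⟨s₀, hs, k, hk, rfl⟩
      exact hs.2.1 _
    · rintro I s s' hs rfl
      have hne : ∀ a, a ≠ M' →
          (prefixOrState 2 (.load t ge) M' s I.n).arr a = s.arr a := by
        intro a ha
        simp [prefixOrState, ha]
      refine ⟨⟨hs.1.transfer ?_ (fun a ha => hne a (by omega)) fun a ha => ?_, fun j => ?_,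
        fun j hj => ?_⟩, fun a ha => hne a (by omega)⟩
      · simp [prefixOrState]
      · rw [hne a (by omega), hs.1.fresh a (by omega)]
      · simp only [prefixOrState, Function.update_self]
        exact bit_le_one
      · simp only [prefixOrState, Function.update_self, bit_ne_zero]
        constructor
        · rintro ⟨-, l, hl, h⟩
          exact ⟨l, hl, (hload I s hs l (hl.trans hj)).mp h⟩
        · rintro ⟨l, hl, h⟩
          exact ⟨hj.le, l, hl, (hload I s hs l (hl.trans hj)).mpr h⟩
    · have : (1 : ℝ) ≤ I.n := by exact_mod_cast I.pos
      push_cast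
      linarith
  have hP' : ∀ I s, P' I s → I.Ready (M' + 1) s := fun _ _ h => h.1
  -- Position `l` of the scan is copied to the vertex `γ l`. As `γ` is an involution, each vertex
  -- receives the entry of its own position.
  have hout : Triple DetectionInstance.n (fun I => (I.n : ℝ) ^ 1) P' _ _ :=
    triple_scatter_table (d := 1) (e := .load M' (.var 2)) (f := ge) (A := {v})
      (R := fun I ρ => ∃ l < γ I.n (ρ v), r I (γ I.n l)) (by omega : 3 ≤ M' + 1) hP'
      (by simp [Expr.arrs]) (by simp [hga]) ?_ ?_ ?_
  · refine ⟨_, M' + 2, M' + 1, by omega, by omega, h3.seq ((hpre.weaken (fun _ _ h => h)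
      (fun _ _ _ _ h => h) ⟨1, fun I => by simpa using hT I⟩).seq (hout.weaken (fun _ _ h => h)
      (fun _ _ _ _ h => h) ⟨1, fun I => by simpa using hT I⟩) (fun I s s' _ h => h.1)
      (R := fun I s s' => I.Ready (M' + 2) s' ∧ (∀ a < M', s'.arr a = s.arr a) ∧
        IsTable I.n s' (M' + 1) {v} fun ρ => ∃ l < γ I.n (ρ v), r I (γ I.n l)) ?_)
      (fun I s s' _ h => ⟨h.1, h.2.2⟩) ?_⟩
    · intro I s s' s'' _ h4 h5
      exact ⟨h5.1, fun a ha => (h5.2.1 a (by omega)).trans (h4.2 a ha), h5.2.2⟩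
    · intro I s s' s'' _ h4 h5
      exact ⟨h5.1, fun a ha => (h5.2.1 a (by omega)).trans (h4.2.1 a ha), h5.2.2⟩
  · refine PolyFits.load (PolyFits.var (PolyBdd.of_le_pow 1 ?_)) (PolyBdd.of_le_const 1 ?_)
    · rintro I s ⟨s₀, hs, k, hk, rfl⟩
      rw [State.setVar_var_self]
      exact hk.le
    · rintro I s ⟨s₀, hs, k, hk, rfl⟩
      exact hs.2.1 _
  · simpa only [pow_one] using hgf P' ⟨M' + 1, hP'⟩
  · intro I s hs ρ hρ
    have hev : ∀ l, (Expr.load M' (.var 2)).eval (s.setVar 2 l) = s.arr M' l := by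
      intro l
      rw [Expr.eval, Expr.eval, State.setVar_var_self, State.setVar_arr]
    simp only [hev, hge I _ s _ hs.1, tupleIndex_singleton, pow_one]
    constructor
    · rintro ⟨l, hl, h4, h5⟩
      rw [← h5, (hγ _ _ hl).2]
      exact (hs.2.2 l hl).mp h4
    · intro h4
      obtain ⟨h5, h6⟩ := hγ _ _ (hρ v)
      exact ⟨_, h5, (hs.2.2 _ h5).mpr h4, h6⟩

theorem TableComputable.exists_lt (hT : ∀ I, (I.n : ℝ) ≤ T I) {u v : α}
    {r : DetectionInstance → ℕ → Prop} (h : TableComputable T {u} fun I ρ => r I (ρ u)) :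
    TableComputable T {v} (fun I ρ => ∃ x < ρ v, r I x) := by
  refine h.scan hT (ge := .var 2) (γ := fun _ l => l) (by simp [Expr.arrs]) ?_ ?_
    fun n l hl => ⟨hl, rfl⟩
  · intro P _
    refine PolyFits.var (PolyBdd.of_le_pow 1 ?_)
    rintro I s ⟨s₀, hs, k, hk, rfl⟩
    rw [State.setVar_var_self, pow_one]
    exact hk.le
  · intro I M s l hs
    rw [Expr.eval, State.setVar_var_self]

/-- The reversal `l ↦ n - 1 - l` exchanges larger and smaller vertices, so the scan runs downwards.
Writing it as `n - (1 + l)` suits truncated subtraction. -/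
theorem TableComputable.exists_gt (hT : ∀ I, (I.n : ℝ) ≤ T I) {u v : α}
    {r : DetectionInstance → ℕ → Prop} (h : TableComputable T {u} fun I ρ => r I (ρ u)) :
    TableComputable T {v} (fun I ρ => ∃ x, ρ v < x ∧ x < I.n ∧ r I x) := by
  refine (h.scan hT (ge := .bin .sub (.var 0) (.bin .add (.const 1) (.var 2)))
    (γ := fun n l => n - (1 + l)) (by simp [Expr.arrs]) ?_ ?_ ?_).congr ?_
  · rintro P ⟨M, hM⟩
    refine PolyFits.bin (PolyFits.var (PolyBdd.of_le_pow 1 ?_))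
      ((PolyFits.const 1).bin (PolyFits.var (PolyBdd.of_le_pow 1 ?_)))
    · rintro I s ⟨s₀, hs, k, hk, rfl⟩
      rw [State.setVar_var_ne _ _ (by omega), (hM I s₀ hs).size, pow_one]
    · rintro I s ⟨s₀, hs, k, hk, rfl⟩
      rw [State.setVar_var_self, pow_one]
      exact hk.le
  · intro I M s l hs
    simp only [Expr.eval, Op.eval, State.setVar_var_self]
    rw [State.setVar_var_ne _ _ (by omega), hs.size]
  · intro n l hl
    constructor <;> omega
  · intro I ρ hρ
    have := hρ v
    constructor
    · rintro ⟨l, hl, h⟩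
      exact ⟨_, by omega, by omega, h⟩
    · rintro ⟨x, h1, h2, h3⟩
      refine ⟨I.n - (1 + x), by omega, ?_⟩
      rwa [show I.n - (1 + (I.n - (1 + x))) = x by omega]

end Unary

/-! ### Order and adjacency constraints -/

section Constraints

variable {α : Type*} [LinearOrder α] {T : DetectionInstance → ℝ}

/-- The value of the variable `a` when a table indexed by `A` is filled. -/
noncomputable def entryOf (A : Finset α) (a : α) : Expr := Expr.tupleEntry a A.toList (.var 2)

theorem entryOf_eval {I : DetectionInstance} {M k : ℕ} {s : State} (hs : I.Ready M s)
    (hk : s.var 2 = k) (A : Finset α) (a : α) :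
    (entryOf A a).eval s = tupleEntry I.n A.toList k a := by
  rw [entryOf, Expr.tupleEntry_eval, hs.size, Expr.eval, hk]

theorem notMem_arrs_entryOf (A : Finset α) (a : α) (x : ℕ) : x ∉ (entryOf A a).arrs :=
  Expr.notMem_arrs_tupleEntry (by simp [Expr.arrs])

theorem polyFits_entryOf (A : Finset α) (a : α) (M d : ℕ) : PolyFits DetectionInstance.n
    (fun I s => ∃ s₀, I.Ready M s₀ ∧ ∃ k < I.n ^ d, s = s₀.setVar 2 k) (entryOf A a) :=
  polyFits_tupleEntry (fun _ _ h => h) _ _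

/-- The shift `k = 0` expresses the order; `k = 1` says that there is room for a vertex strictly
between the two. -/
theorem tableComputable_add_lt {A : Finset α} {u v : α} (hu : u ∈ A) (hv : v ∈ A) (k : ℕ)
    (hT : ∀ I, (I.n : ℝ) ^ A.card ≤ T I) :
    TableComputable T A (fun _ ρ => ρ u + k < ρ v) := by
  refine TableComputable.of_expr (e := .bin .lt (.bin .add (entryOf A u) (.const k))
    (entryOf A v)) hT (fun I ρ ρ' h h' => by rwa [← h u hu, ← h v hv]) ?_
    (fun M => ((polyFits_entryOf A u M _).bin (PolyFits.const k)).bin (polyFits_entryOf A v M _)) ?_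
  · intro a ha
    simp [Expr.arrs, notMem_arrs_entryOf] at ha
  · intro I M s j hs hj
    simp [Expr.eval, Op.eval, entryOf_eval hs hj]

theorem tableComputable_add_one_lt_size {u : α} (hT : ∀ I, (I.n : ℝ) ≤ T I) :
    TableComputable T {u} (fun I ρ => ρ u + 1 < I.n) := by
  refine TableComputable.of_expr (e := .bin .lt (.bin .add (entryOf {u} u) (.const 1))
    (.var 0)) (fun I => by simpa using hT I) (fun I ρ ρ' h h' => by rwa [← h u (by simp)]) ?_
    (fun M => ((polyFits_entryOf {u} u M _).bin (PolyFits.const 1)).bin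
      (polyFits_size fun _ _ h => h)) ?_
  · intro a ha
    simp [Expr.arrs, notMem_arrs_entryOf] at ha
  · intro I M s j hs hj
    simp [Expr.eval, Op.eval, entryOf_eval hs hj, hs.size]

theorem tableComputable_pos {u : α} (hT : ∀ I, (I.n : ℝ) ≤ T I) :
    TableComputable T {u} (fun _ ρ => 0 < ρ u) := by
  refine TableComputable.of_expr (e := .bin .lt (.const 0) (entryOf {u} u))
    (fun I => by simpa using hT I) (fun I ρ ρ' h h' => by rwa [← h u (by simp)]) ?_
    (fun M => (PolyFits.const 0).bin (polyFits_entryOf {u} u M _)) ?_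
  · intro a ha
    simp [Expr.arrs, notMem_arrs_entryOf] at ha
  · intro I M s j hs hj
    simp [Expr.eval, Op.eval, entryOf_eval hs hj]

/-- The entry of the adjacency matrix for the vertices `u` and `v`. -/
noncomputable def adjExpr (A : Finset α) (u v : α) : Expr :=
  .load 2 (.bin .add (.bin .mul (entryOf A u) (.var 0)) (entryOf A v))

theorem polyFits_adjExpr (A : Finset α) (u v : α) (M d : ℕ) : PolyFits DetectionInstance.n
    (fun I s => ∃ s₀, I.Ready M s₀ ∧ ∃ k < I.n ^ d, s = s₀.setVar 2 k) (adjExpr A u v) := by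
  refine PolyFits.load (((polyFits_entryOf A u M d).bin (polyFits_size fun _ _ h => h)).bin
    (polyFits_entryOf A v M d)) (PolyBdd.of_le_const 1 ?_)
  rintro I s ⟨s₀, hs, k, hk, rfl⟩
  exact hs.matrix_le _

theorem adjExpr_eval {I : DetectionInstance} {M k : ℕ} {s : State} (hs : I.Ready M s)
    (hk : s.var 2 = k) (A : Finset α) (u v : α) : (adjExpr A u v).eval s ≠ 0 ↔
      I.Adj (tupleEntry I.n A.toList k u) (tupleEntry I.n A.toList k v) := by
  rw [← hs.matrix _ (tupleEntry_lt I.pos _ _ _) _ (tupleEntry_lt I.pos _ _ _)]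
  simp only [adjExpr, Expr.eval, Op.eval, entryOf_eval hs hk, hs.size]

theorem tableComputable_lt_adj {A : Finset α} {u v : α} (hu : u ∈ A) (hv : v ∈ A)
    (hT : ∀ I, (I.n : ℝ) ^ A.card ≤ T I) :
    TableComputable T A (fun I ρ => ρ u < ρ v ∧ I.Adj (ρ u) (ρ v)) := by
  refine TableComputable.of_expr (e := .bin .mul (.bin .lt (entryOf A u) (entryOf A v))
    (adjExpr A u v)) hT (fun I ρ ρ' h h' => by rwa [← h u hu, ← h v hv]) ?_
    (fun M => ((polyFits_entryOf A u M _).bin (polyFits_entryOf A v M _)).bin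
      (polyFits_adjExpr A u v M _)) ?_
  · intro a ha
    simp [Expr.arrs, adjExpr, notMem_arrs_entryOf] at ha
    omega
  · intro I M s j hs hj
    rw [← adjExpr_eval hs hj]
    simp [Expr.eval, Op.eval, entryOf_eval hs hj]

theorem tableComputable_lt_not_adj {A : Finset α} {u v : α} (hu : u ∈ A) (hv : v ∈ A)
    (hT : ∀ I, (I.n : ℝ) ^ A.card ≤ T I) :
    TableComputable T A (fun I ρ => ρ u < ρ v ∧ ¬ I.Adj (ρ u) (ρ v)) := by
  refine TableComputable.of_expr (e := .bin .mul (.bin .lt (entryOf A u) (entryOf A v))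
    (.bin .eq (adjExpr A u v) (.const 0))) hT
    (fun I ρ ρ' h h' => by rwa [← h u hu, ← h v hv]) ?_
    (fun M => ((polyFits_entryOf A u M _).bin (polyFits_entryOf A v M _)).bin
      ((polyFits_adjExpr A u v M _).bin (PolyFits.const 0))) ?_
  · intro a ha
    simp [Expr.arrs, adjExpr, notMem_arrs_entryOf] at ha
    omega
  · intro I M s j hs hj
    rw [← adjExpr_eval hs hj]
    simp only [Expr.eval, Op.eval, entryOf_eval hs hj, ne_eq, mul_eq_zero, not_or]
    split_ifs <;> simp_all

end Constraints

/-! ### Adding a vertex -/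

section Create

/-- The value of a relation depends on the variables in `A` only. -/
def DependsOnlyOn {α : Type*} (A : Finset α) (R : DetectionInstance → (α → ℕ) → Prop) : Prop :=
  ∀ (I : DetectionInstance) ρ ρ', (∀ a ∈ A, ρ a = ρ' a) → R I ρ → R I ρ'

theorem DependsOnlyOn.of_singleton {α : Type*} {u : α} {R : DetectionInstance → (α → ℕ) → Prop}
    (hR : DependsOnlyOn {u} R) (I : DetectionInstance) (ρ : α → ℕ) :
    R I ρ ↔ R I fun _ => ρ u :=
  ⟨hR I _ _ (by simp), hR I _ _ (by simp)⟩

variable {α : Type*} [LinearOrder α] {T : DetectionInstance → ℝ} {ω : ℝ} {p : ℕ}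

/-- Imposing both constraints on `v` at once could require `p + 1` variables. The constraint with
`x` is joined first, and `B` may omit `x` from then on, while `v` and `y` are kept for the second
join. -/
theorem tableComputable_join_join (hω : MatMulInTime ω)
    (hT : ∀ I : DetectionInstance, (I.n : ℝ) ^ (ω * p / 2) ≤ T I) {A A' B : Finset α} {v x y : α}
    {R Rx Ry : DetectionInstance → (α → ℕ) → Prop} (hR : DependsOnlyOn A' R)
    (hRx : DependsOnlyOn {x, v} Rx) (hRy : DependsOnlyOn {y, v} Ry)
    (h : TableComputable T A' R) (hx : TableComputable T {x, v} Rx)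
    (hy : TableComputable T {y, v} Ry) (hAB : A ⊆ B) (hvB : v ∈ B) (hyB : y ∈ B)
    (hB : B ⊆ insert v A') (hpA : A.card ≤ p) (hpA' : A'.card ≤ p) (hpB : B.card ≤ p)
    (hp : 2 ≤ p) :
    TableComputable T A (fun I ρ => ∃ ρ' : α → ℕ, (∀ a, ρ' a < I.n) ∧ (∀ a ∈ A, ρ' a = ρ a) ∧
      R I ρ' ∧ Rx I ρ' ∧ Ry I ρ') := by
  have h2 : ∀ a b : α, ({a, b} : Finset α).card ≤ p := fun a b => Finset.card_le_two.trans hp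
  have hj := h.join hω hx hR hRx (A := B) (p := p) (by grind) hpA' (h2 _ _) hpB hT
  refine (hj.join hω hy ?_ hRy (A := A) (p := p) (hAB.trans Finset.subset_union_left) hpB
    (h2 _ _) hpA hT).congr ?_
  · rintro I ρ ρ' hag ⟨ρ₁, h1, h2, h3⟩
    exact ⟨ρ₁, h1, fun a ha => (h2 a ha).trans (hag a ha), h3⟩
  · intro I ρ _
    constructor
    · rintro ⟨ρ₁, h1, h2, ⟨ρ₂, h3, h4, h5, h6⟩, h7⟩
      refine ⟨ρ₂, h3, fun a ha => (h4 a (hAB ha)).trans (h2 a ha), h5, h6, hRy I ρ₁ ρ₂ ?_ h7⟩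
      intro a ha
      rcases Finset.mem_insert.mp ha with rfl | ha
      · exact (h4 _ hyB).symm
      · rw [Finset.mem_singleton.mp ha]
        exact (h4 _ hvB).symm
    · rintro ⟨ρ₁, h1, h2, h3, h4, h5⟩
      exact ⟨ρ₁, h1, h2, ⟨ρ₁, h1, fun _ _ => rfl, h3, h4⟩, h5⟩

/-- If `u`, `v` and `w` all survive, the joins can be made directly into `A`. If `u` or `w` is
dropped, its constraint is joined first and `v` takes its place. If `v` itself is not kept, only the
existence of a gap between `u` and `w` matters. -/
theorem TableComputable.insert_between (hω : MatMulInTime ω)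
    (hT : ∀ I : DetectionInstance, (I.n : ℝ) ^ (ω * p / 2) ≤ T I) {A A' : Finset α} {u v w : α}
    {R : DetectionInstance → (α → ℕ) → Prop} (hR : DependsOnlyOn A' R)
    (h : TableComputable T A' R) (hv : v ∉ A') (hu : u ∈ A') (hw : w ∈ A') (huw : u ≠ w)
    (hA : A ⊆ insert v A') (hpA : A.card ≤ p) (hpA' : A'.card ≤ p) :
    TableComputable T A (fun I ρ => ∃ ρ' : α → ℕ, (∀ a, ρ' a < I.n) ∧ (∀ a ∈ A, ρ' a = ρ a) ∧
      R I ρ' ∧ ρ' u < ρ' v ∧ ρ' v < ρ' w) := by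
  have h2 : ∀ a b : α, ({a, b} : Finset α).card ≤ 2 := fun a b => Finset.card_le_two
  have hp : 2 ≤ p := by
    rw [← Finset.card_pair huw]
    exact (Finset.card_le_card (by grind)).trans hpA'
  have hTc : ∀ (a b : α) (I : DetectionInstance), (I.n : ℝ) ^ ({a, b} : Finset α).card ≤ T I :=
    fun a b I => (pow_le_rpow_width I.pos hω.two_le ((h2 a b).trans hp)).trans (hT I)
  by_cases hvA : v ∈ A
  · have hlu : TableComputable T {u, v} (fun I ρ => ρ u < ρ v) :=
      tableComputable_add_lt (by simp) (by simp) 0 (hTc u v)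
    have hlw : TableComputable T {w, v} (fun I ρ => ρ v < ρ w) :=
      tableComputable_add_lt (by simp) (by simp) 0 (hTc w v)
    have hdu : DependsOnlyOn {u, v} (fun _ ρ => ρ u < ρ v) := fun I ρ ρ' hag h => by
      simp only at h ⊢
      rwa [← hag u (by simp), ← hag v (by simp)]
    have hdw : DependsOnlyOn {w, v} (fun _ ρ => ρ v < ρ w) := fun I ρ ρ' hag h => by
      simp only at h ⊢
      rwa [← hag w (by simp), ← hag v (by simp)]
    have hcard : ∀ a ∈ A', (insert v (A'.erase a)).card ≤ p := fun a ha => by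
      rw [Finset.card_insert_of_notMem (by simp [hv]), Finset.card_erase_add_one ha]
      exact hpA'
    by_cases huA : u ∈ A
    · by_cases hwA : w ∈ A
      · exact tableComputable_join_join hω hT hR hdu hdw h hlu hlw (B := A) subset_rfl hvA hwA hA
          hpA hpA' hpA hp
      · refine (tableComputable_join_join hω hT hR hdw hdu h hlw hlu
          (B := insert v (A'.erase w)) (by grind) (by simp) (by grind) (by grind) hpA hpA'
          (hcard w hw) hp).congr fun I ρ _ =>
            exists_congr fun ρ' => and_congr_right fun _ => and_congr_right fun _ =>
              and_congr_right fun _ => and_comm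
    · exact tableComputable_join_join hω hT hR hdu hdw h hlu hlw (B := insert v (A'.erase u))
        (by grind) (by simp) (by grind) (by grind) hpA hpA' (hcard u hu) hp
  -- In the integers there is a value strictly between iff `ρ u + 1 < ρ w`, and then `ρ u + 1` is
  -- one.
  · have hg := tableComputable_add_lt (A := {u, w}) (u := u) (v := w) (by simp) (by simp) 1
      (hTc u w)
    refine (h.join hω hg hR (fun I ρ ρ' hag h => by rwa [← hag u (by simp), ← hag w (by simp)])
      (A := A) (p := p) (by grind) hpA' ((h2 _ _).trans hp) hpA hT).congr fun I ρ _ => ?_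
    constructor
    · rintro ⟨ρ', h3, h4, h5, h6⟩
      have hne : ∀ a, a ≠ v → Function.update ρ' v (ρ' u + 1) a = ρ' a := fun a ha => by simp [ha]
      refine ⟨Function.update ρ' v (ρ' u + 1), fun a => ?_, fun a ha => ?_, ?_, ?_, ?_⟩
      · rcases eq_or_ne a v with rfl | ha
        · rw [Function.update_self]
          exact h6.trans (h3 w)
        · rw [hne a ha]
          exact h3 a
      · rw [hne a (by grind), h4 a ha]
      · exact hR I _ _ (fun a ha => (hne a (by grind)).symm) h5
      · rw [hne u (by grind), Function.update_self]
        omega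
      · rwa [hne w (by grind), Function.update_self]
    · rintro ⟨ρ', h3, h4, h5, h6, h7⟩
      exact ⟨ρ', h3, h4, h5, by omega⟩

/-- For `p = 1` the order relation, as a table over pairs, would take too long; the constraint is
then imposed by a scan. If `v` is not kept, it can be placed right after `u`, provided that `u` is
not the last vertex of the graph. -/
theorem TableComputable.insert_last (hω : MatMulInTime ω)
    (hT : ∀ I : DetectionInstance, (I.n : ℝ) ^ (ω * p / 2) ≤ T I) {A A' : Finset α} {u v : α}
    {R : DetectionInstance → (α → ℕ) → Prop} (hR : DependsOnlyOn A' R)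
    (h : TableComputable T A' R) (hv : v ∉ A') (hu : u ∈ A')
    (hA : A ⊆ insert v A') (hpA : A.card ≤ p) (hpA' : A'.card ≤ p) :
    TableComputable T A (fun I ρ => ∃ ρ' : α → ℕ, (∀ a, ρ' a < I.n) ∧ (∀ a ∈ A, ρ' a = ρ a) ∧
      R I ρ' ∧ ρ' u < ρ' v) := by
  have hp : 1 ≤ p := (Finset.card_pos.mpr ⟨u, hu⟩).trans_le hpA'
  have hT1 : ∀ I : DetectionInstance, (I.n : ℝ) ≤ T I := fun I => by
    simpa using (pow_le_rpow_width I.pos hω.two_le hp).trans (hT I)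
  by_cases hvA : v ∈ A
  · by_cases hp2 : 2 ≤ p
    · have h2 : ({u, v} : Finset α).card ≤ p := Finset.card_le_two.trans hp2
      have hlu : TableComputable T {u, v} (fun I ρ => ρ u < ρ v) :=
        tableComputable_add_lt (by simp) (by simp) 0
          fun I => (pow_le_rpow_width I.pos hω.two_le h2).trans (hT I)
      exact h.join hω hlu hR (fun I ρ ρ' hag h => by
        rwa [← hag u (by simp), ← hag v (by simp)]) (A := A) (p := p) (by grind) hpA' h2 hpA hT
    -- At width `1` the vertex `v` must replace `u` as the only anchor.
    · obtain rfl : A' = {u} := Finset.eq_singleton_iff_unique_mem.mpr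
        ⟨hu, fun a ha => Finset.card_le_one.mp (by omega) a ha u hu⟩
      obtain rfl : A = {v} := Finset.eq_singleton_iff_unique_mem.mpr
        ⟨hvA, fun a ha => Finset.card_le_one.mp (by omega) a ha v hvA⟩
      have huv : u ≠ v := fun h => hv (by simp [h])
      refine ((h.congr fun I ρ _ => hR.of_singleton I ρ).exists_lt hT1 (v := v)
        (r := fun I x => R I fun _ => x)).congr fun I ρ hρ => ?_
      constructor
      · rintro ⟨x, hx, h3⟩
        refine ⟨Function.update ρ u x, fun a => ?_, fun a ha => ?_, ?_, ?_⟩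
        · rcases eq_or_ne a u with rfl | ha
          · rw [Function.update_self]
            exact hx.trans (hρ v)
          · rw [Function.update_of_ne ha]
            exact hρ a
        · rw [Finset.mem_singleton.mp ha, Function.update_of_ne huv.symm]
        · rw [hR.of_singleton, Function.update_self]
          exact h3
        · rwa [Function.update_self, Function.update_of_ne huv.symm]
      · rintro ⟨ρ', h3, h4, h5, h6⟩
        exact ⟨ρ' u, by rwa [← h4 v (by simp)], (hR.of_singleton I ρ').mp h5⟩
  · refine (h.join hω (tableComputable_add_one_lt_size (u := u) hT1) hR (fun I ρ ρ' hag h => by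
      rwa [← hag u (by simp)]) (A := A) (p := p) (by grind) hpA' (by simpa using hp) hpA hT).congr
      fun I ρ _ => ?_
    constructor
    · rintro ⟨ρ', h3, h4, h5, h6⟩
      have hne : ∀ a, a ≠ v → Function.update ρ' v (ρ' u + 1) a = ρ' a := fun a ha => by simp [ha]
      refine ⟨Function.update ρ' v (ρ' u + 1), fun a => ?_, fun a ha => ?_, ?_, ?_⟩
      · rcases eq_or_ne a v with rfl | ha
        · rwa [Function.update_self]
        · rw [hne a ha]
          exact h3 a
      · rw [hne a (by grind), h4 a ha]
      · exact hR I _ _ (fun a ha => (hne a (by grind)).symm) h5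
      · rw [hne u (by grind), Function.update_self]
        omega
    · rintro ⟨ρ', h3, h4, h5, h6⟩
      have := h3 v
      exact ⟨ρ', h3, h4, h5, by omega⟩

/-- The mirror image of `insert_last`; an unanchored `v` is placed at vertex `0`. -/
theorem TableComputable.insert_first (hω : MatMulInTime ω)
    (hT : ∀ I : DetectionInstance, (I.n : ℝ) ^ (ω * p / 2) ≤ T I) {A A' : Finset α} {w v : α}
    {R : DetectionInstance → (α → ℕ) → Prop} (hR : DependsOnlyOn A' R)
    (h : TableComputable T A' R) (hv : v ∉ A') (hw : w ∈ A')
    (hA : A ⊆ insert v A') (hpA : A.card ≤ p) (hpA' : A'.card ≤ p) :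
    TableComputable T A (fun I ρ => ∃ ρ' : α → ℕ, (∀ a, ρ' a < I.n) ∧ (∀ a ∈ A, ρ' a = ρ a) ∧
      R I ρ' ∧ ρ' v < ρ' w) := by
  have hp : 1 ≤ p := (Finset.card_pos.mpr ⟨w, hw⟩).trans_le hpA'
  have hT1 : ∀ I : DetectionInstance, (I.n : ℝ) ≤ T I := fun I => by
    simpa using (pow_le_rpow_width I.pos hω.two_le hp).trans (hT I)
  by_cases hvA : v ∈ A
  · by_cases hp2 : 2 ≤ p
    · have h2 : ({w, v} : Finset α).card ≤ p := Finset.card_le_two.trans hp2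
      have hlw : TableComputable T {w, v} (fun I ρ => ρ v < ρ w) :=
        tableComputable_add_lt (by simp) (by simp) 0
          fun I => (pow_le_rpow_width I.pos hω.two_le h2).trans (hT I)
      exact h.join hω hlw hR (fun I ρ ρ' hag h => by
        rwa [← hag w (by simp), ← hag v (by simp)]) (A := A) (p := p) (by grind) hpA' h2 hpA hT
    · obtain rfl : A' = {w} := Finset.eq_singleton_iff_unique_mem.mpr
        ⟨hw, fun a ha => Finset.card_le_one.mp (by omega) a ha w hw⟩
      obtain rfl : A = {v} := Finset.eq_singleton_iff_unique_mem.mpr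
        ⟨hvA, fun a ha => Finset.card_le_one.mp (by omega) a ha v hvA⟩
      have hwv : w ≠ v := fun h => hv (by simp [h])
      refine ((h.congr fun I ρ _ => hR.of_singleton I ρ).exists_gt hT1 (v := v)
        (r := fun I x => R I fun _ => x)).congr fun I ρ hρ => ?_
      constructor
      · rintro ⟨x, hx, hxn, h3⟩
        refine ⟨Function.update ρ w x, fun a => ?_, fun a ha => ?_, ?_, ?_⟩
        · rcases eq_or_ne a w with rfl | ha
          · rwa [Function.update_self]
          · rw [Function.update_of_ne ha]
            exact hρ a
        · rw [Finset.mem_singleton.mp ha, Function.update_of_ne hwv.symm]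
        · rw [hR.of_singleton, Function.update_self]
          exact h3
        · rwa [Function.update_self, Function.update_of_ne hwv.symm]
      · rintro ⟨ρ', h3, h4, h5, h6⟩
        exact ⟨ρ' w, by rwa [← h4 v (by simp)], h3 w, (hR.of_singleton I ρ').mp h5⟩
  · refine (h.join hω (tableComputable_pos (u := w) hT1) hR (fun I ρ ρ' hag h => by
      rwa [← hag w (by simp)]) (A := A) (p := p) (by grind) hpA' (by simpa using hp) hpA hT).congr
      fun I ρ _ => ?_
    constructor
    · rintro ⟨ρ', h3, h4, h5, h6⟩
      have hne : ∀ a, a ≠ v → Function.update ρ' v 0 a = ρ' a := fun a ha => by simp [ha]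
      refine ⟨Function.update ρ' v 0, fun a => ?_, fun a ha => ?_, ?_, ?_⟩
      · rcases eq_or_ne a v with rfl | ha
        · rw [Function.update_self]
          exact I.pos
        · rw [hne a ha]
          exact h3 a
      · rw [hne a (by grind), h4 a ha]
      · exact hR I _ _ (fun a ha => (hne a (by grind)).symm) h5
      · rwa [hne w (by grind), Function.update_self]
    · rintro ⟨ρ', h3, h4, h5, h6⟩
      exact ⟨ρ', h3, h4, h5, by omega⟩

end Create

/-! ### Dynamic programming along a merge tree -/

section Solutions

variable {α : Type*} [LinearOrder α]

/-- `f` maps the vertices of the pattern to vertices of the graph in the required way. -/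
structure OrdPattern.IsSolution (Q : OrdPattern α) (I : DetectionInstance) (f : α → ℕ) :
    Prop where
  lt : ∀ a, f a < I.n
  mono : ∀ u ∈ Q.verts, ∀ v ∈ Q.verts, u < v → f u < f v
  mand : ∀ u v, Q.mand.Adj u v → I.Adj (f u) (f v)
  forb : ∀ u v, Q.forb.Adj u v → ¬ I.Adj (f u) (f v)

/-- The values of the anchors extend to a solution. -/
def AnchoredPattern.Extends (Q : AnchoredPattern α) (I : DetectionInstance) (ρ : α → ℕ) : Prop :=
  ∃ f, Q.IsSolution I f ∧ ∀ a ∈ Q.anchors, f a = ρ a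

theorem AnchoredPattern.dependsOnlyOn_extends (Q : AnchoredPattern α) :
    DependsOnlyOn Q.anchors Q.Extends := by
  rintro I ρ ρ' h ⟨f, hf, h'⟩
  exact ⟨f, hf, fun a ha => (h' a ha).trans (h a ha)⟩

/-- Induction on the number of elements strictly between `u` and `v`, splitting at any one of them.
This reduces the order constraints of a pattern to local ones, which a merge tree can distribute
over its nodes. -/
theorem lt_of_forall_consecutiveIn {S : Finset α} {f : α → ℕ}
    (h : ∀ u v, ConsecutiveIn S u v → f u < f v) :
    ∀ u ∈ S, ∀ v ∈ S, u < v → f u < f v := by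
  suffices H : ∀ k, ∀ u ∈ S, ∀ v ∈ S, u < v → (S.filter fun w => u < w ∧ w < v).card = k →
      f u < f v from fun u hu v hv huv => H _ u hu v hv huv rfl
  intro k
  induction k using Nat.strong_induction_on with
  | _ k ih =>
    intro u hu v hv huv hk
    by_cases hc : ∀ w ∈ S, ¬ (u < w ∧ w < v)
    · exact h u v ⟨hu, hv, huv, hc⟩
    · push Not at hc
      obtain ⟨w, hw, huw, hwv⟩ := hc
      have hmem : w ∈ S.filter fun w => u < w ∧ w < v := by simp [hw, huw, hwv]
      have h1 : (S.filter fun x => u < x ∧ x < w).card < k := by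
        rw [← hk]
        refine Finset.card_lt_card ⟨fun x hx => ?_, fun hs => ?_⟩
        · simp only [Finset.mem_filter] at hx ⊢
          exact ⟨hx.1, hx.2.1, hx.2.2.trans hwv⟩
        · have := hs hmem
          simp at this
      have h2 : (S.filter fun x => w < x ∧ x < v).card < k := by
        rw [← hk]
        refine Finset.card_lt_card ⟨fun x hx => ?_, fun hs => ?_⟩
        · simp only [Finset.mem_filter] at hx ⊢
          exact ⟨hx.1, huw.trans hx.2.1, hx.2.2⟩
        · have := hs hmem
          simp at this
      exact (ih _ h1 u hu w hw huw rfl).trans (ih _ h2 w hw v hv hwv rfl)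

/-- Solutions of the parts agree on common vertices, these being anchors of both parts, and
therefore glue. Each edge belongs to one part and each consecutive pair lies within one part, so
every constraint on the glued map is inherited from a part. -/
theorem AnchoredPattern.IsDivision.extends_iff {Q Q₁ Q₂ : AnchoredPattern α}
    (h : Q.IsDivision Q₁ Q₂) (I : DetectionInstance) (ρ : α → ℕ) :
    (∃ ρ' : α → ℕ, (∀ a, ρ' a < I.n) ∧ (∀ a ∈ Q.anchors, ρ' a = ρ a) ∧ Q₁.Extends I ρ' ∧
      Q₂.Extends I ρ') ↔ Q.Extends I ρ := by
  constructor
  · rintro ⟨ρ', h1, h2, ⟨f₁, hf₁, h3⟩, f₂, hf₂, h4⟩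
    set f : α → ℕ := fun a => if a ∈ Q₁.verts then f₁ a else f₂ a with hf
    have e1 : ∀ a ∈ Q₁.verts, f a = f₁ a := fun a ha => if_pos ha
    have e2 : ∀ a ∈ Q₂.verts, f a = f₂ a := by
      intro a ha
      by_cases ha' : a ∈ Q₁.verts
      · obtain ⟨h5, h6⟩ := h.common a ha' ha
        rw [e1 a ha', h3 a h5, h4 a h6]
      · exact if_neg ha'
    clear_value f
    refine ⟨f, ⟨fun a => ?_, lt_of_forall_consecutiveIn fun u v huv => ?_, fun u v huv => ?_,
      fun u v huv => ?_⟩, fun a ha => ?_⟩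
    · rw [hf]
      simp only
      split_ifs
      · exact hf₁.lt a
      · exact hf₂.lt a
    · have h5 := h.consecutive u v huv
      have h6 := huv.1
      have h7 := huv.2.1
      rw [← h.verts_union, Finset.mem_union] at h6 h7
      -- This is where the condition on consecutive vertices is needed: no relation between vertices
      -- private to different parts would be known.
      have h8 : (u ∈ Q₁.verts ∧ v ∈ Q₁.verts) ∨ (u ∈ Q₂.verts ∧ v ∈ Q₂.verts) := by
        clear * - h5 h6 h7
        tauto
      rcases h8 with ⟨hu, hv⟩ | ⟨hu, hv⟩
      · rw [e1 u hu, e1 v hv]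
        exact hf₁.mono u hu v hv huv.2.2.1
      · rw [e2 u hu, e2 v hv]
        exact hf₂.mono u hu v hv huv.2.2.1
    · rw [← h.mand_union, SimpleGraph.sup_adj] at huv
      rcases huv with huv | huv
      · obtain ⟨hu, hv⟩ := Q₁.mand_mem u v huv
        rw [e1 u hu, e1 v hv]
        exact hf₁.mand u v huv
      · obtain ⟨hu, hv⟩ := Q₂.mand_mem u v huv
        rw [e2 u hu, e2 v hv]
        exact hf₂.mand u v huv
    · rw [← h.forb_union, SimpleGraph.sup_adj] at huv
      rcases huv with huv | huv
      · obtain ⟨hu, hv⟩ := Q₁.forb_mem u v huv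
        rw [e1 u hu, e1 v hv]
        exact hf₁.forb u v huv
      · obtain ⟨hu, hv⟩ := Q₂.forb_mem u v huv
        rw [e2 u hu, e2 v hv]
        exact hf₂.forb u v huv
    · have h5 := Q.anchors_subset ha
      rw [← h.verts_union, Finset.mem_union] at h5
      rcases h5 with h5 | h5
      · rw [e1 a h5, h3 a (h.anchors_left a ha h5), h2 a ha]
      · rw [e2 a h5, h4 a (h.anchors_right a ha h5), h2 a ha]
  · rintro ⟨f, hf, h1⟩
    refine ⟨f, hf.lt, h1, ⟨f, ⟨hf.lt, fun u hu v hv => hf.mono u ?_ v ?_, fun u v huv =>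
      hf.mand u v ?_, fun u v huv => hf.forb u v ?_⟩, fun _ _ => rfl⟩, ⟨f, ⟨hf.lt, fun u hu v hv =>
      hf.mono u ?_ v ?_, fun u v huv => hf.mand u v ?_, fun u v huv => hf.forb u v ?_⟩,
      fun _ _ => rfl⟩⟩
    all_goals first
      | (rw [← h.verts_union]; simp [*])
      | (rw [← h.mand_union]; simp [*])
      | (rw [← h.forb_union]; simp [*])

theorem AnchoredPattern.IsDivision.anchors_subset_union {Q Q₁ Q₂ : AnchoredPattern α}
    (h : Q.IsDivision Q₁ Q₂) : Q.anchors ⊆ Q₁.anchors ∪ Q₂.anchors := by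
  intro a ha
  have h1 := Q.anchors_subset ha
  rw [← h.verts_union] at h1
  rcases Finset.mem_union.mp h1 with h1 | h1
  · exact Finset.mem_union_left _ (h.anchors_left a ha h1)
  · exact Finset.mem_union_right _ (h.anchors_right a ha h1)

/-- A vertex without edges is subject only to the order, hence only to its two neighbours. As these
are anchors of `Q'`, their positions are visible in its table, and any solution of `Q'` behind that
entry can be extended by the value at `v`. -/
theorem AnchoredPattern.extends_create_iff {Q Q' : AnchoredPattern α} {v : α}
    (hedge : ∀ u, ¬ Q.mand.Adj v u ∧ ¬ Q.forb.Adj v u)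
    (hverts : Q'.verts = Q.verts.erase v) (hmand : Q'.mand = Q.mand) (hforb : Q'.forb = Q.forb)
    (hanch : Q.anchors.erase v ⊆ Q'.anchors)
    (hnbr : ∀ u, ConsecutiveIn Q.verts u v ∨ ConsecutiveIn Q.verts v u → u ∈ Q'.anchors)
    (I : DetectionInstance) (ρ : α → ℕ) :
    (∃ ρ' : α → ℕ, (∀ a, ρ' a < I.n) ∧ (∀ a ∈ Q.anchors, ρ' a = ρ a) ∧ Q'.Extends I ρ' ∧
      (∀ u, ConsecutiveIn Q.verts u v → ρ' u < ρ' v) ∧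
      ∀ w, ConsecutiveIn Q.verts v w → ρ' v < ρ' w) ↔ Q.Extends I ρ := by
  constructor
  · rintro ⟨ρ', h1, h2, ⟨f, hf, h3⟩, h4, h5⟩
    have hne : ∀ a, a ≠ v → Function.update f v (ρ' v) a = f a := fun a ha => by simp [ha]
    have hv : Function.update f v (ρ' v) v = ρ' v := Function.update_self _ _ _
    refine ⟨Function.update f v (ρ' v), ⟨fun a => ?_, lt_of_forall_consecutiveIn
      fun a b hab => ?_, fun a b hab => ?_, fun a b hab => ?_⟩, fun a ha => ?_⟩
    · rcases eq_or_ne a v with rfl | ha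
      · rw [hv]
        exact h1 a
      · rw [hne a ha]
        exact hf.lt a
    · rcases eq_or_ne a v with rfl | ha
      · rw [hv, hne b hab.2.2.1.ne', h3 b (hnbr b (Or.inr hab))]
        exact h5 b hab
      · rcases eq_or_ne b v with rfl | hb
        · rw [hv, hne a ha, h3 a (hnbr a (Or.inl hab))]
          exact h4 a hab
        · rw [hne a ha, hne b hb]
          exact hf.mono a (by rw [hverts]; exact Finset.mem_erase.mpr ⟨ha, hab.1⟩) b
            (by rw [hverts]; exact Finset.mem_erase.mpr ⟨hb, hab.2.1⟩) hab.2.2.1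
    · have ha : a ≠ v := fun h => (hedge b).1 (h ▸ hab)
      have hb : b ≠ v := fun h => (hedge a).1 (h ▸ hab.symm)
      rw [hne a ha, hne b hb]
      exact hf.mand a b (hmand ▸ hab)
    · have ha : a ≠ v := fun h => (hedge b).2 (h ▸ hab)
      have hb : b ≠ v := fun h => (hedge a).2 (h ▸ hab.symm)
      rw [hne a ha, hne b hb]
      exact hf.forb a b (hforb ▸ hab)
    · rcases eq_or_ne a v with rfl | hav
      · rw [hv, h2 a ha]
      · rw [hne a hav, h3 a (hanch (Finset.mem_erase.mpr ⟨hav, ha⟩)), h2 a ha]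
  · rintro ⟨f, hf, h1⟩
    refine ⟨f, hf.lt, h1, ⟨f, ⟨hf.lt, fun a ha b hb => hf.mono a ?_ b ?_, fun a b hab =>
      hf.mand a b (hmand ▸ hab), fun a b hab => hf.forb a b (hforb ▸ hab)⟩, fun _ _ => rfl⟩,
      fun u hu => hf.mono u hu.1 v hu.2.1 hu.2.2.1, fun w hw => hf.mono v hw.1 w hw.2.1 hw.2.2.1⟩
    · rw [hverts] at ha
      exact Finset.mem_of_mem_erase ha
    · rw [hverts] at hb
      exact Finset.mem_of_mem_erase hb

theorem exists_consecutiveIn_left {S : Finset α} {v x : α} (hv : v ∈ S) (hx : x ∈ S)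
    (h : x < v) : ∃ u, ConsecutiveIn S u v := by
  have hne : (S.filter (· < v)).Nonempty := ⟨x, by simp [hx, h]⟩
  have hm := Finset.max'_mem _ hne
  rw [Finset.mem_filter] at hm
  refine ⟨_, hm.1, hv, hm.2, fun w hw hw' => ?_⟩
  exact absurd (Finset.le_max' _ w (by simp [hw, hw'.2])) (not_le.mpr hw'.1)

theorem exists_consecutiveIn_right {S : Finset α} {v x : α} (hv : v ∈ S) (hx : x ∈ S)
    (h : v < x) : ∃ w, ConsecutiveIn S v w := by
  have hne : (S.filter (v < ·)).Nonempty := ⟨x, by simp [hx, h]⟩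
  have hm := Finset.min'_mem _ hne
  rw [Finset.mem_filter] at hm
  refine ⟨_, hv, hm.1, hm.2, fun w hw hw' => ?_⟩
  exact absurd (Finset.min'_le _ w (by simp [hw, hw'.1])) (not_le.mpr hw'.2)

theorem ConsecutiveIn.left_unique {S : Finset α} {u u' v : α} (h : ConsecutiveIn S u v)
    (h' : ConsecutiveIn S u' v) : u = u' := by
  rcases lt_trichotomy u u' with hlt | rfl | hlt
  · exact absurd ⟨hlt, h'.2.2.1⟩ (h.2.2.2 u' h'.1)
  · rfl
  · exact absurd ⟨hlt, h.2.2.1⟩ (h'.2.2.2 u h.1)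

theorem ConsecutiveIn.right_unique {S : Finset α} {v w w' : α} (h : ConsecutiveIn S v w)
    (h' : ConsecutiveIn S v w') : w = w' := by
  rcases lt_trichotomy w w' with hlt | rfl | hlt
  · exact absurd ⟨h.2.2.1, hlt⟩ (h'.2.2.2 w h.2.1)
  · rfl
  · exact absurd ⟨h'.2.2.1, hlt⟩ (h.2.2.2 w' h'.2.1)

/-- Ensures that a created vertex has a neighbour in the order, and that the pattern is not
contained in the empty graph. -/
theorem MergeTree.verts_nonempty {Q : AnchoredPattern α} (t : MergeTree Q) : Q.verts.Nonempty := by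
  induction t with
  | leaf Q h =>
    obtain ⟨u, v, -, h, -⟩ := h
    exact ⟨u, by simp [h]⟩
  | create Q Q' h t ih =>
    obtain ⟨v, hv, -⟩ := h
    exact ⟨v, hv⟩
  | merge Q Q₁ Q₂ h t₁ t₂ ih₁ ih₂ =>
    rw [← h.verts_union]
    exact ih₁.mono Finset.subset_union_left

variable {T : DetectionInstance → ℝ} {ω : ℝ} {p : ℕ}

theorem tableComputable_create (hω : MatMulInTime ω)
    (hT : ∀ I : DetectionInstance, (I.n : ℝ) ^ (ω * p / 2) ≤ T I) {Q Q' : AnchoredPattern α}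
    (h : Q.IsVertexDeletion Q') (hQ' : Q'.verts.Nonempty) (hp : Q.anchors.card ≤ p)
    (hp' : Q'.anchors.card ≤ p) (ih : TableComputable T Q'.anchors Q'.Extends) :
    TableComputable T Q.anchors Q.Extends := by
  obtain ⟨v, hv, hedge, hverts, hmand, hforb, hanch, hnbr⟩ := h
  have hvA' : v ∉ Q'.anchors := fun h => by
    have := Q'.anchors_subset h
    rw [hverts] at this
    simp at this
  have hA : Q.anchors ⊆ insert v Q'.anchors := fun a ha => by
    rcases eq_or_ne a v with rfl | hav
    · exact Finset.mem_insert_self _ _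
    · exact Finset.mem_insert_of_mem (hanch (Finset.mem_erase.mpr ⟨hav, ha⟩))
  have hd := Q'.dependsOnlyOn_extends
  have hiff := AnchoredPattern.extends_create_iff hedge hverts hmand hforb hanch hnbr
  by_cases hl : ∃ u, ConsecutiveIn Q.verts u v
  · obtain ⟨u, hu⟩ := hl
    by_cases hr : ∃ w, ConsecutiveIn Q.verts v w
    · obtain ⟨w, hw⟩ := hr
      refine (ih.insert_between hω hT hd hvA' (hnbr u (Or.inl hu)) (hnbr w (Or.inr hw))
        (hu.2.2.1.trans hw.2.2.1).ne hA hp hp').congr fun I ρ _ => ?_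
      rw [← hiff]
      refine exists_congr fun ρ' => and_congr_right fun _ => and_congr_right fun _ =>
        and_congr_right fun _ => and_congr ⟨fun h u' hu' => ?_, fun h => h u hu⟩
          ⟨fun h w' hw' => ?_, fun h => h w hw⟩
      · rwa [hu'.left_unique hu]
      · rwa [hw'.right_unique hw]
    · refine (ih.insert_last hω hT hd hvA' (hnbr u (Or.inl hu)) hA hp hp').congr
        fun I ρ _ => ?_
      rw [← hiff]
      refine exists_congr fun ρ' => and_congr_right fun _ => and_congr_right fun _ =>
        and_congr_right fun _ => ⟨fun h => ⟨fun u' hu' => ?_, fun w hw => absurd ⟨w, hw⟩ hr⟩,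
          fun h => h.1 u hu⟩
      rwa [hu'.left_unique hu]
  · by_cases hr : ∃ w, ConsecutiveIn Q.verts v w
    · obtain ⟨w, hw⟩ := hr
      refine (ih.insert_first hω hT hd hvA' (hnbr w (Or.inr hw)) hA hp hp').congr
        fun I ρ _ => ?_
      rw [← hiff]
      refine exists_congr fun ρ' => and_congr_right fun _ => and_congr_right fun _ =>
        and_congr_right fun _ => ⟨fun h => ⟨fun u hu => absurd ⟨u, hu⟩ hl, fun w' hw' => ?_⟩,
          fun h => h.2 w hw⟩
      rwa [hw'.right_unique hw]
    -- Without neighbours, `v` would be the only vertex, but `Q'` has another one.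
    · obtain ⟨x, hx⟩ := hQ'
      rw [hverts, Finset.mem_erase] at hx
      rcases lt_or_gt_of_ne hx.1 with h | h
      · exact absurd (exists_consecutiveIn_left hv hx.2 h) hl
      · exact absurd (exists_consecutiveIn_right hv hx.2 h) hr

/-- Tables for a pair of vertices related by `K`, with a restricted set of anchors. -/
theorem tableComputable_pair {K : DetectionInstance → ℕ → ℕ → Prop} {u v : α} (huv : u ≠ v)
    {A : Finset α} (hA : A ⊆ {u, v}) (hp : A.card ≤ p)
    (hT2 : 2 ≤ p → ∀ I : DetectionInstance, (I.n : ℝ) ^ 2 ≤ T I)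
    (hT1 : p ≤ 1 → ∀ I : DetectionInstance, (I.n : ℝ) ≤ T I)
    (h : 2 ≤ p → TableComputable T {u, v} fun I ρ => ρ u < ρ v ∧ K I (ρ u) (ρ v))
    (hgt : p ≤ 1 → TableComputable T {u} fun I ρ => ∃ y, ρ u < y ∧ y < I.n ∧ K I (ρ u) y)
    (hlt : p ≤ 1 → TableComputable T {v} fun I ρ => ∃ x < ρ v, K I x (ρ v)) :
    TableComputable T A (fun I ρ => ∃ ρ' : α → ℕ, (∀ a, ρ' a < I.n) ∧ (∀ a ∈ A, ρ' a = ρ a) ∧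
      ρ' u < ρ' v ∧ K I (ρ' u) (ρ' v)) := by
  rcases Nat.lt_or_ge p 2 with hp2 | hp2
  · have hp1 : p ≤ 1 := by omega
    by_cases hvA : v ∈ A
    · obtain rfl : A = {v} := Finset.eq_singleton_iff_unique_mem.mpr
        ⟨hvA, fun a ha => Finset.card_le_one.mp (by omega) a ha v hvA⟩
      -- The projection onto the same set merely brings the relation into existential form.
      refine ((hlt hp1).project (A' := {v}) subset_rfl (fun I => by simpa using hT1 hp1 I)).congr
        fun I ρ _ => ?_
      constructor
      · rintro ⟨ρ', h1, h2, x, hx, h3⟩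
        refine ⟨Function.update ρ' u x, fun a => ?_, fun a ha => ?_, ?_⟩
        · rcases eq_or_ne a u with rfl | ha
          · rw [Function.update_self]
            exact hx.trans (h1 v)
          · rw [Function.update_of_ne ha]
            exact h1 a
        · rw [← h2 a ha, Finset.mem_singleton.mp ha, Function.update_of_ne huv.symm]
        · rw [Function.update_self, Function.update_of_ne huv.symm]
          exact ⟨hx, h3⟩
      · rintro ⟨ρ', h1, h2, h3, h4⟩
        exact ⟨ρ', h1, h2, ρ' u, h3, h4⟩
    · have hAu : A ⊆ {u} := by grind
      refine ((hgt hp1).project hAu (fun I => by simpa using hT1 hp1 I)).congr fun I ρ _ => ?_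
      constructor
      · rintro ⟨ρ', h1, h2, y, hy, hyn, h3⟩
        refine ⟨Function.update ρ' v y, fun a => ?_, fun a ha => ?_, ?_⟩
        · rcases eq_or_ne a v with rfl | ha
          · rwa [Function.update_self]
          · rw [Function.update_of_ne ha]
            exact h1 a
        · rw [← h2 a ha, Function.update_of_ne (by rintro rfl; exact hvA ha)]
        · rw [Function.update_self, Function.update_of_ne huv]
          exact ⟨hy, h3⟩
      · rintro ⟨ρ', h1, h2, h3, h4⟩
        exact ⟨ρ', h1, h2, ρ' v, h3, h1 v, h4⟩
  · exact (h hp2).project hA fun I => by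
      rw [Finset.card_pair huv]
      exact hT2 hp2 I

theorem DetectionInstance.adj_comm (I : DetectionInstance) (x y : ℕ) : I.Adj x y ↔ I.Adj y x :=
  ⟨fun ⟨hx, hy, h⟩ => ⟨hy, hx, h.symm⟩, fun ⟨hx, hy, h⟩ => ⟨hy, hx, h.symm⟩⟩

/-- For `2 ≤ p` there is time to inspect all pairs in the adjacency matrix. For `p ≤ 1` at most one
endpoint is an anchor, and the other one is searched for from its adjacency list. -/
theorem tableComputable_leaf (hω : MatMulInTime ω)
    (hT : ∀ I : DetectionInstance, (I.n : ℝ) ^ (ω * p / 2) ≤ T I)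
    (hT1 : p ≤ 1 → ∀ I : DetectionInstance, (I.n : ℝ) + I.G.edgeSet.ncard ≤ T I)
    {Q : AnchoredPattern α} (h : Q.IsSingleEdge) (hp : Q.anchors.card ≤ p) :
    TableComputable T Q.anchors Q.Extends := by
  obtain ⟨u, v, huv, hverts, hedge⟩ := h
  have hA : Q.anchors ⊆ {u, v} := hverts ▸ Q.anchors_subset
  have hT2 : 2 ≤ p → ∀ I : DetectionInstance, (I.n : ℝ) ^ 2 ≤ T I := fun hp I =>
    (pow_le_rpow_width I.pos hω.two_le hp).trans (hT I)
  have hTn : p ≤ 1 → ∀ I : DetectionInstance, (I.n : ℝ) ≤ T I := fun hp I =>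
    le_trans (by simp) (hT1 hp I)
  have hT2' : 2 ≤ p → ∀ I : DetectionInstance, (I.n : ℝ) ^ ({u, v} : Finset α).card ≤ T I :=
    fun hp I => by
      rw [Finset.card_pair huv.ne]
      exact hT2 hp I
  rcases hedge with ⟨hm, hf⟩ | ⟨hm, hf⟩
  · refine (tableComputable_pair huv.ne hA hp hT2 hTn (K := fun I x y => I.Adj x y)
      (fun hp => tableComputable_lt_adj (by simp) (by simp) (hT2' hp))
      (fun hp => (tableComputable_exists_adj_gt (hT1 hp) u).congr fun I ρ _ => ?_)
      (fun hp => (tableComputable_exists_adj_lt (hT1 hp) v).congr fun I ρ _ => ?_)).congr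
      fun I ρ _ => ?_
    · exact exists_congr fun y => and_congr_right fun _ => ⟨fun h => ⟨h.2.1, h⟩, fun h => h.2⟩
    · exact exists_congr fun y => and_congr_right fun _ => I.adj_comm _ _
    · constructor
      · rintro ⟨f, h1, h2, h3, h4⟩
        refine ⟨f, ⟨h1, fun a ha b hb hab => ?_, fun a b hab => ?_, fun a b hab => ?_⟩, h2⟩
        · rw [hverts, Finset.mem_insert, Finset.mem_singleton] at ha hb
          rcases ha with rfl | rfl <;> rcases hb with rfl | rfl
          · exact absurd hab (lt_irrefl _)
          · exact h3
          · exact absurd hab huv.le.not_gt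
          · exact absurd hab (lt_irrefl _)
        · rw [hm, SimpleGraph.edge_adj] at hab
          rcases hab.1 with ⟨rfl, rfl⟩ | ⟨rfl, rfl⟩
          · exact h4
          · exact (I.adj_comm _ _).mp h4
        · rw [hf] at hab
          exact hab.elim
      · rintro ⟨f, hs, h2⟩
        refine ⟨f, hs.lt, h2, hs.mono u (by simp [hverts]) v (by simp [hverts]) huv,
          hs.mand u v ?_⟩
        rw [hm, SimpleGraph.edge_adj]
        exact ⟨Or.inl ⟨rfl, rfl⟩, huv.ne⟩
  · refine (tableComputable_pair huv.ne hA hp hT2 hTn (K := fun I x y => ¬ I.Adj x y)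
      (fun hp => tableComputable_lt_not_adj (by simp) (by simp) (hT2' hp))
      (fun hp => tableComputable_exists_not_adj_gt (hT1 hp) u)
      (fun hp => (tableComputable_exists_not_adj_lt (hT1 hp) v).congr fun I ρ _ => ?_)).congr
      fun I ρ _ => ?_
    · exact exists_congr fun y => and_congr_right fun _ => not_congr (I.adj_comm _ _)
    · constructor
      · rintro ⟨f, h1, h2, h3, h4⟩
        refine ⟨f, ⟨h1, fun a ha b hb hab => ?_, fun a b hab => ?_, fun a b hab => ?_⟩, h2⟩
        · rw [hverts, Finset.mem_insert, Finset.mem_singleton] at ha hb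
          rcases ha with rfl | rfl <;> rcases hb with rfl | rfl
          · exact absurd hab (lt_irrefl _)
          · exact h3
          · exact absurd hab huv.le.not_gt
          · exact absurd hab (lt_irrefl _)
        · rw [hm] at hab
          exact hab.elim
        · rw [hf, SimpleGraph.edge_adj] at hab
          rcases hab.1 with ⟨rfl, rfl⟩ | ⟨rfl, rfl⟩
          · exact h4
          · exact fun h => h4 ((I.adj_comm _ _).mp h)
      · rintro ⟨f, hs, h2⟩
        refine ⟨f, hs.lt, h2, hs.mono u (by simp [hverts]) v (by simp [hverts]) huv,
          hs.forb u v ?_⟩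
        rw [hf, SimpleGraph.edge_adj]
        exact ⟨Or.inl ⟨rfl, rfl⟩, huv.ne⟩

theorem MergeTree.anchors_card_le {Q : AnchoredPattern α} (t : MergeTree Q) :
    Q.anchors.card ≤ t.width := by
  cases t <;> simp [MergeTree.width]

theorem MergeTree.tableComputable (hω : MatMulInTime ω)
    (hT : ∀ I : DetectionInstance, (I.n : ℝ) ^ (ω * p / 2) ≤ T I)
    (hT1 : p ≤ 1 → ∀ I : DetectionInstance, (I.n : ℝ) + I.G.edgeSet.ncard ≤ T I)
    {Q : AnchoredPattern α} (t : MergeTree Q) (hp : t.width ≤ p) :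
    TableComputable T Q.anchors Q.Extends := by
  induction t with
  | leaf Q h => exact tableComputable_leaf hω hT hT1 h hp
  | create Q Q' h t ih =>
    simp only [MergeTree.width, max_le_iff] at hp
    exact tableComputable_create hω hT h t.verts_nonempty hp.1 (t.anchors_card_le.trans hp.2)
      (ih hp.2)
  | merge Q Q₁ Q₂ h t₁ t₂ ih₁ ih₂ =>
    simp only [MergeTree.width, max_le_iff] at hp
    exact ((ih₁ hp.2.1).join hω (ih₂ hp.2.2) Q₁.dependsOnlyOn_extends Q₂.dependsOnlyOn_extends
      h.anchors_subset_union (t₁.anchors_card_le.trans hp.2.1) (t₂.anchors_card_le.trans hp.2.2)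
      hp.1 hT).congr fun I ρ _ => h.extends_iff I ρ

/-! ### Detection -/

theorem OrdPattern.containedIn_iff (P : OrdPattern α) (I : DetectionInstance) :
    P.ContainedIn I.G ↔ ∃ f, P.IsSolution I f := by
  constructor
  · rintro ⟨f, hf⟩
    have hval : ∀ a (ha : a ∈ P.verts),
        (if h : a ∈ P.verts then (f ⟨a, h⟩ : ℕ) else 0) = f ⟨a, ha⟩ := fun a ha => dif_pos ha
    -- The default `0` off the pattern is a vertex because the graph is nonempty; these values are
    -- irrelevant.
    refine ⟨fun a => if h : a ∈ P.verts then (f ⟨a, h⟩ : ℕ) else 0, fun a => ?_,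
      fun u hu v hv huv => ?_, fun u v huv => ?_, fun u v huv => ?_⟩
    · split_ifs
      · exact Fin.is_lt _
      · exact I.pos
    · simp only [hval u hu, hval v hv]
      exact f.lt_iff_lt.mpr huv
    · obtain ⟨hu, hv⟩ := P.mand_mem u v huv
      simp only [hval u hu, hval v hv]
      exact ⟨Fin.is_lt _, Fin.is_lt _, (hf ⟨u, hu⟩ ⟨v, hv⟩).1 huv⟩
    · obtain ⟨hu, hv⟩ := P.forb_mem u v huv
      simp only [hval u hu, hval v hv]
      rintro ⟨_, _, h⟩
      exact (hf ⟨u, hu⟩ ⟨v, hv⟩).2 huv h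
  · rintro ⟨f, hf⟩
    refine ⟨OrderEmbedding.ofStrictMono (fun a => ⟨f a, hf.lt a⟩)
      fun a b hab => hf.mono a a.2 b b.2 hab, fun u v => ⟨fun huv => ?_, fun huv h => ?_⟩⟩
    · obtain ⟨_, _, h⟩ := hf.mand u v huv
      exact h
    · exact hf.forb u v huv ⟨hf.lt _, hf.lt _, h⟩

/-- Writing the adjacency matrix takes time `n + m`, which has to be assumed affordable only for `p
≤ 1`; otherwise the time for the tables dominates it. -/
theorem MergeTree.detectableInTime (hω : MatMulInTime ω) {T : ℕ → ℕ → ℝ}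
    (hT : ∀ n m : ℕ, 1 ≤ n → (n : ℝ) ^ (ω * p / 2) ≤ T n m)
    (hT1 : p ≤ 1 → ∀ n m : ℕ, (n : ℝ) + m ≤ T n m)
    {Q : AnchoredPattern α} (t : MergeTree Q) (hp : t.width ≤ p) :
    Q.DetectableInTime T := by
  have hT' : ∀ I : DetectionInstance, (I.n : ℝ) ^ (ω * p / 2) ≤ T I.n I.G.edgeSet.ncard :=
    fun I => hT _ _ I.pos
  have hT1' : p ≤ 1 → ∀ I : DetectionInstance,
    (I.n : ℝ) + I.G.edgeSet.ncard ≤ T I.n I.G.edgeSet.ncard := fun h I => hT1 h _ _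
  have hpos : ∀ I : DetectionInstance, 1 ≤ T I.n I.G.edgeSet.ncard := fun I => by
    simpa using (pow_le_rpow_width I.pos hω.two_le (Nat.zero_le p)).trans (hT' I)
  -- For `2 ≤ p`, both `n` and `m` are at most `n ^ 2 ≤ n ^ (ω * p / 2)`.
  have hlin : ∀ I : DetectionInstance,
      (I.n : ℝ) + I.G.edgeSet.ncard ≤ (2 : ℕ) * T I.n I.G.edgeSet.ncard := by
    intro I
    rcases Nat.lt_or_ge p 2 with hp | hp
    · have := hT1' (by omega) I
      have := hpos I
      push_cast
      linarith
    · have h1 := (pow_le_rpow_width I.pos hω.two_le hp).trans (hT' I)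
      have h2 : (1 : ℝ) ≤ I.n := by exact_mod_cast I.pos
      have h3 : I.G.edgeSet.ncard ≤ I.n ^ 2 := by
        classical
        rw [← SimpleGraph.coe_edgeFinset, Set.ncard_coe_finset]
        refine I.G.card_edgeFinset_le_card_choose_two.trans ?_
        rw [Fintype.card_fin]
        exact Nat.choose_le_pow _ _
      have h3' : (I.G.edgeSet.ncard : ℝ) ≤ (I.n : ℝ) ^ 2 := by exact_mod_cast h3
      push_cast
      nlinarith
  -- Projecting away all anchors of the root leaves a table with a single entry, at index `0`, which
  -- is the answer.
  have htab := (t.tableComputable hω hT' hT1' hp).project (Finset.empty_subset _) fun I =>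
    (pow_le_rpow_width I.pos hω.two_le (t.anchors_card_le.trans hp)).trans (hT' I)
  obtain ⟨c, M', τ, -, hτ, hc⟩ := htab 3 le_rfl
  have hfin : Triple DetectionInstance.n (fun _ => 1)
      (fun I s => I.Ready M' s ∧ IsTable I.n s τ ∅ fun _ : α → ℕ => Q.ContainedIn I.G)
      (.assign 0 (.load τ (.const 0))) (fun _ s s' => s' = s.setVar 0 (s.arr τ 0)) := by
    refine Triple.assign (PolyFits.load (PolyFits.const 0) (PolyBdd.of_le_const 1 ?_))
    rintro I s ⟨-, h, -⟩
    exact h _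
  have hall : Triple DetectionInstance.n (fun I => T I.n I.G.edgeSet.ncard)
      (fun I s => s = detectionInput I.adj)
      (.seq matrixCmd (.seq c (.assign 0 (.load τ (.const 0)))))
      (fun I _ s' => s'.var 0 ≠ 0 ↔ Q.ContainedIn I.G) := by
    refine (triple_matrixCmd.weaken (fun _ _ h => h) (fun _ _ _ _ h => h) ⟨2, hlin⟩).seq
      (hc.seq (hfin.weaken (fun _ _ h => h) (fun _ _ _ _ h => h) ⟨1, fun I => by
        simpa using hpos I⟩) (fun I s s' _ h => ?_)
        (R := fun I _ s' => s'.var 0 ≠ 0 ↔ Q.ContainedIn I.G) ?_)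
      (fun I s s' _ h => h) (fun I s s' s'' _ _ h => h)
    · refine ⟨h.1, h.2.2.1, fun ρ hρ => (h.2.2.2 ρ hρ).trans ?_⟩
      rw [Q.containedIn_iff]
      constructor
      · rintro ⟨ρ', -, -, f, hf, -⟩
        exact ⟨f, hf⟩
      · rintro ⟨f, hf⟩
        exact ⟨f, hf.lt, by simp, f, hf, fun _ _ => rfl⟩
    · rintro I s s' s'' _ h rfl
      rw [State.setVar_var_self]
      have h1 := h.2.2.2 (fun _ => 0) fun _ => I.pos
      rw [Finset.toList_empty] at h1
      refine Iff.trans h1 ?_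
      rw [Q.containedIn_iff]
      constructor
      · rintro ⟨ρ', -, -, f, hf, -⟩
        exact ⟨f, hf⟩
      · rintro ⟨f, hf⟩
        exact ⟨f, hf.lt, by simp, f, hf, fun _ _ => rfl⟩
  obtain ⟨d, K, hall⟩ := hall
  -- The empty graph is treated separately: there variable `0`, which holds `n = 0`, already is the
  -- negative answer. The exponent `d + 1` makes the test fit, and `2` is its cost.
  refine ⟨.branch (.var 0) (.seq matrixCmd (.seq c (.assign 0 (.load τ (.const 0))))) .skip,
    d + 1, K + 2, fun n G adj hadj => ?_⟩
  have hvar : (detectionInput adj).var 0 = n := by simp [detectionInput]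
  have hfit : (Expr.var 0).Fits ((n + 2) ^ (d + 1)) (detectionInput adj) := by
    rw [Expr.Fits, hvar]
    exact lt_of_lt_of_le (by omega) (Nat.le_self_pow (by omega) (n + 2))
  rcases Nat.eq_zero_or_pos n with rfl | hn
  · refine ⟨_, _, .branch_false hfit hvar (.skip _), ?_, fun h => absurd h (by omega)⟩
    rw [hvar]
    obtain ⟨a, ha⟩ := t.verts_nonempty
    exact iff_of_false (fun h => h rfl) fun ⟨f, _⟩ => (f ⟨a, ha⟩).elim0
  · obtain ⟨τ', s', hx, hτ', hs'⟩ := hall ⟨n, hn, G, adj, hadj⟩ _ rfl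
    refine ⟨_, s', .branch_true hfit (by rw [Expr.eval, hvar]; omega)
      (hx.mono (pow_le_pow_size n (Nat.le_succ d))), hs', fun _ => ?_⟩
    have h1 := hpos ⟨n, hn, G, adj, hadj⟩
    simp only [Expr.cost] at h1 hτ' ⊢
    push_cast
    linarith

end Solutions

theorem mainTheorem3 {α : Type*} [LinearOrder α] (P : OrdPattern α) (p : ℕ)
    (hp : P.HasMergeWidth p) (ω : ℝ) (hω : MatMulInTime ω) :
    (2 ≤ p → P.DetectableInTime fun n _ => (n : ℝ) ^ (ω * p / 2)) ∧
      P.DetectableInTime fun n m => (n : ℝ) ^ (ω * p / 2) + n + m := by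
  obtain ⟨Q, rfl, t, ht⟩ := hp.1
  refine ⟨fun h2 => t.detectableInTime hω (p := p) (fun n m _ => le_rfl)
    (fun h => absurd h (by omega)) ht.le, t.detectableInTime hω (p := p) (fun n m _ => ?_)
    (fun _ n m => ?_) ht.le⟩
  · have h1 : (0 : ℝ) ≤ n := Nat.cast_nonneg n
    have h2 : (0 : ℝ) ≤ m := Nat.cast_nonneg m
    linarith
  · have := Real.rpow_nonneg (Nat.cast_nonneg n : (0 : ℝ) ≤ n) (ω * p / 2)
    linarith
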